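/- Let $L$ be a positive definite even lattice, i.e. a finitely generated free abelian group with a positive definite symmetric bilinear form $\langle\cdot,\cdot\rangle : L\times L\to\mathbb Z$ such that $\langle x,x\rangle$ is even for all $x\in L$. Let $L^\circ=\{\beta\in\mathbb Q\otimes L \mid \langle\alpha,\beta\rangle\in\mathbb Z \text{ for all } \alpha\in L\}$. The set of screeners of $L$ is $$\Phi=\{\beta\in L \mid \langle\beta,\beta\rangle\in 2\mathbb Z,\ \beta\notin 2L,\ 2\beta/\langle\beta,\beta\rangle\in L^\circ\},$$ and a screening system is a linearly independent subset of $\Phi$. A subset $R\subset L$ is said to be the set of roots of a (rescaled) root system of type $X$ if the elements of $R$, with the reflections given by $\langle\cdot,\cdot\rangle$, form a reduced crystallographic root system (in the span of $R$) that has a base whose Cartan matrix is the one of type $X$. For a positive integer $p$ and a simply laced root lattice $K$ (whose roots have norm squared $2$), $\sqrt p\,K$ denotes the group $K$ with its form multiplied by $p$; its roots are its elements of norm squared $2p$. (1) Suppose that $L$ is generated, as an abelian group, by a screening system. Then $L$ is an orthogonal direct sum of sublattices $N_1,\dots,N_s$, each of them isometric to $\sqrt{p_i}\,K_i$ for a positive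 integer $p_i$ and with $K_i$ one of $A_1^n$ ($n\ge 1$ orthogonal copies of $A_1$), $A_n$ ($n\ge 2$), $D_n$ ($n\ge 4$), $E_6$, $E_7$, $E_8$, such that $\Phi$ is the union of the mutually orthogonal sets $\Phi\cap N_i$, and $\Phi\cap N_i$ is the set of roots of a (rescaled) root system of type: $A_1$ if $K_i=A_1$; $B_n$ if $K_i=A_1^n$ with $n\ge2$; $G_2$ if $K_i=A_2$; $C_3$ if $K_i=A_3$; $A_n$ if $K_i=A_n$ with $n>3$; $F_4$ if $K_i=D_4$; $C_n$ if $K_i=D_n$ with $n>4$; $E_n$ if $K_i=E_n$, $n=6,7,8$. In particular, the set of all screeners of $L$ is the set of roots of an orthogonal direct sum of (rescaled) root systems from the list $A_1$, $B_2$, $G_2$, $B_3$, $C_3$, $A_4$, $B_4$, $F_4$, $E_6$, $E_7$, $E_8$, and $A_n$, $C_n$, $B_n$ for $n>4$. (2) Let $p$ be a positive integer. If $L\cong\sqrt p\,A_n$ with $n>3$, or $L\cong\sqrt p\,E_n$ with $n=6,7,8$, then the set of screeners of $L$ is just the set of roots, and it is a root system of type $A_n$, respectively $E_n$. If $L\cong\sqrt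 p\,A_2$ or $L\cong\sqrt p\,A_3$, then the screeners are the roots and exactly $6$ further elements, and together they are the roots of a root system of type $G_2$, respectively $C_3$. If $L\cong\sqrt p\,D_4$, then the screeners are the roots and exactly $24$ further elements, and together they are the roots of a root system of type $F_4$. If $L\cong\sqrt p\,D_n$ with $n>4$, then the screeners are the roots and exactly $2n$ further elements, and together they are the roots of a root system of type $C_n$. If $L\cong(\sqrt p\,A_1)^n$ is the orthogonal direct sum of $n\ge2$ copies of $\sqrt p\,A_1$, then the screeners are the roots of a root system of type $B_n$. -/

import Mathlib

open scoped TensorProduct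

section Lattice

variable {L : Type*} [AddCommGroup L]

/-- The rational dual `L° = {β ∈ ℚ ⊗ L | ⟨α, β⟩ ∈ ℤ for all α ∈ L}` of the lattice `L` with the
bilinear form `B`. -/
def rationalDual (B : LinearMap.BilinForm ℤ L) : Set (ℚ ⊗[ℤ] L) :=
  {β | ∀ α : L, ∃ n : ℤ, (B.baseChange ℚ) ((1 : ℚ) ⊗ₜ[ℤ] α) β = (n : ℚ)}

/-- The set `Φ` of screeners of the lattice `L`: the elements `β` of even norm with `β ∉ 2L` and
`2β/⟨β, β⟩ ∈ L°`. -/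
def screeners (B : LinearMap.BilinForm ℤ L) : Set L :=
  {β | Even (B β β) ∧ (¬ ∃ γ : L, β = 2 • γ) ∧
    ((2 : ℚ) / (B β β : ℚ)) ⊗ₜ[ℤ] β ∈ rationalDual B}

/-- A screening system is a linearly independent set of screeners (in a free abelian group,
independence over `ℤ` is the same as independence over `ℂ` in `ℂ ⊗ L`). -/
def IsScreeningSystem (B : LinearMap.BilinForm ℤ L) (S : Set L) : Prop :=
  S ⊆ screeners B ∧ LinearIndepOn ℤ id S

/-- The types of the irreducible reduced root systems. -/
inductive DynkinType
  | A (n : ℕ)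
  | B (n : ℕ)
  | C (n : ℕ)
  | D (n : ℕ)
  | E₆
  | E₇
  | E₈
  | F₄
  | G₂

/-- The rank (the index). -/
def DynkinType.rank : DynkinType → ℕ
  | .A n => n
  | .B n => n
  | .C n => n
  | .D n => n
  | .E₆ => 6
  | .E₇ => 7
  | .E₈ => 8
  | .F₄ => 4
  | .G₂ => 2

/-- The Cartan matrix, with entries `2⟨αᵢ, αⱼ⟩/⟨αⱼ, αⱼ⟩`: for `B n` the last simple root is short,
for `C n` it is long. -/
def DynkinType.cartan : (t : DynkinType) → Matrix (Fin t.rank) (Fin t.rank) ℤ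
  | .A n => CartanMatrix.A n
  | .B n => CartanMatrix.B n
  | .C n => CartanMatrix.C n
  | .D n => CartanMatrix.D n
  | .E₆ => CartanMatrix.E₆
  | .E₇ => CartanMatrix.E₇
  | .E₈ => CartanMatrix.E₈
  | .F₄ => CartanMatrix.F₄
  | .G₂ => CartanMatrix.G₂

/-- `R` is the set of roots of a (rescaled) root system of type `t`, the reflections being those
of the form `B`: the elements of `R`, with the coroots `2⟨x, ·⟩/⟨x, x⟩`, make up a reduced
crystallographic root system having a base whose Cartan matrix is the one of type `t`. As only the
Cartan matrix is prescribed, the roots are pinned down up to a common scalar. -/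
def IsRootSetOfType (B : LinearMap.BilinForm ℤ L) (R : Set L) (t : DynkinType) : Prop :=
  ∃ (P : RootPairing R ℤ L (Module.Dual ℤ L)) (b : P.Base) (e : b.support ≃ Fin t.rank),
    P.IsReduced ∧
    (∀ x : R, P.root x = (x : L)) ∧
    (∀ (x : R) (y : L), B x x * P.coroot' x y = 2 * B x y) ∧
    b.cartanMatrix.reindex e e = t.cartan

/-- The sublattice `N` of `L` is isometric to the orthogonal direct sum of `m` copies of the
rescaled root lattice `√p K`, where `K` is the root lattice of the simply laced type `t`, with
roots of norm squared `2`: it has a basis with the corresponding Gram matrix. -/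
def IsScaledRootLattice (B : LinearMap.BilinForm ℤ L) (N : Submodule ℤ L) (p m : ℕ)
    (t : DynkinType) : Prop :=
  ∃ b : Module.Basis (Fin m × Fin t.rank) ℤ N, ∀ (i j : Fin m) (k l : Fin t.rank),
    B (b (i, k)) (b (j, l)) = if i = j then (p : ℤ) * t.cartan k l else 0

end Lattice

/-- The types of root systems that occur as sets of screeners. -/
inductive IsListed : DynkinType → Prop
  | A_one : IsListed (.A 1)
  | B_two : IsListed (.B 2)
  | G_two : IsListed .G₂
  | B_three : IsListed (.B 3)
  | C_three : IsListed (.C 3)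
  | B_four : IsListed (.B 4)
  | A_four : IsListed (.A 4)
  | F_four : IsListed .F₄
  | E_six : IsListed .E₆
  | E_seven : IsListed .E₇
  | E_eight : IsListed .E₈
  | A (n : ℕ) (hn : 4 < n) : IsListed (.A n)
  | C (n : ℕ) (hn : 4 < n) : IsListed (.C n)
  | B (n : ℕ) (hn : 4 < n) : IsListed (.B n)

/-- `ScreenerType K m X`: the screeners of `m` orthogonal copies of the (equally rescaled) simply
laced root lattice of type `K` are to form a root system of type `X`. Several copies are
considered together only for `K = A₁`. -/
inductive ScreenerType : DynkinType → ℕ → DynkinType → Prop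
  | A_one : ScreenerType (.A 1) 1 (.A 1)
  | A_one_copies (n : ℕ) (hn : 2 ≤ n) : ScreenerType (.A 1) n (.B n)
  | A_two : ScreenerType (.A 2) 1 .G₂
  | A_three : ScreenerType (.A 3) 1 (.C 3)
  | A (n : ℕ) (hn : 3 < n) : ScreenerType (.A n) 1 (.A n)
  | D_four : ScreenerType (.D 4) 1 .F₄
  | D (n : ℕ) (hn : 4 < n) : ScreenerType (.D n) 1 (.C n)
  | E_six : ScreenerType .E₆ 1 .E₆
  | E_seven : ScreenerType .E₇ 1 .E₇
  | E_eight : ScreenerType .E₈ 1 .E₈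

/-!
In an even lattice `L`, an element `x` is a screener if and only if it is not divisible by `2` and
`⟨x, x⟩` divides `2⟨x, α⟩` for all `α` (`mem_screeners_iff`). The set `Φ` of screeners is
therefore stable under the reflections in its elements (`reflect_mem_screeners`), and it is a
reduced root system. To determine its type, it suffices to give independent screeners with the
right Cartan matrix in which all screeners and all coroots are integral combinations: that the
coefficients of a screener all have the same sign then follows (`isRootSetOfType_of_base`).

In a root lattice `√p K` the inner products are divisible by `p` and the norms by `2p`, and the
Cauchy–Schwarz inequality shows that the screeners are the elements `x` of norm `2kp` with inner
products divisible by `kp`, for `k = 1, 2, 3` (`RootGenerators.mem_screeners_iff`). For `k = 1`,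
these are the roots. For `k = 2, 3`, they come from elements of norm `2/k` of the dual lattice of
`K`, and they are found in coordinates: those of `ℤⁿ⁺¹` for `Aₙ` (`false_of_sum_sq`), those of
`ℤⁿ` for `Dₙ`, including `A₃ = D₃` (`IsLongPath.eq_axisVec`), and the coefficients in the simple
roots, modulo `2` and `3`, for `A₂`, `D₄` and `Eₙ`. All this applies as well to an orthogonal
direct summand `N` of `L`, since the screeners of `L` in `N` are the screeners of `N`
(`IsScreenerSummand`).

Let now `L` be generated by screeners, and let `2p` be the least norm of an element of `Φ`. The
screeners of norm `2p` have inner products in `pℤ`, and unless they are pairwise orthogonal or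
opposite, some of them span a lattice of type `A₂`. A sublattice `M` of type `A`, `D` or `E` can
be enlarged by any screener `x` of norm `2p` neither contained in nor orthogonal to it: if `x` is
changed modulo `M` so as to have inner products at most `0` with the simple roots, the inequality
`⟨x, θ⟩ > -2p` for the highest root `θ` implies that `x` is attached to a single simple root,
which occurs in `θ` with coefficient `1` (`IsRootLike.exists_attached`). The result is a path of
roots with one root attached to it, and the relations given by the affine diagrams `Ẽ₇` and `Ẽ₈`
show that it is again of type `A`, `D` or `E` (`IsRootFork.exists_span`). A maximal `M` contains
or is orthogonal to all screeners of norm `2p`, and it turns out that the same is true of the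
longer screeners (`IsReflectionStable.separates`). Hence `M` is an orthogonal direct summand, and
one goes on with the screeners orthogonal to it (`exists_components`).
-/

/-! ### Screeners in terms of the form -/

section Screeners

variable {L : Type*} [AddCommGroup L] {B : LinearMap.BilinForm ℤ L}

theorem eq_zero_of_form_self_nonpos (hpos : ∀ x : L, x ≠ 0 → 0 < B x x) {x : L}
    (h : B x x ≤ 0) : x = 0 := by
  by_contra hx
  have := hpos x hx
  omega

theorem form_self_nonneg (hpos : ∀ x : L, x ≠ 0 → 0 < B x x) (x : L) : 0 ≤ B x x := by
  by_cases h : x = 0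
  · simp [h]
  · exact (hpos x h).le

/-- The Cauchy–Schwarz inequality, in the strict form for non-parallel vectors. -/
theorem form_sq_lt_of_smul_ne (hsymm : B.IsSymm) (hpos : ∀ x : L, x ≠ 0 → 0 < B x x) {x y : L}
    (h : B x x • y ≠ B x y • x) : B x y ^ 2 < B x x * B y y := by
  have hx : x ≠ 0 := by rintro rfl; simp at h
  have h1 := hpos _ (sub_ne_zero.mpr h)
  have h2 := hpos x hx
  have h3 : B y x = B x y := hsymm.eq y x
  simp only [map_sub, LinearMap.sub_apply, map_smul, LinearMap.smul_apply, smul_eq_mul, h3] at h1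
  have h4 : B x x * (B x x * B y y - B x y ^ 2) > 0 := by nlinarith
  nlinarith [pos_of_mul_pos_right h4 h2.le]

theorem eq_or_eq_neg_of_form_sq [Module.Free ℤ L] (hsymm : B.IsSymm)
    (hpos : ∀ x : L, x ≠ 0 → 0 < B x x) {x y : L} (hxy : B x x = B y y)
    (h : B x x ^ 2 ≤ B x y ^ 2) : y = x ∨ y = -x := by
  by_cases hx : x = 0
  · subst hx
    left
    exact eq_zero_of_form_self_nonpos hpos (by simp at hxy; omega)
  have h2 := hpos x hx
  have h1 : B x x • y = B x y • x := by
    by_contra hne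
    have := form_sq_lt_of_smul_ne hsymm hpos hne
    rw [← hxy] at this
    nlinarith
  have h3 : B x y = B x x ∨ B x y = - B x x := by
    have := congrArg (B y) h1
    simp only [map_smul, smul_eq_mul, ← hxy, show B y x = B x y from hsymm.eq y x] at this
    exact sq_eq_sq_iff_eq_or_eq_neg.mp (by rw [sq, sq]; exact this.symm)
  rcases h3 with h3 | h3
  · left
    rw [h3] at h1
    exact smul_right_injective L h2.ne' h1
  · right
    rw [h3] at h1
    refine smul_right_injective L h2.ne' ?_
    simp only [h1, neg_smul, smul_neg]

/-- Screeners of an even lattice, without the passage to `ℚ ⊗ L`. -/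
theorem mem_screeners_iff (hpos : ∀ x : L, x ≠ 0 → 0 < B x x) (hsymm : B.IsSymm)
    (heven : ∀ x : L, Even (B x x)) {x : L} :
    x ∈ screeners B ↔ (∀ γ : L, x ≠ 2 • γ) ∧ ∀ α : L, B x x ∣ 2 * B x α := by
  have key : (∀ γ : L, x ≠ 2 • γ) →
      (((2 : ℚ) / (B x x : ℚ)) ⊗ₜ[ℤ] x ∈ rationalDual B ↔ ∀ α : L, B x x ∣ 2 * B x α) := by
    intro h
    have hx : x ≠ 0 := by rintro rfl; exact h 0 (by simp)
    have hq : (B x x : ℚ) ≠ 0 := by exact_mod_cast (hpos x hx).ne'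
    refine forall_congr' fun α => ?_
    have : B α x = B x α := hsymm.eq α x
    rw [LinearMap.BilinForm.baseChange_tmul, this]
    constructor
    · rintro ⟨n, hn⟩
      refine ⟨n, ?_⟩
      have h2 : (2 * B x α : ℚ) = B x x * n := by
        rw [← hn]
        simp
        field_simp
      exact_mod_cast h2
    · rintro ⟨n, hn⟩
      refine ⟨n, ?_⟩
      have h2 : (2 * B x α : ℚ) = B x x * n := by exact_mod_cast hn
      simp
      field_simp
      linarith
  constructor
  · rintro ⟨_, h2, h3⟩
    have h2' : ∀ γ : L, x ≠ 2 • γ := fun γ h => h2 ⟨γ, h⟩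
    exact ⟨h2', (key h2').mp h3⟩
  · rintro ⟨h2, h3⟩
    exact ⟨heven x, fun ⟨γ, h⟩ => h2 γ h, (key h2).mpr h3⟩

/-- The reflection in a reflective vector `x` preserves the norm. -/
theorem form_reflect (hsymm : B.IsSymm) {x y : L} {m : ℤ}
    (h : 2 * B x y = m * B x x) : B (y - m • x) (y - m • x) = B y y := by
  have h3 : B y x = B x y := hsymm.eq y x
  simp only [map_sub, LinearMap.sub_apply, map_smul, LinearMap.smul_apply, smul_eq_mul, h3]
  linear_combination (-m) * h

/-- The reflections in screeners preserve the set of screeners. -/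
theorem reflect_mem_screeners (hpos : ∀ x : L, x ≠ 0 → 0 < B x x) (hsymm : B.IsSymm)
    (heven : ∀ x : L, Even (B x x)) {x y : L} (hx : x ∈ screeners B) (hy : y ∈ screeners B)
    {m : ℤ} (h : 2 * B x y = m * B x x) : y - m • x ∈ screeners B := by
  rw [mem_screeners_iff hpos hsymm heven] at hx hy ⊢
  have hx0 : x ≠ 0 := by rintro rfl; exact hx.1 0 (by simp)
  have hq := (hpos x hx0).ne'
  have h3 : B y x = B x y := hsymm.eq y x
  constructor
  · intro γ hγ
    obtain ⟨n, hn⟩ := hx.2 γ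
    have h4 : m + 2 * n = 0 := by
      have h5 : B x (y - m • x) = B x (2 • γ) := by rw [hγ]
      simp only [map_sub, map_smul, smul_eq_mul, map_nsmul, nsmul_eq_mul] at h5
      have : (m + 2 * n) * B x x = 0 := by
        push_cast at h5
        linear_combination h - 2 * h5 - 2 * hn
      exact (mul_eq_zero.mp this).resolve_right hq
    refine hy.1 (γ - n • x) ?_
    have h6 : m = -(2 * n) := by omega
    rw [smul_sub, ← hγ, h6]
    module
  · intro α
    rw [form_reflect hsymm h]
    obtain ⟨n, hn⟩ := hx.2 α
    have h4 := hy.2 (α - n • x)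
    have h5 : B (y - m • x) α = B y (α - n • x) := by
      simp only [map_sub, LinearMap.sub_apply, map_smul, LinearMap.smul_apply, smul_eq_mul, h3]
      refine mul_right_injective₀ hq ?_
      dsimp only
      refine mul_right_injective₀ (two_ne_zero) ?_
      dsimp only
      linear_combination (2 * B x α) * h - (2 * B x y) * hn
    rw [h5]
    exact h4

/-- Parallel screeners agree up to sign, since screeners are not divisible by `2`. -/
theorem eq_or_eq_neg_of_parallel [Module.Free ℤ L] (hpos : ∀ x : L, x ≠ 0 → 0 < B x x)
    (hsymm : B.IsSymm) {x y : L}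
    (hx : (∀ γ : L, x ≠ 2 • γ) ∧ ∀ α : L, B x x ∣ 2 * B x α)
    (hy : (∀ γ : L, y ≠ 2 • γ) ∧ ∀ α : L, B y y ∣ 2 * B y α)
    (h : B x x • y = B x y • x) : x = y ∨ x = -y := by
  have h3 : B y x = B x y := hsymm.eq y x
  have hx0 : x ≠ 0 := by rintro rfl; exact hx.1 0 (by simp)
  have hy0 : y ≠ 0 := by rintro rfl; exact hy.1 0 (by simp)
  have hqx := hpos x hx0
  have hqy := hpos y hy0
  obtain ⟨m, hm⟩ := hx.2 y
  obtain ⟨n, hn⟩ := hy.2 x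
  rw [h3] at hn
  have hmy : (2 : ℤ) • y = m • x := by
    refine smul_right_injective L hqx.ne' ?_
    dsimp only
    rw [smul_comm, h, smul_smul, smul_smul, hm]
  have hnx : (2 : ℤ) • x = n • y := by
    have : B x y ^ 2 = B x x * B y y := by
      have := congrArg (B y) h
      simp only [map_smul, smul_eq_mul, h3] at this
      linarith
    have hmn : m * n = 4 := by
      have : B x x * B y y * (m * n) = B x x * B y y * 4 := by
        linear_combination (-B y y * n) * hm - (2 * B x y) * hn + 4 * this
      exact mul_left_cancel₀ (mul_pos hqx hqy).ne' this
    have h5 := congrArg (fun z => n • z) hmy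
    simp only [smul_smul] at h5
    rw [mul_comm n m, hmn] at h5
    refine smul_right_injective L (two_ne_zero (α := ℤ)) ?_
    dsimp only
    rw [smul_smul, smul_smul]
    exact h5.symm.trans (by rw [mul_comm])
  have hmn : m * n = 4 := by
    have h5 := congrArg (fun z => n • z) hmy
    simp only [smul_smul] at h5
    have h6 : (4 - n * m) • x = 0 := by
      rw [sub_smul, ← h5, mul_comm n 2, mul_smul, ← hnx, smul_smul]
      simp
    have := (smul_eq_zero.mp h6).resolve_right hx0
    linarith
  have hm' : m ∣ 4 := ⟨n, hmn.symm⟩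
  have hmle : m ≤ 4 := Int.le_of_dvd (by norm_num) hm'
  have hmge : -4 ≤ m := by
    have : -m ∣ 4 := (neg_dvd).mpr hm'
    have := Int.le_of_dvd (by norm_num) this
    omega
  have inj := smul_right_injective L (two_ne_zero (α := ℤ))
  have two : ∀ z : L, (2 : ℤ) • z = 2 • z := fun z => by norm_cast
  have cases : m = 1 ∨ m = -1 ∨ m = 2 ∨ m = -2 ∨ m = 4 ∨ m = -4 := by
    have h0 : m ≠ 0 := by rintro rfl; omega
    have h3 : m ≠ 3 := by rintro rfl; omega
    have h3' : m ≠ -3 := by rintro rfl; omega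
    omega
  rcases cases with rfl | rfl | rfl | rfl | rfl | rfl
  · exact (hx.1 y (by rw [← two, hmy, one_smul])).elim
  · exact (hx.1 (-y) (by rw [← two, smul_neg, hmy]; simp)).elim
  · exact Or.inl (inj hmy).symm
  · refine Or.inr (inj ?_)
    dsimp only
    rw [smul_neg, hmy]; module
  · refine (hy.1 x (inj ?_)).elim
    dsimp only
    rw [hmy]; module
  · refine (hy.1 (-x) (inj ?_)).elim
    dsimp only
    rw [hmy]; module

end Screeners

/-! ### Root systems from simple roots -/

section RootSets

variable {L : Type*} [AddCommGroup L] {B : LinearMap.BilinForm ℤ L}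

theorem DynkinType.cartan_diag (t : DynkinType) (i : Fin t.rank) : t.cartan i i = 2 := by
  cases t
  case E₆ => exact CartanMatrix.E₆_diag i
  case E₇ => exact CartanMatrix.E₇_diag i
  case E₈ => exact CartanMatrix.E₈_diag i
  case F₄ => exact CartanMatrix.F₄_diag i
  case G₂ => exact CartanMatrix.G₂_diag i
  case A n => exact congrFun (CartanMatrix.A_diag n) i
  case B n => exact CartanMatrix.B_diag n i
  case C n => exact CartanMatrix.C_diag n i
  case D n => exact CartanMatrix.D_diag n i

theorem DynkinType.cartan_nonpos (t : DynkinType) {i j : Fin t.rank} (h : i ≠ j) :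
    t.cartan i j ≤ 0 := by
  cases t
  case A n => exact CartanMatrix.A_apply_le_zero_of_ne n i j h
  case B n => exact CartanMatrix.B_off_diag_nonpos n i j h
  case C n => exact CartanMatrix.C_off_diag_nonpos n i j h
  case D n => exact CartanMatrix.D_off_diag_nonpos n i j h
  case E₆ => exact CartanMatrix.E₆_off_diag_nonpos i j h
  case E₇ => exact CartanMatrix.E₇_off_diag_nonpos i j h
  case E₈ => exact CartanMatrix.E₈_off_diag_nonpos i j h
  case F₄ => exact CartanMatrix.F₄_off_diag_nonpos i j h
  case G₂ => exact CartanMatrix.G₂_off_diag_nonpos i j h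

theorem form_sum_sum {ι : Type*} [Fintype ι] (b : ι → L) (c d : ι → ℤ) :
    B (∑ i, c i • b i) (∑ j, d j • b j) = ∑ i, ∑ j, c i * d j * B (b i) (b j) := by
  simp only [map_sum, LinearMap.sum_apply, map_smul, LinearMap.smul_apply, smul_eq_mul,
    Finset.mul_sum, mul_assoc]
  rw [Finset.sum_comm]
  refine Finset.sum_congr rfl fun i _ => Finset.sum_congr rfl fun j _ => ?_
  ring

/-- A double sum with symmetric terms is divisible by `q` if its diagonal terms and twice its
off-diagonal terms are. -/
theorem dvd_sum_sum_of_symm {ι : Type*} (s : Finset ι) (f : ι → ι → ℤ) (q : ℤ)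
    (hf : ∀ i j, f i j = f j i) (hd : ∀ i, q ∣ f i i) (ho : ∀ i j, q ∣ 2 * f i j) :
    q ∣ ∑ i ∈ s, ∑ j ∈ s, f i j := by
  classical
  induction s using Finset.induction_on with
  | empty => simp
  | insert a s ha ih =>
    have : ∑ i ∈ insert a s, ∑ j ∈ insert a s, f i j =
        f a a + ∑ j ∈ s, 2 * f a j + ∑ i ∈ s, ∑ j ∈ s, f i j := by
      simp only [Finset.sum_insert ha, Finset.sum_add_distrib]
      rw [Finset.sum_congr rfl fun i _ => hf i a, ← Finset.mul_sum]
      ring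
    rw [this]
    exact dvd_add (dvd_add (hd a) (Finset.dvd_sum fun j _ => ho a j)) ih

/-- If the coroot of `x = ∑ cᵢ bᵢ` is an integral combination of the coroots of an obtuse system of
reflective vectors `bᵢ`, then so are the "coroots" of the positive and of the negative part of `x`,
whence their norms are divisible by that of `x`. As their sum is at most the norm of `x`, one of
the parts vanishes. -/
theorem sign_coherent_of_obtuse (hpos : ∀ x : L, x ≠ 0 → 0 < B x x) (hsymm : B.IsSymm)
    {ι : Type*} [Fintype ι] {b : ι → L} (hli : LinearIndependent ℤ b)
    (hdvd : ∀ i, ∀ α, B (b i) (b i) ∣ 2 * B (b i) α) (hobt : ∀ i j, i ≠ j → B (b i) (b j) ≤ 0)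
    {x : L} {c : ι → ℤ} (hx : x = ∑ i, c i • b i)
    (hc : ∀ i, B x x ∣ c i * B (b i) (b i)) : (∀ i, 0 ≤ c i) ∨ (∀ i, c i ≤ 0) := by
  have part : ∀ d : ι → ℤ, (∀ i, d i = c i ∨ d i = -c i ∨ d i = 0) → d ≠ 0 →
      B x x ≤ B (∑ i, d i • b i) (∑ i, d i • b i) := by
    intro d hd hd0
    refine Int.le_of_dvd (hpos _ fun h => hd0 ?_) ?_
    · exact funext fun i => Fintype.linearIndependent_iff.mp hli d h i
    · have hd' : ∀ i, B x x ∣ d i * B (b i) (b i) := by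
        intro i
        rcases hd i with h | h | h
        · rw [h]; exact hc i
        · rw [h, neg_mul]; exact (hc i).neg_right
        · rw [h, zero_mul]; exact dvd_zero _
      rw [form_sum_sum]
      refine dvd_sum_sum_of_symm _ _ _ (fun i j => ?_) (fun i => ?_) (fun i j => ?_)
      · rw [show B (b i) (b j) = B (b j) (b i) from hsymm.eq _ _]; ring
      · rw [mul_assoc]; exact (hd' i).mul_left _
      · have h1 : d i * B (b i) (b i) ∣ d i * (2 * B (b i) (b j)) := mul_dvd_mul_left _ (hdvd i _)
        have h2 := ((hd' i).trans h1).mul_left (d j)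
        rw [show 2 * (d i * d j * B (b i) (b j)) = d j * (d i * (2 * B (b i) (b j))) by ring]
        exact h2
  by_contra hcon
  push Not at hcon
  obtain ⟨⟨i, hi⟩, ⟨j, hj⟩⟩ := hcon
  have hu := part (fun i => max (c i) 0) (fun i => by rcases max_choice (c i) 0 with h | h <;> simp [h])
    (fun h => by have := congrFun h j; simp at this; omega)
  have hv := part (fun i => max (-c i) 0)
    (fun i => by rcases max_choice (-c i) 0 with h | h <;> simp [h])
    (fun h => by have := congrFun h i; simp at this; omega)
  set u := ∑ i, max (c i) 0 • b i with hu'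
  set v := ∑ i, max (-c i) 0 • b i with hv'
  have huv : x = u - v := by
    rw [hx, hu', hv', ← Finset.sum_sub_distrib]
    refine Finset.sum_congr rfl fun i _ => ?_
    rw [← sub_smul]
    congr 1
    omega
  have huv' : B u v ≤ 0 := by
    rw [hu', hv', form_sum_sum]
    refine Finset.sum_nonpos fun i _ => Finset.sum_nonpos fun j _ => ?_
    by_cases hij : i = j
    · subst hij
      rcases le_total (c i) 0 with h | h <;> simp [h]
    · exact mul_nonpos_of_nonneg_of_nonpos
        (mul_nonneg (le_max_right _ _) (le_max_right _ _)) (hobt i j hij)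
  have hxx : B x x = B u u + B v v - 2 * B u v := by
    rw [huv]
    simp only [map_sub, LinearMap.sub_apply, show B v u = B u v from hsymm.eq _ _]
    ring
  have hx0 : x ≠ 0 := by
    rintro rfl
    have := Fintype.linearIndependent_iff.mp hli c hx.symm i
    omega
  have := hpos x hx0
  omega

/-- A set of primitive reflective vectors closed under its reflections is the set of roots of a
root system of type `t`, if it contains independent vectors with the right Cartan matrix in which
all roots and all coroots are integral combinations. -/
theorem isRootSetOfType_of_base [Module.Finite ℤ L] [Module.Free ℤ L]
    (hpos : ∀ x : L, x ≠ 0 → 0 < B x x) (hsymm : B.IsSymm)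
    {R : Set L} {t : DynkinType} (b : Fin t.rank → L)
    (hR : ∀ x ∈ R, (∀ γ : L, x ≠ 2 • γ) ∧ ∀ α, B x x ∣ 2 * B x α)
    (hrefl : ∀ x ∈ R, ∀ y ∈ R, ∀ m : ℤ, 2 * B x y = m * B x x → y - m • x ∈ R)
    (hb : ∀ i, b i ∈ R) (hli : LinearIndependent ℤ b)
    (hc : ∀ x ∈ R, ∃ c : Fin t.rank → ℤ, x = ∑ i, c i • b i ∧ ∀ i, B x x ∣ c i * B (b i) (b i))
    (hcartan : ∀ i j, B (b j) (b j) * t.cartan i j = 2 * B (b i) (b j)) :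
    IsRootSetOfType B R t := by
  classical
  have hne : ∀ x ∈ R, x ≠ 0 := by
    rintro x hx rfl
    exact (hR 0 hx).1 0 (by simp)
  have hq : ∀ x ∈ R, 0 < B x x := fun x hx => hpos x (hne x hx)
  have hB : LinearMap.Nondegenerate B :=
    ⟨fun x hx => eq_zero_of_form_self_nonpos hpos (hx x).le,
      fun x hx => eq_zero_of_form_self_nonpos hpos (hx x).le⟩
  have href : ∀ x ∈ R, LinearMap.IsReflective B x := fun x hx =>
    ⟨.of_ne_zero (hq x hx).ne', (hR x hx).2⟩
  let P₀ := RootPairing.ofBilinear B hB (LinearMap.BilinForm.isSymm_iff.mp hsymm) (IsRegular.of_ne_zero two_ne_zero)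
  let cor : ∀ x : R, Module.Dual ℤ L := fun x => (href x x.2).coroot
  have hcor : ∀ (x : R) (y : L), B x x * cor x y = 2 * B x y := fun x y =>
    LinearMap.IsReflective.apply_self_mul_coroot_apply B _
  have hmem : ∀ x y : R, (y : L) - cor x y • (x : L) ∈ R := fun x y =>
    hrefl x x.2 y y.2 _ (by rw [← hcor, mul_comm])
  let root : R ↪ L := Function.Embedding.subtype _
  let coroot : R ↪ Module.Dual ℤ L :=
    ⟨cor, fun x y hxy => Subtype.ext <| by
      have := P₀.coroot.injective (a₁ := ⟨x, href x x.2⟩) (a₂ := ⟨y, href y y.2⟩) hxy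
      exact congrArg (fun z => z.1) this⟩
  have hinv : ∀ x y : R, (y : L) - cor x y • (x : L) -
      cor x ((y : L) - cor x y • (x : L)) • (x : L) = y := by
    intro x y
    rw [map_sub, map_smul, LinearMap.IsReflective.coroot_apply_self B (href x x.2), smul_eq_mul]
    module
  let P : RootPairing R ℤ L (Module.Dual ℤ L) :=
    { toLinearMap := Module.Dual.eval ℤ L
      root := root
      coroot := coroot
      root_coroot_two := fun x => LinearMap.IsReflective.coroot_apply_self B (href x x.2)
      reflectionPerm := fun x => Function.Involutive.toPerm (fun y => ⟨_, hmem x y⟩)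
        fun y => Subtype.ext (hinv x y)
      reflectionPerm_root := fun x y => rfl
      reflectionPerm_coroot := fun x y =>
        P₀.reflectionPerm_coroot ⟨x, href x x.2⟩ ⟨y, href y y.2⟩ }
  have hProot : ∀ x : R, P.root x = x := fun x => rfl
  have hPcor : ∀ (x : R) (y : L), B x x * P.coroot' x y = 2 * B x y := hcor
  have hPpair : ∀ x y : R, B y y * P.pairing x y = 2 * B y x := fun x y => hcor y x
  have hPcor' : ∀ (x : R) (y : L), B x x * P.coroot x y = 2 * B x y := hcor
  -- the simple roots, as a subset of `R`
  let b' : Fin t.rank → R := fun i => ⟨b i, hb i⟩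
  have hb'inj : Function.Injective b' := fun i j h =>
    hli.injective (congrArg (fun z : R => (z : L)) h)
  have himg : ((Finset.univ.image b' : Finset R) : Set R) = Set.range b' := by simp
  have hb'mem : ∀ i, b' i ∈ ((Finset.univ.image b' : Finset R) : Set R) := fun i => by simp
  have hcoind : LinearIndependent ℤ (P.coroot ∘ b') := by
    rw [Fintype.linearIndependent_iff]
    intro g hg
    have h1 : ∀ y : L, ∑ i, g i * P.coroot (b' i) y = 0 := by
      intro y
      have := LinearMap.congr_fun hg y
      simpa using this
    -- multiplying by the product of all the norms turns coroots into multiples of the roots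
    let q : Fin t.rank → ℤ := fun i => ∏ j ∈ Finset.univ.erase i, B (b j) (b j)
    have hqi : ∀ i, q i * B (b i) (b i) = ∏ j, B (b j) (b j) := fun i =>
      Finset.prod_erase_mul _ _ (Finset.mem_univ i)
    have h2 : ∑ i, (g i * q i) • b i = 0 := by
      refine eq_zero_of_form_self_nonpos hpos (le_of_eq ?_)
      set z := ∑ i, (g i * q i) • b i with hz
      have h3 : 2 * B z z = (∏ j, B (b j) (b j)) * ∑ i, g i * P.coroot (b' i) z := by
        nth_rewrite 1 [hz]
        simp only [map_sum, LinearMap.sum_apply, map_smul, LinearMap.smul_apply, smul_eq_mul,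
          Finset.mul_sum]
        refine Finset.sum_congr rfl fun i _ => ?_
        rw [← hqi i]
        linear_combination (-g i * q i) * hPcor' (b' i) z
      rw [h1, mul_zero] at h3
      omega
    intro i
    have := Fintype.linearIndependent_iff.mp hli _ h2 i
    refine (mul_eq_zero.mp this).resolve_right ?_
    exact Finset.prod_ne_zero_iff.mpr fun j _ => (hq _ (hb j)).ne'
  have hobt : ∀ i j, i ≠ j → B (b i) (b j) ≤ 0 := by
    intro i j hij
    have h1 := hcartan i j
    have h2 := t.cartan_nonpos hij
    have h3 := hq _ (hb j)
    nlinarith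
  have hroots : ∀ x : R, P.root x ∈ AddSubmonoid.closure (P.root '' (Finset.univ.image b')) ∧
        P.coroot x ∈ AddSubmonoid.closure (P.coroot '' (Finset.univ.image b')) ∨
      -P.root x ∈ AddSubmonoid.closure (P.root '' (Finset.univ.image b')) ∧
        -P.coroot x ∈ AddSubmonoid.closure (P.coroot '' (Finset.univ.image b')) := by
    intro x
    obtain ⟨c, hxc, hcd⟩ := hc x x.2
    choose d hd using hcd
    have hqx := hq x x.2
    have hxd : P.coroot x = ∑ i, d i • P.coroot (b' i) := by
      ext y
      refine mul_left_cancel₀ hqx.ne' ?_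
      rw [hPcor', LinearMap.sum_apply, Finset.mul_sum]
      nth_rewrite 1 [hxc]
      simp only [map_sum, LinearMap.sum_apply, map_smul, LinearMap.smul_apply, smul_eq_mul,
        Finset.mul_sum]
      refine Finset.sum_congr rfl fun i _ => ?_
      have := hPcor' (b' i) y
      linear_combination (-c i) * this + (P.coroot (b' i) y) * hd i
    have mem_root : ∀ e : Fin t.rank → ℤ, (∀ i, 0 ≤ e i) →
        ∑ i, e i • b i ∈ AddSubmonoid.closure (P.root '' (Finset.univ.image b')) := by
      intro e he
      refine sum_mem fun i _ => ?_
      obtain ⟨k, hk⟩ := Int.eq_ofNat_of_zero_le (he i)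
      rw [hk, natCast_zsmul]
      exact AddSubmonoid.nsmul_mem _ (AddSubmonoid.subset_closure (Set.mem_image_of_mem _ (hb'mem i))) k
    have mem_coroot : ∀ e : Fin t.rank → ℤ, (∀ i, 0 ≤ e i) →
        ∑ i, e i • P.coroot (b' i) ∈
          AddSubmonoid.closure (P.coroot '' (Finset.univ.image b')) := by
      intro e he
      refine sum_mem fun i _ => ?_
      obtain ⟨k, hk⟩ := Int.eq_ofNat_of_zero_le (he i)
      rw [hk, natCast_zsmul]
      exact AddSubmonoid.nsmul_mem _ (AddSubmonoid.subset_closure (Set.mem_image_of_mem _ (hb'mem i))) k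
    have hsign := sign_coherent_of_obtuse hpos hsymm hli (fun i => (hR _ (hb i)).2) hobt hxc
      (fun i => ⟨d i, hd i⟩)
    have hd' : ∀ i, ∀ s : ℤ, 0 ≤ s * c i → 0 ≤ s * d i := by
      intro i s hs
      have h1 := hd i
      have h2 := hq _ (hb i)
      have h3 : 0 ≤ B x x * (s * d i) := by
        have : B x x * (s * d i) = s * c i * B (b i) (b i) := by linear_combination (-s) * h1
        rw [this]
        exact mul_nonneg hs h2.le
      exact nonneg_of_mul_nonneg_right h3 hqx
    rcases hsign with hs | hs
    · left
      refine ⟨?_, ?_⟩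
      · rw [hProot, hxc]; exact mem_root c hs
      · rw [hxd]
        exact mem_coroot d fun i => by simpa using hd' i 1 (by simpa using hs i)
    · right
      refine ⟨?_, ?_⟩
      · rw [hProot, hxc, ← Finset.sum_neg_distrib]
        simp only [← neg_smul]
        exact mem_root (fun i => -c i) fun i => by have := hs i; omega
      · rw [hxd, ← Finset.sum_neg_distrib]
        simp only [← neg_smul]
        exact mem_coroot (fun i => -d i) fun i => by
          simpa using hd' i (-1) (by have := hs i; omega)
  let base : P.Base :=
    { support := Finset.univ.image b'
      linearIndepOn_root := by
        rw [himg, linearIndepOn_range_iff hb'inj]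
        exact hli
      linearIndepOn_coroot := by
        rw [himg, linearIndepOn_range_iff hb'inj]
        exact hcoind
      root_mem_or_neg_mem := fun x => (hroots x).imp And.left And.left
      coroot_mem_or_neg_mem := fun x => (hroots x).imp And.right And.right }
  let e₀ : Fin t.rank ≃ base.support := Equiv.ofBijective
    (fun i => ⟨b' i, Finset.mem_image_of_mem _ (Finset.mem_univ i)⟩)
    ⟨fun i j h => hb'inj (congrArg (fun z => z.1) h), fun ⟨x, hx⟩ => by
      obtain ⟨i, -, rfl⟩ := Finset.mem_image.mp hx
      exact ⟨i, rfl⟩⟩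
  refine ⟨P, base, e₀.symm, ⟨fun x y hxy => ?_⟩, hProot, hPcor, ?_⟩
  · by_contra hcon
    refine hxy ?_
    rw [LinearIndependent.pair_iff]
    intro s u hsu
    rw [hProot, hProot] at hsu hcon
    have hx := hq x x.2
    have hne' : B x x • (y : L) ≠ B x y • (x : L) := fun h =>
      hcon (eq_or_eq_neg_of_parallel hpos hsymm (hR x x.2) (hR y y.2) h)
    have hu : u = 0 := by
      by_contra hu
      refine hne' (smul_right_injective L hu ?_)
      have h1 : u • (y : L) = -s • (x : L) := by
        rw [neg_smul, eq_neg_iff_add_eq_zero, add_comm]; exact hsu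
      have h2 : u * B x y = -s * B x x := by
        have := congrArg (B x) h1
        simpa using this
      dsimp only
      rw [smul_comm, h1, smul_smul, smul_smul, h2, mul_comm]
    refine ⟨?_, hu⟩
    rw [hu, zero_smul, add_zero] at hsu
    exact (smul_eq_zero.mp hsu).resolve_right (hne x x.2)
  · ext i j
    have h1 := hcartan i j
    have h2 : B (b j) (b j) * P.pairing (b' i) (b' j) = 2 * B (b j) (b i) := hPpair (b' i) (b' j)
    rw [show B (b j) (b i) = B (b i) (b j) from hsymm.eq _ _, ← h1] at h2
    have h3 := mul_left_cancel₀ (hq _ (hb j)).ne' h2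
    have h4 : base.cartanMatrix (e₀ i) (e₀ j) = P.pairing (b' i) (b' j) :=
      RootPairing.Base.algebraMap_cartanMatrixIn_apply ℤ base (e₀ i) (e₀ j)
    simpa [Matrix.reindex_apply] using h4.trans h3

end RootSets

/-! ### Sublattices generated by roots -/

section Summands

variable {L : Type*} [AddCommGroup L] {B : LinearMap.BilinForm ℤ L}

/-- The screeners of `L` in the sublattice `N` are the screeners of the lattice `N`, as is the case
for an orthogonal direct summand. -/
def IsScreenerSummand (B : LinearMap.BilinForm ℤ L) (N : Submodule ℤ L) : Prop :=
  ∀ x ∈ N, x ∈ screeners B ↔ (∀ γ ∈ N, x ≠ 2 • γ) ∧ ∀ α ∈ N, B x x ∣ 2 * B x α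

theorem isScreenerSummand_top (hpos : ∀ x : L, x ≠ 0 → 0 < B x x) (hsymm : B.IsSymm)
    (heven : ∀ x : L, Even (B x x)) : IsScreenerSummand B ⊤ := fun x _ => by
  simp [mem_screeners_iff hpos hsymm heven]

/-- The vectors `aᵢ` generate `N`, and they have norm `2p` and inner products in `pℤ`. -/
structure RootGenerators (B : LinearMap.BilinForm ℤ L) (N : Submodule ℤ L) (p : ℤ)
    {ι : Type*} (a : ι → L) : Prop where
  span_eq : Submodule.span ℤ (Set.range a) = N
  norm_eq : ∀ i, B (a i) (a i) = 2 * p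
  dvd : ∀ i j, p ∣ B (a i) (a j)

namespace RootGenerators

variable {N : Submodule ℤ L} {p : ℤ} {ι : Type*} {a : ι → L}

theorem mem (h : RootGenerators B N p a) (i : ι) : a i ∈ N := by
  rw [← h.span_eq]
  exact Submodule.subset_span ⟨i, rfl⟩

theorem dvd_of_forall (h : RootGenerators B N p a) {x : L} {q : ℤ} (hx : ∀ i, q ∣ B x (a i)) :
    ∀ y ∈ N, q ∣ B x y := by
  intro y hy
  rw [← h.span_eq] at hy
  induction hy using Submodule.span_induction with
  | mem _ h => obtain ⟨i, rfl⟩ := h; exact hx i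
  | zero => simp
  | add u v _ _ hu hv => rw [map_add]; exact dvd_add hu hv
  | smul m u _ hu => rw [map_smul]; exact hu.mul_left m

theorem dvd_form (h : RootGenerators B N p a) (hsymm : B.IsSymm) {x y : L} (hx : x ∈ N)
    (hy : y ∈ N) : p ∣ B x y := by
  refine h.dvd_of_forall (fun i => ?_) y hy
  rw [show B x (a i) = B (a i) x from hsymm.eq _ _]
  exact h.dvd_of_forall (fun j => h.dvd i j) x hx

theorem two_mul_dvd_norm (h : RootGenerators B N p a) (hsymm : B.IsSymm) {x : L} (hx : x ∈ N) :
    2 * p ∣ B x x := by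
  have hx' := hx
  rw [← h.span_eq] at hx'
  induction hx' using Submodule.span_induction with
  | mem _ h' => obtain ⟨i, rfl⟩ := h'; rw [h.norm_eq]
  | zero => simp
  | add u v hu hv hu' hv' =>
    rw [h.span_eq] at hu hv
    simp only [map_add, LinearMap.add_apply, show B v u = B u v from hsymm.eq _ _]
    have := mul_dvd_mul_left 2 (h.dvd_form hsymm hu hv)
    have h' := dvd_add (dvd_add (hu' hu) this) (hv' hv)
    rwa [show B u u + B u v + (B u v + B v v) = B u u + 2 * B u v + B v v by ring]
  | smul m u hu hu' =>
    rw [h.span_eq] at hu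
    simp only [map_smul, LinearMap.smul_apply, smul_eq_mul]
    exact ((hu' hu).mul_left _).mul_left _

/-- The screeners in a lattice generated by vectors of norm `2p` with inner products in `pℤ`: their
norm is `2p`, `4p` or `6p`, by the Cauchy–Schwarz inequality. -/
theorem mem_screeners_iff [Module.Free ℤ L] (h : RootGenerators B N p a) (hp : 0 < p)
    (hpos : ∀ x : L, x ≠ 0 → 0 < B x x) (hsymm : B.IsSymm) (hN : IsScreenerSummand B N)
    {x : L} (hx : x ∈ N) :
    x ∈ screeners B ↔
      ∃ k : ℤ, (k = 1 ∨ k = 2 ∨ k = 3) ∧ B x x = 2 * (k * p) ∧ ∀ y ∈ N, k * p ∣ B x y := by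
  rw [hN x hx]
  constructor
  · rintro ⟨h1, h2⟩
    have hx0 : x ≠ 0 := by rintro rfl; exact h1 0 N.zero_mem (by simp)
    have hq := hpos x hx0
    obtain ⟨t, ht⟩ := h.two_mul_dvd_norm hsymm hx
    have hdvd : ∀ y ∈ N, t * p ∣ B x y := by
      intro y hy
      obtain ⟨n, hn⟩ := h2 y hy
      exact ⟨n, by rw [ht] at hn; linarith⟩
    have ht0 : 0 < t := by
      rw [ht] at hq
      exact pos_of_mul_pos_right hq (by omega)
    refine ⟨t, ?_, by rw [ht]; ring, hdvd⟩
    obtain ⟨i, hi⟩ : ∃ i, B x (a i) ≠ 0 := by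
      by_contra! hcon
      have := h.dvd_of_forall (x := x) (q := 0) (fun i => by rw [hcon i]) x hx
      rw [zero_dvd_iff] at this
      omega
    obtain ⟨m, hm⟩ := hdvd _ (h.mem i)
    have hm0 : m ≠ 0 := by rintro rfl; simp at hm; exact hi hm
    have hm1 : 1 ≤ m ^ 2 := by
      have := sq_nonneg m
      have := pow_ne_zero 2 hm0
      omega
    by_contra hcon
    have ht4 : 4 ≤ t := by omega
    have hpt : 0 < p ^ 2 * t := by positivity
    by_cases hpar : B x x • a i = B x (a i) • x
    · have hsq : B x (a i) ^ 2 = B x x * (2 * p) := by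
        have := congrArg (B (a i)) hpar
        simp only [map_smul, smul_eq_mul, show B (a i) x = B x (a i) from hsymm.eq _ _,
          h.norm_eq] at this
        linarith
      have htm : t * m ^ 2 = 4 := by
        rw [hm, ht] at hsq
        refine mul_left_cancel₀ hpt.ne' ?_
        linear_combination hsq
      have ht4' : t = 4 := by nlinarith
      subst ht4'
      have hm' : m = 1 ∨ m = -1 := by
        have : m ^ 2 = 1 := by omega
        simpa using this
      have hx2 : x = 2 • (m • a i) := by
        refine smul_right_injective L (show (4 * p * m) ≠ 0 by
          rcases hm' with rfl | rfl <;> omega) ?_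
        dsimp only
        have e : (4 * p * m) • x = (2 * p * 4) • a i := by rw [← hm, ← hpar, ht]
        rw [e]
        rcases hm' with rfl | rfl <;> module
      exact h1 _ (N.smul_mem _ (h.mem i)) hx2
    · have := form_sq_lt_of_smul_ne hsymm hpos hpar
      rw [h.norm_eq, hm, ht] at this
      have h3 : p ^ 2 * t * (t * m ^ 2) < p ^ 2 * t * 4 := by nlinarith
      have := lt_of_mul_lt_mul_left h3 hpt.le
      nlinarith
  · rintro ⟨k, hk, hk2, hk3⟩
    constructor
    · rintro γ hγ rfl
      obtain ⟨n, hn⟩ := h.two_mul_dvd_norm hsymm hγ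
      simp only [map_nsmul, LinearMap.smul_apply, nsmul_eq_mul, hn] at hk2
      have : p * (4 * n) = p * k := by push_cast at hk2; linarith
      have := mul_left_cancel₀ hp.ne' this
      omega
    · intro y hy
      rw [hk2]
      exact mul_dvd_mul_left 2 (hk3 y hy)

end RootGenerators

/-- A family of `r` vectors spanning the same sublattice as `r` independent ones is independent. -/
theorem linearIndependent_of_span_eq {r : ℕ} {a b : Fin r → L} (ha : LinearIndependent ℤ a)
    (hab : Submodule.span ℤ (Set.range a) = Submodule.span ℤ (Set.range b)) :
    LinearIndependent ℤ b := by
  have hr : Module.finrank ℤ (Submodule.span ℤ (Set.range b)) = r := by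
    rw [← hab, finrank_span_eq_card ha, Fintype.card_fin]
  have : Module.Finite ℤ (Submodule.span ℤ (Set.range b)) :=
    Module.Finite.span_of_finite ℤ (Set.finite_range b)
  let b' : Fin r → Submodule.span ℤ (Set.range b) := fun i => ⟨b i, Submodule.subset_span ⟨i, rfl⟩⟩
  have h1 : LinearIndependent ℤ b' := by
    refine linearIndependent_of_top_le_span_of_card_eq_finrank ?_ (by simp [hr])
    rintro ⟨x, hx⟩ -
    rw [Submodule.mem_span_range_iff_exists_fun] at hx ⊢
    obtain ⟨c, hc⟩ := hx
    exact ⟨c, Subtype.ext (by simpa [b'] using hc)⟩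
  exact h1.map' (Submodule.subtype _) (Submodule.ker_subtype _)

/-- Generators `b` of `N` that are screeners with the right Cartan matrix are simple roots of
`Φ ∩ N`, if the coroots of all screeners in `N` are integral combinations of their coroots. -/
theorem screeners_inter_isRootSetOfType [Module.Finite ℤ L] [Module.Free ℤ L]
    (hpos : ∀ x : L, x ≠ 0 → 0 < B x x) (hsymm : B.IsSymm) (heven : ∀ x : L, Even (B x x))
    {N : Submodule ℤ L} {t : DynkinType} {a b : Fin t.rank → L} (ha : LinearIndependent ℤ a)
    (haN : Submodule.span ℤ (Set.range a) = N) (hbN : Submodule.span ℤ (Set.range b) = N)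
    (hb : ∀ i, b i ∈ screeners B)
    (hc : ∀ c : Fin t.rank → ℤ, ∑ i, c i • b i ∈ screeners B → ∀ i,
      B (∑ i, c i • b i) (∑ i, c i • b i) ∣ c i * B (b i) (b i))
    (hcartan : ∀ i j, B (b j) (b j) * t.cartan i j = 2 * B (b i) (b j)) :
    IsRootSetOfType B (screeners B ∩ N) t := by
  refine isRootSetOfType_of_base hpos hsymm b
    (fun x hx => (mem_screeners_iff hpos hsymm heven).mp hx.1)
    (fun x hx y hy m h => ⟨reflect_mem_screeners hpos hsymm heven hx.1 hy.1 h,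
      N.sub_mem hy.2 (N.smul_mem _ hx.2)⟩)
    (fun i => ⟨hb i, hbN ▸ Submodule.subset_span ⟨i, rfl⟩⟩)
    (linearIndependent_of_span_eq ha (haN.trans hbN.symm)) (fun x hx => ?_) hcartan
  have hx2 : x ∈ N := hx.2
  rw [← hbN, Submodule.mem_span_range_iff_exists_fun] at hx2
  obtain ⟨c, rfl⟩ := hx2
  exact ⟨c, rfl, hc c hx.1⟩

theorem IsScaledRootLattice.exists_family {N : Submodule ℤ L} {p : ℕ} {t : DynkinType}
    (h : IsScaledRootLattice B N p 1 t) :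
    ∃ a : Fin t.rank → L, LinearIndependent ℤ a ∧ Submodule.span ℤ (Set.range a) = N ∧
      ∀ k l, B (a k) (a l) = (p : ℤ) * t.cartan k l := by
  obtain ⟨b, hb⟩ := h
  let e : Fin t.rank ≃ Fin 1 × Fin t.rank := (Equiv.uniqueProd _ _).symm
  let b' := b.reindex e.symm
  refine ⟨fun k => b' k, b'.linearIndependent.map' _ (Submodule.ker_subtype _), ?_, fun k l => ?_⟩
  · have : Set.range (fun k => (b' k : L)) = N.subtype '' Set.range b' := by
      rw [← Set.range_comp]; rfl
    rw [this, Submodule.span_image, b'.span_eq, Submodule.map_top, Submodule.range_subtype]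
  · have := hb 0 0 k l
    simpa [b', e] using this

theorem isScaledRootLattice_of_family {N : Submodule ℤ L} {p m : ℕ} {t : DynkinType}
    (a : Fin m × Fin t.rank → L) (hli : LinearIndependent ℤ a)
    (hN : Submodule.span ℤ (Set.range a) = N)
    (ha : ∀ i j k l, B (a (i, k)) (a (j, l)) = if i = j then (p : ℤ) * t.cartan k l else 0) :
    IsScaledRootLattice B N p m t := by
  subst hN
  refine ⟨Module.Basis.span hli, fun i j k l => ?_⟩
  rw [Module.Basis.span_apply, Module.Basis.span_apply]
  exact ha i j k l

/-- Families with the Gram matrix of a simply laced type generate the sublattice by roots. -/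
theorem RootGenerators.of_cartan {N : Submodule ℤ L} {p : ℤ} {t : DynkinType}
    {a : Fin t.rank → L} (haN : Submodule.span ℤ (Set.range a) = N)
    (ha : ∀ k l, B (a k) (a l) = p * t.cartan k l) : RootGenerators B N p a :=
  ⟨haN, fun i => by rw [ha, t.cartan_diag, mul_comm], fun i j => by rw [ha]; exact dvd_mul_right _ _⟩

/-- If all the screeners have norm `2p`, the Cartan matrix of the generators is the one of the
screeners. -/
theorem screeners_inter_isRootSetOfType_of_norm [Module.Finite ℤ L] [Module.Free ℤ L]
    (hpos : ∀ x : L, x ≠ 0 → 0 < B x x) (hsymm : B.IsSymm) (heven : ∀ x : L, Even (B x x))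
    {N : Submodule ℤ L} {p : ℤ} (hp : 0 < p) {t : DynkinType} {a : Fin t.rank → L}
    (ha : LinearIndependent ℤ a) (haN : Submodule.span ℤ (Set.range a) = N)
    (hG : ∀ k l, B (a k) (a l) = p * t.cartan k l) (hN : IsScreenerSummand B N)
    (hk : ∀ k : ℤ, (k = 2 ∨ k = 3) → ∀ x ∈ N, B x x = 2 * (k * p) →
      (∀ y ∈ N, k * p ∣ B x y) → False) :
    screeners B ∩ N = {x | x ∈ N ∧ B x x = 2 * p} ∧ IsRootSetOfType B (screeners B ∩ N) t := by
  have hgen := RootGenerators.of_cartan haN hG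
  have hnorm : ∀ x ∈ N, x ∈ screeners B ↔ B x x = 2 * p := by
    intro x hx
    rw [hgen.mem_screeners_iff hp hpos hsymm hN hx]
    constructor
    · rintro ⟨k, hk1, hk2, hk3⟩
      rcases hk1 with rfl | hk1
      · simpa using hk2
      · exact (hk k hk1 x hx hk2 hk3).elim
    · intro h
      exact ⟨1, Or.inl rfl, by simpa using h, fun y hy => by
        simpa using hgen.dvd_form hsymm hx hy⟩
  refine ⟨?_, screeners_inter_isRootSetOfType hpos hsymm heven ha haN haN
    (fun i => (hnorm _ (hgen.mem i)).mpr (hgen.norm_eq i)) (fun c hc i => ?_) fun i j => ?_⟩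
  · ext x
    constructor
    · rintro ⟨h1, h2⟩
      exact ⟨h2, (hnorm x h2).mp h1⟩
    · rintro ⟨h1, h2⟩
      exact ⟨(hnorm x h1).mpr h2, h1⟩
  · have hmem : ∑ i, c i • a i ∈ N := N.sum_mem fun i _ => N.smul_mem _ (hgen.mem i)
    rw [(hnorm _ hmem).mp hc, hgen.norm_eq]
    exact dvd_mul_left _ _
  · rw [hG, hG, t.cartan_diag]
    ring

end Summands

/-! ### Paths of roots -/

section Paths

variable {L : Type*} [AddCommGroup L] {B : LinearMap.BilinForm ℤ L}

/-- The first `n` terms of the sequence `a` have norm `2p` and form a path: consecutive terms have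
inner product `-p`, other ones are orthogonal. They are simple roots of type `Aₙ`, scaled by `p`. -/
structure IsRootPath (B : LinearMap.BilinForm ℤ L) (p : ℤ) (n : ℕ) (a : ℕ → L) : Prop where
  norm_eq : ∀ i < n, B (a i) (a i) = 2 * p
  succ_eq : ∀ i, i + 1 < n → B (a i) (a (i + 1)) = -p
  far_eq : ∀ i j, i + 1 < j → j < n → B (a i) (a j) = 0

/-- The consecutive differences `c₀, c₁ - c₀, c₂ - c₁, …`. For the coefficients `c` of a vector of
`Aₙ` in the simple roots, these are its coordinates in `ℤⁿ⁺¹`. -/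
def pathDiff (c : ℕ → ℤ) : ℕ → ℤ
  | 0 => c 0
  | j + 1 => c (j + 1) - c j

theorem sum_pathDiff (c : ℕ → ℤ) (m : ℕ) : ∑ j ∈ Finset.range (m + 1), pathDiff c j = c m := by
  induction m with
  | zero => simp [pathDiff]
  | succ m ih => rw [Finset.sum_range_succ, ih]; simp [pathDiff]

theorem eq_zero_of_pathDiff {c : ℕ → ℤ} {m : ℕ} (h : ∀ j ≤ m, pathDiff c j = 0) :
    ∀ j ≤ m, c j = 0 := by
  intro j hj
  rw [← sum_pathDiff c j]
  exact Finset.sum_eq_zero fun i hi => h i (by simp at hi; omega)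

namespace IsRootPath

variable {p : ℤ} {n : ℕ} {a : ℕ → L}

theorem form_apply (h : IsRootPath B p n a) (hsymm : B.IsSymm) {i j : ℕ} (hi : i < n)
    (hj : j < n) : B (a i) (a j) =
      p * ((if i = j then 2 else 0) - (if i + 1 = j then 1 else 0) - if i = j + 1 then 1 else 0) := by
  rcases lt_trichotomy i j with hij | rfl | hij
  · by_cases h1 : i + 1 = j
    · subst h1
      rw [h.succ_eq i hj]
      simp [show i ≠ i + 1 + 1 by omega]
    · rw [h.far_eq i j (by omega) hj]
      simp [h1, show i ≠ j by omega, show i ≠ j + 1 by omega]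
  · rw [h.norm_eq i hi]
    simp
    ring
  · rw [show B (a i) (a j) = B (a j) (a i) from hsymm.eq _ _]
    by_cases h1 : j + 1 = i
    · subst h1
      rw [h.succ_eq j hi]
      simp [show j + 1 + 1 ≠ j by omega]
    · rw [h.far_eq j i (by omega) hi]
      simp [show i ≠ j by omega, show i ≠ j + 1 by omega, show i + 1 ≠ j by omega]

theorem form_sum_apply (h : IsRootPath B p n a) (hsymm : B.IsSymm) (c : ℕ → ℤ) {j : ℕ}
    (hj : j < n) : B (∑ i ∈ Finset.range n, c i • a i) (a j) =
      p * (pathDiff c j - if j + 1 < n then pathDiff c (j + 1) else -c j) := by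
  have : B (∑ i ∈ Finset.range n, c i • a i) (a j) = ∑ i ∈ Finset.range n,
      p * ((if i = j then 2 * c i else 0) - (if i + 1 = j then c i else 0) -
        if i = j + 1 then c i else 0) := by
    simp only [map_sum, LinearMap.sum_apply, map_smul, LinearMap.smul_apply, smul_eq_mul]
    refine Finset.sum_congr rfl fun i hi => ?_
    rw [h.form_apply hsymm (Finset.mem_range.mp hi) hj]
    split_ifs <;> ring
  rw [this, ← Finset.mul_sum, Finset.sum_sub_distrib, Finset.sum_sub_distrib,
    Finset.sum_ite_eq', Finset.sum_ite_eq', if_pos (Finset.mem_range.mpr hj)]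
  congr 1
  cases j with
  | zero =>
    simp only [pathDiff, Nat.add_eq_zero_iff, one_ne_zero, and_false, if_false,
      Finset.sum_const_zero, Finset.mem_range]
    split_ifs <;> ring
  | succ j =>
    simp only [Nat.add_right_cancel_iff, Finset.sum_ite_eq', Finset.mem_range, pathDiff]
    rw [if_pos (by omega)]
    split_ifs <;> ring

theorem norm_sum (h : IsRootPath B p n a) (hsymm : B.IsSymm) (c : ℕ → ℤ) {m : ℕ} (hm : m < n) :
    B (∑ i ∈ Finset.range (m + 1), c i • a i) (∑ i ∈ Finset.range (m + 1), c i • a i) =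
      p * (∑ j ∈ Finset.range (m + 1), pathDiff c j ^ 2 + c m ^ 2) := by
  induction m with
  | zero =>
    simp [pathDiff, h.norm_eq 0 hm]
    ring
  | succ m ih =>
    have h1 : B (∑ i ∈ Finset.range (m + 1), c i • a i) (a (m + 1)) = -p * c m := by
      simp only [map_sum, LinearMap.sum_apply, map_smul, LinearMap.smul_apply, smul_eq_mul]
      rw [Finset.sum_range_succ, Finset.sum_eq_zero, h.succ_eq m hm]
      · ring
      · intro i hi
        rw [h.far_eq i (m + 1) (by simp at hi; omega) hm, mul_zero]
    rw [Finset.sum_range_succ _ (m + 1), Finset.sum_range_succ _ (m + 1)]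
    simp only [map_add, LinearMap.add_apply, map_smul, LinearMap.smul_apply, smul_eq_mul]
    rw [show B (a (m + 1)) (∑ i ∈ Finset.range (m + 1), c i • a i) =
      B (∑ i ∈ Finset.range (m + 1), c i • a i) (a (m + 1)) from hsymm.eq _ _, h1,
      ih (by omega), h.norm_eq _ hm]
    simp only [pathDiff]
    ring

/-- The squared length of a vector of `Aₙ` in the coordinates of `ℤⁿ⁺¹`. -/
theorem norm_sum_of_eq_zero (h : IsRootPath B p n a) (hsymm : B.IsSymm) {c : ℕ → ℤ}
    (hc : c n = 0) :
    B (∑ i ∈ Finset.range n, c i • a i) (∑ i ∈ Finset.range n, c i • a i) =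
      p * ∑ j ∈ Finset.range (n + 1), pathDiff c j ^ 2 := by
  cases n with
  | zero => simp [pathDiff, hc]
  | succ m =>
    rw [h.norm_sum hsymm c (Nat.lt_succ_self m), Finset.sum_range_succ _ (m + 1)]
    simp [pathDiff, hc]

end IsRootPath

theorem sum_sq_eq_zero {y : ℕ → ℤ} {m : ℕ} (h : ∑ j ∈ Finset.range (m + 1), y j ^ 2 = 0) :
    ∀ j ≤ m, y j = 0 := by
  intro j hj
  rw [Finset.sum_eq_zero_iff_of_nonneg fun i _ => sq_nonneg _] at h
  exact pow_eq_zero_iff two_ne_zero |>.mp (h j (by simp; omega))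

/-- Integers with consecutive differences divisible by `k` are all congruent. -/
theorem dvd_sub_of_dvd_succ {y : ℕ → ℤ} {k : ℤ} {m : ℕ} (h : ∀ j < m, k ∣ y j - y (j + 1)) :
    ∀ j ≤ m, k ∣ y j - y 0 := by
  intro j hj
  induction j with
  | zero => simp
  | succ j ih =>
    have h1 := dvd_sub (ih (by omega)) (h j (by omega))
    rwa [show y j - y 0 - (y j - y (j + 1)) = y (j + 1) - y 0 by ring] at h1

theorem card_le_sum_sq {y : ℕ → ℤ} {m : ℕ} (h : ∀ j ≤ m, y j ≠ 0) :
    ((m + 1 : ℕ) : ℤ) ≤ ∑ j ∈ Finset.range (m + 1), y j ^ 2 := by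
  have : ∑ j ∈ Finset.range (m + 1), (1 : ℤ) ≤ ∑ j ∈ Finset.range (m + 1), y j ^ 2 := by
    refine Finset.sum_le_sum fun j hj => ?_
    have := pow_ne_zero 2 (h j (by simp at hj; omega))
    have := sq_nonneg (y j)
    omega
  simpa using this

theorem sum_sq_modEq_card {y : ℕ → ℤ} {m : ℕ} (h : ∀ j ≤ m, ¬ (2 : ℤ) ∣ y j) :
    (8 : ℤ) ∣ (∑ j ∈ Finset.range (m + 1), y j ^ 2) - ((m + 1 : ℕ) : ℤ) := by
  have : (∑ j ∈ Finset.range (m + 1), y j ^ 2) - ((m + 1 : ℕ) : ℤ) =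
      ∑ j ∈ Finset.range (m + 1), (y j ^ 2 - 1) := by
    rw [Finset.sum_sub_distrib]; simp
  rw [this]
  exact Finset.dvd_sum fun j hj =>
    Int.eight_dvd_sq_sub_one_of_odd (by
      have := h j (by simp at hj; omega)
      rw [← Int.not_even_iff_odd, even_iff_two_dvd]; exact this)

theorem dvd_sum_sq {y : ℕ → ℤ} {m : ℕ} {k : ℤ} (h : ∀ j ≤ m, k ∣ y j) :
    k ^ 2 ∣ ∑ j ∈ Finset.range (m + 1), y j ^ 2 :=
  Finset.dvd_sum fun j hj => pow_dvd_pow_of_dvd (h j (by simp at hj; omega)) 2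

/-- In the coordinates `y` of `ℤⁿ⁺¹`, with sum `0`, the conditions on a screener of `Aₙ` of norm
`2k` are that the coordinates are congruent modulo `k` with sum of squares `2k`. For `k = 2, 3`
this forces `n ≤ 3`. -/
theorem false_of_sum_sq {y : ℕ → ℤ} {n : ℕ} {k : ℤ} (hn : 3 < n) (hk : k = 2 ∨ k = 3)
    (hcong : ∀ j < n, k ∣ y j - y (j + 1)) (hsum : ∑ j ∈ Finset.range (n + 1), y j = 0)
    (hsq : ∑ j ∈ Finset.range (n + 1), y j ^ 2 = 2 * k) : False := by
  have hc := dvd_sub_of_dvd_succ hcong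
  by_cases h0 : k ∣ y 0
  · have hall : ∀ j ≤ n, k ∣ y j := fun j hj => (dvd_sub_left h0).mp (hc j hj)
    rcases hk with rfl | rfl
    · have h1 : (2 : ℤ) ^ 3 ∣ ∑ j ∈ Finset.range (n + 1), (y j ^ 2 - 2 * y j) := by
        refine Finset.dvd_sum fun j hj => ?_
        obtain ⟨e, he⟩ := hall j (by simp at hj; omega)
        obtain ⟨f, hf⟩ := Int.even_mul_pred_self e
        exact ⟨f, by rw [he]; linear_combination 4 * hf⟩
      rw [Finset.sum_sub_distrib, ← Finset.mul_sum, hsum, hsq] at h1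
      omega
    · have := dvd_sum_sq hall
      rw [hsq] at this
      omega
  · have hall : ∀ j ≤ n, ¬ k ∣ y j := fun j hj h => h0 ((dvd_sub_right h).mp (hc j hj))
    have hcard := card_le_sum_sq (y := y) fun j hj h => hall j hj (by rw [h]; exact dvd_zero _)
    rw [hsq] at hcard
    rcases hk with rfl | rfl
    · push_cast at hcard; omega
    · have h1 : (3 : ℤ) ∣ ∑ j ∈ Finset.range (n + 1), (y j - y 0) :=
        Finset.dvd_sum fun j hj => hc j (by simp at hj; omega)
      rw [Finset.sum_sub_distrib, hsum] at h1
      simp only [Finset.sum_const, Finset.card_range, nsmul_eq_mul, zero_sub, dvd_neg] at h1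
      have h2 : (3 : ℤ) ∣ ((n + 1 : ℕ) : ℤ) := (Int.prime_three.dvd_or_dvd h1).resolve_right h0
      have hn5 : n = 5 := by omega
      subst hn5
      -- six nonzero squares with sum `6` are all `1`, and congruent signs modulo `3` are equal
      have hone : ∀ j ≤ 5, y j ^ 2 = 1 := by
        have h3 : ∀ j ∈ Finset.range 6, 0 ≤ y j ^ 2 - 1 := by
          intro j hj
          have h4 : y j ≠ 0 := fun h => hall j (by simp at hj; omega) (by rw [h]; exact dvd_zero _)
          have := pow_ne_zero 2 h4
          have := sq_nonneg (y j)
          omega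
        have h5 := (Finset.sum_eq_zero_iff_of_nonneg h3).mp
          (by rw [Finset.sum_sub_distrib]; simp [hsq])
        intro j hj
        have := h5 j (by simp; omega)
        omega
      have heq : ∀ j ≤ 5, y j = y 0 := by
        intro j hj
        have h4 := hc j hj
        have h5 : y j = 1 ∨ y j = -1 := sq_eq_one_iff.mp (hone j hj)
        have h6 : y 0 = 1 ∨ y 0 = -1 := sq_eq_one_iff.mp (hone 0 (by norm_num))
        omega
      have h7 : ∑ j ∈ Finset.range 6, y j = ∑ j ∈ Finset.range 6, y 0 :=
        Finset.sum_congr rfl fun j hj => heq j (by simp at hj; omega)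
      rw [hsum] at h7
      simp at h7
      exact h0 (by rw [h7]; exact dvd_zero _)

/-- No vector of norm `2kp`, `k = 2, 3`, of `√p Aₙ`, `n > 3`, has inner products in `kpℤ`. -/
theorem IsRootPath.false_of_dvd {p : ℤ} {n : ℕ} {a : ℕ → L} (h : IsRootPath B p n a)
    (hsymm : B.IsSymm) (hp : 0 < p) (hn : 3 < n) {k : ℤ} (hk : k = 2 ∨ k = 3) {c : ℕ → ℤ}
    (hnorm : B (∑ i ∈ Finset.range n, c i • a i) (∑ i ∈ Finset.range n, c i • a i) = 2 * (k * p))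
    (hdvd : ∀ j < n, k * p ∣ B (∑ i ∈ Finset.range n, c i • a i) (a j)) : False := by
  let c' : ℕ → ℤ := fun i => if i < n then c i else 0
  have hcc : ∑ i ∈ Finset.range n, c i • a i = ∑ i ∈ Finset.range n, c' i • a i :=
    Finset.sum_congr rfl fun i hi => by simp [c', Finset.mem_range.mp hi]
  have hcn : c' n = 0 := by simp [c']
  rw [hcc] at hnorm hdvd
  rw [h.norm_sum_of_eq_zero hsymm hcn] at hnorm
  refine false_of_sum_sq (y := pathDiff c') hn hk (fun j hj => ?_) ?_ ?_
  · have h1 := hdvd j hj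
    rw [h.form_sum_apply hsymm c' hj, mul_comm k p] at h1
    have h2 := Int.dvd_of_mul_dvd_mul_left hp.ne' h1
    split_ifs at h2 with h3
    · exact h2
    · obtain rfl : n = j + 1 := by omega
      simpa [pathDiff, hcn] using h2
  · rw [sum_pathDiff, hcn]
  · refine mul_left_cancel₀ hp.ne' ?_
    linarith

end Paths

/-! ### Screeners of type C -/

section LongPaths

variable {L : Type*} [AddCommGroup L] {B : LinearMap.BilinForm ℤ L}

/-- A path of `m` vectors of norm `2p`, continued by a vector `l` of norm `4p`: simple roots of type
`Cₘ₊₁`, scaled by `p`. -/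
structure IsLongPath (B : LinearMap.BilinForm ℤ L) (p : ℤ) (m : ℕ) (b : ℕ → L) (l : L) : Prop where
  path : IsRootPath B p m b
  norm_eq : B l l = 4 * p
  last_eq : ∀ j, j + 1 = m → B (b j) l = -2 * p
  far_eq : ∀ j, j + 1 < m → B (b j) l = 0

/-- The terms of the path followed by the long vector, as a finite family. -/
def longPathFamily (m : ℕ) (b : ℕ → L) (l : L) : Fin (m + 1) → L :=
  fun i => if (i : ℕ) < m then b i else l

/-- The combination of a long path with coefficients `c₀, …, cₘ₋₁` on the path and `cₘ / 2` on the
long vector. In the standard coordinates of `Dₘ₊₁` it has the entries `pathDiff c`. -/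
def longPathVec (m : ℕ) (b : ℕ → L) (l : L) (c : ℕ → ℤ) : L :=
  ∑ j ∈ Finset.range m, c j • b j + (c m / 2) • l

theorem sum_longPathFamily {m : ℕ} {b : ℕ → L} {l : L} (c : Fin (m + 1) → ℤ) :
    ∑ i, c i • longPathFamily m b l i = longPathVec m b l
      fun j => if h : j < m then c ⟨j, by omega⟩ else 2 * c (Fin.last m) := by
  rw [longPathVec, Finset.sum_range, Fin.sum_univ_castSucc]
  congr 1
  · refine Finset.sum_congr rfl fun i _ => ?_
    simp [longPathFamily]
    rfl
  · simp [longPathFamily]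

theorem mem_span_longPathFamily {m : ℕ} {b : ℕ → L} {l x : L} :
    x ∈ Submodule.span ℤ (Set.range (longPathFamily m b l)) ↔
      ∃ c : ℕ → ℤ, 2 ∣ c m ∧ x = longPathVec m b l c := by
  rw [Submodule.mem_span_range_iff_exists_fun]
  constructor
  · rintro ⟨c, rfl⟩
    exact ⟨_, by simp, sum_longPathFamily c⟩
  · rintro ⟨c, -, rfl⟩
    refine ⟨fun i => if (i : ℕ) < m then c i else c m / 2, ?_⟩
    rw [longPathVec, Finset.sum_range, Fin.sum_univ_castSucc]
    simp [longPathFamily]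

theorem longPathFamily_mem {m : ℕ} {b : ℕ → L} {l : L} (i : Fin (m + 1)) :
    longPathFamily m b l i ∈ Submodule.span ℤ (Set.range (longPathFamily m b l)) :=
  Submodule.subset_span ⟨i, rfl⟩

/-- The vector of `Dₘ₊₁` whose only nonzero coordinate is the `i`-th one, equal to `2`. -/
def axisVec (m : ℕ) (b : ℕ → L) (l : L) (i : ℕ) : L :=
  longPathVec m b l fun j => if i ≤ j then 2 else 0

theorem pathDiff_axis {i j : ℕ} {s : ℤ} :
    pathDiff (fun j => if i ≤ j then s else 0) j = if j = i then s else 0 := by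
  cases j with
  | zero => simp [pathDiff, eq_comm]
  | succ j =>
    simp only [pathDiff]
    split_ifs <;> omega

/-- Integers whose squares add up to `4` are, if they are all even, zero but for a single `±2`. -/
theorem exists_single_of_sum_sq {y : ℕ → ℤ} {m : ℕ} (heven : ∀ j ≤ m, 2 ∣ y j)
    (hsq : ∑ j ∈ Finset.range (m + 1), y j ^ 2 = 4) :
    ∃ i ≤ m, ∃ s : ℤ, (s = 2 ∨ s = -2) ∧ ∀ j ≤ m, y j = if j = i then s else 0 := by
  obtain ⟨i, hi, hi0⟩ : ∃ i ≤ m, y i ≠ 0 := by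
    by_contra! hcon
    rw [Finset.sum_eq_zero fun j hj => by rw [hcon j (by simp at hj; omega)]; norm_num] at hsq
    omega
  have hmem : i ∈ Finset.range (m + 1) := by simp; omega
  rw [← Finset.add_sum_erase _ _ hmem] at hsq
  obtain ⟨e, he⟩ := heven i hi
  have he0 : e ≠ 0 := by rintro rfl; simp at he; exact hi0 he
  have he1 : 1 ≤ e ^ 2 := by
    have := pow_ne_zero 2 he0
    have := sq_nonneg e
    omega
  have hnn : ∀ j ∈ (Finset.range (m + 1)).erase i, 0 ≤ y j ^ 2 := fun j _ => sq_nonneg _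
  have h0 := Finset.sum_nonneg hnn
  have hyi : y i ^ 2 = 4 * e ^ 2 := by rw [he]; ring
  have he2 : e ^ 2 = 1 := by omega
  have hz : ∑ j ∈ (Finset.range (m + 1)).erase i, y j ^ 2 = 0 := by omega
  refine ⟨i, hi, y i, ?_, fun j hj => ?_⟩
  · rcases sq_eq_one_iff.mp he2 with rfl | rfl <;> omega
  · split_ifs with hji
    · rw [hji]
    · have := (Finset.sum_eq_zero_iff_of_nonneg hnn).mp hz j (by simp; omega)
      exact pow_eq_zero_iff two_ne_zero |>.mp this

namespace IsLongPath

variable {p : ℤ} {m : ℕ} {b : ℕ → L} {l : L}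

theorem form_vec_path (h : IsLongPath B p m b l) (hsymm : B.IsSymm) {c : ℕ → ℤ} (hc : 2 ∣ c m)
    {j : ℕ} (hj : j < m) :
    B (longPathVec m b l c) (b j) = p * (pathDiff c j - pathDiff c (j + 1)) := by
  obtain ⟨e, he⟩ := hc
  rw [longPathVec, he]
  simp only [map_add, LinearMap.add_apply, map_smul, LinearMap.smul_apply, smul_eq_mul]
  rw [h.path.form_sum_apply hsymm c hj, show B l (b j) = B (b j) l from hsymm.eq _ _]
  split_ifs with h1
  · rw [h.far_eq j h1]; ring
  · rw [h.last_eq j (by omega)]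
    obtain rfl : m = j + 1 := by omega
    simp only [pathDiff, he]
    rw [Int.mul_ediv_cancel_left _ two_ne_zero]
    ring

theorem form_path_sum (h : IsLongPath B p (m + 1) b l) (c : ℕ → ℤ) :
    B (∑ j ∈ Finset.range (m + 1), c j • b j) l = -2 * p * c m := by
  simp only [map_sum, LinearMap.sum_apply, map_smul, LinearMap.smul_apply, smul_eq_mul]
  rw [Finset.sum_range_succ, Finset.sum_eq_zero fun j hj => ?_, h.last_eq m rfl]
  · ring
  · rw [h.far_eq j (by simp at hj; omega), mul_zero]

theorem form_vec_long (h : IsLongPath B p (m + 1) b l) {c : ℕ → ℤ} (hc : 2 ∣ c (m + 1)) :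
    B (longPathVec (m + 1) b l c) l = 2 * p * pathDiff c (m + 1) := by
  obtain ⟨e, he⟩ := hc
  rw [longPathVec, he]
  simp only [map_add, LinearMap.add_apply, map_smul, LinearMap.smul_apply, smul_eq_mul]
  rw [h.form_path_sum, h.norm_eq, Int.mul_ediv_cancel_left _ two_ne_zero]
  simp only [pathDiff, he]
  ring

theorem norm_vec (h : IsLongPath B p (m + 1) b l) (hsymm : B.IsSymm) {c : ℕ → ℤ}
    (hc : 2 ∣ c (m + 1)) :
    B (longPathVec (m + 1) b l c) (longPathVec (m + 1) b l c) =
      p * ∑ j ∈ Finset.range (m + 2), pathDiff c j ^ 2 := by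
  obtain ⟨e, he⟩ := hc
  rw [longPathVec, he, Finset.sum_range_succ _ (m + 1)]
  simp only [map_add, LinearMap.add_apply, map_smul, LinearMap.smul_apply, smul_eq_mul]
  rw [show B l (∑ j ∈ Finset.range (m + 1), c j • b j) = B (∑ j ∈ Finset.range (m + 1), c j • b j) l
    from hsymm.eq _ _, h.form_path_sum, h.norm_eq, Int.mul_ediv_cancel_left _ two_ne_zero,
    h.path.norm_sum hsymm c (Nat.lt_succ_self m)]
  simp only [pathDiff, he]
  ring

/-- The vectors of norm `4p` in `√p Dₘ₊₂` with inner products in `2pℤ`: unless `m + 2 = 4`, their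
coordinates cannot be odd, because of the sum of their squares. -/
theorem eq_axisVec (h : IsLongPath B p (m + 1) b l) (hsymm : B.IsSymm) (hp : 0 < p) (hm : m ≠ 2)
    (hm1 : 1 ≤ m) {c : ℕ → ℤ} (hc : 2 ∣ c (m + 1))
    (hnorm : B (longPathVec (m + 1) b l c) (longPathVec (m + 1) b l c) = 2 * (2 * p))
    (hdvd : ∀ j < m + 1, 2 * p ∣ B (longPathVec (m + 1) b l c) (b j)) :
    ∃ i ≤ m + 1, ∃ s : ℤ, (s = 2 ∨ s = -2) ∧ ∀ j ≤ m + 1, c j = if i ≤ j then s else 0 := by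
  have hsq : ∑ j ∈ Finset.range (m + 1 + 1), pathDiff c j ^ 2 = 4 := by
    rw [h.norm_vec hsymm hc] at hnorm
    refine mul_left_cancel₀ hp.ne' ?_
    linarith
  have hcong : ∀ j < m + 1, (2 : ℤ) ∣ pathDiff c j - pathDiff c (j + 1) := by
    intro j hj
    have h1 := hdvd j hj
    rw [h.form_vec_path hsymm hc hj, mul_comm 2 p] at h1
    exact Int.dvd_of_mul_dvd_mul_left hp.ne' h1
  have hall := dvd_sub_of_dvd_succ hcong
  by_cases h0 : (2 : ℤ) ∣ pathDiff c 0
  · obtain ⟨i, hi, s, hs, hy⟩ := exists_single_of_sum_sq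
      (fun j hj => (dvd_sub_left h0).mp (hall j hj)) hsq
    refine ⟨i, hi, s, hs, fun j hj => ?_⟩
    rw [← sum_pathDiff c j, ← sum_pathDiff (fun j => if i ≤ j then s else 0) j]
    refine Finset.sum_congr rfl fun k hk => ?_
    rw [pathDiff_axis, hy k (by simp at hk; omega)]
  · exfalso
    have hodd : ∀ j ≤ m + 1, ¬ (2 : ℤ) ∣ pathDiff c j := fun j hj h =>
      h0 ((dvd_sub_right h).mp (hall j hj))
    have h1 := card_le_sum_sq (y := pathDiff c) fun j hj h => hodd j hj (by rw [h]; exact dvd_zero _)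
    have h2 := sum_sq_modEq_card hodd
    rw [hsq] at h1 h2
    push_cast at h1 h2
    omega

/-- There are no screeners of norm `6p` in `√p Dₘ₊₂`. -/
theorem false_of_dvd_three (h : IsLongPath B p (m + 1) b l) (hsymm : B.IsSymm) (hp : 0 < p)
    {c : ℕ → ℤ} (hc : 2 ∣ c (m + 1))
    (hnorm : B (longPathVec (m + 1) b l c) (longPathVec (m + 1) b l c) = 2 * (3 * p))
    (hdvd : ∀ j < m + 1, 3 * p ∣ B (longPathVec (m + 1) b l c) (b j))
    (hdvdl : 3 * p ∣ B (longPathVec (m + 1) b l c) l) : False := by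
  have hsq : ∑ j ∈ Finset.range (m + 1 + 1), pathDiff c j ^ 2 = 6 := by
    rw [h.norm_vec hsymm hc] at hnorm
    refine mul_left_cancel₀ hp.ne' ?_
    linarith
  have hcong : ∀ j < m + 1, (3 : ℤ) ∣ pathDiff c j - pathDiff c (j + 1) := by
    intro j hj
    have h1 := hdvd j hj
    rw [h.form_vec_path hsymm hc hj, mul_comm 3 p] at h1
    exact Int.dvd_of_mul_dvd_mul_left hp.ne' h1
  have hall := dvd_sub_of_dvd_succ hcong
  have hlast : (3 : ℤ) ∣ pathDiff c (m + 1) := by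
    rw [h.form_vec_long hc, mul_comm 3 p, mul_comm 2 p, mul_assoc] at hdvdl
    have := Int.dvd_of_mul_dvd_mul_left hp.ne' hdvdl
    omega
  have h0 : (3 : ℤ) ∣ pathDiff c 0 := (dvd_sub_right hlast).mp (hall _ le_rfl)
  have := dvd_sum_sq fun j hj => (dvd_sub_left h0).mp (hall j hj)
  rw [hsq] at this
  omega

theorem vec_axis_smul (i : ℕ) {s : ℤ} (hs : 2 ∣ s) :
    longPathVec m b l (fun j => if i ≤ j then s else 0) = (s / 2) • axisVec m b l i := by
  obtain ⟨e, rfl⟩ := hs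
  rw [axisVec, longPathVec, longPathVec, smul_add, Finset.smul_sum]
  congr 1
  · refine Finset.sum_congr rfl fun j _ => ?_
    split_ifs
    · rw [smul_smul, Int.mul_ediv_cancel_left _ two_ne_zero, mul_comm]
    · simp
  · split_ifs
    · simp
    · simp

theorem vec_congr {c d : ℕ → ℤ} (h : ∀ j ≤ m, c j = d j) :
    longPathVec m b l c = longPathVec m b l d := by
  rw [longPathVec, longPathVec, h m le_rfl]
  congr 1
  exact Finset.sum_congr rfl fun j hj => by rw [h j (by simp at hj; omega)]

theorem two_dvd_axis (i k : ℕ) : (2 : ℤ) ∣ if i ≤ k then 2 else 0 := by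
  split_ifs <;> simp

theorem norm_axisVec (h : IsLongPath B p (m + 1) b l) (hsymm : B.IsSymm) {i : ℕ}
    (hi : i ≤ m + 1) : B (axisVec (m + 1) b l i) (axisVec (m + 1) b l i) = 2 * (2 * p) := by
  rw [axisVec, h.norm_vec hsymm (two_dvd_axis _ _)]
  simp only [pathDiff_axis, ite_pow]
  rw [show (0 : ℤ) ^ 2 = 0 by norm_num, Finset.sum_ite_eq', if_pos (by simp; omega)]
  ring

/-- The coordinates of a vector are determined by it. -/
theorem axisVec_injective (h : IsLongPath B p (m + 1) b l) (hsymm : B.IsSymm) (hp : 0 < p) {i k : ℕ}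
    (hi : i ≤ m + 1) (hk : k ≤ m + 1) {s u : ℤ} (hs : s = 1 ∨ s = -1)
    (hik : s • axisVec (m + 1) b l i = u • axisVec (m + 1) b l k) : i = k ∧ s = u := by
  let c : ℕ → ℤ := fun j => (if i ≤ j then 2 * s else 0) - if k ≤ j then 2 * u else 0
  have hc2 : 2 ∣ c (m + 1) := by
    dsimp only [c]
    (split_ifs; all_goals omega)
  have hzero : longPathVec (m + 1) b l c = 0 := by
    have h1 := vec_axis_smul (m := m + 1) (b := b) (l := l) i (s := 2 * s) (dvd_mul_right _ _)
    have h2 := vec_axis_smul (m := m + 1) (b := b) (l := l) k (s := 2 * u) (dvd_mul_right _ _)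
    rw [Int.mul_ediv_cancel_left _ two_ne_zero] at h1 h2
    rw [← h1, ← h2] at hik
    rw [← sub_eq_zero.mpr hik]
    simp only [longPathVec, if_pos hi, if_pos hk, c, sub_smul, Finset.sum_sub_distrib]
    rw [show (2 * s - 2 * u) / 2 = 2 * s / 2 - 2 * u / 2 by omega, sub_smul]
    abel
  have hn := h.norm_vec hsymm hc2
  rw [hzero, map_zero] at hn
  have hsum := (mul_eq_zero.mp hn.symm).resolve_left hp.ne'
  have hy := sum_sq_eq_zero hsum
  have hcz := eq_zero_of_pathDiff hy
  have h1 := hcz (m + 1) le_rfl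
  have h2 := hcz i hi
  have h3 := hcz k hk
  simp only [c] at h1 h2 h3
  split_ifs at h1 h2 h3 <;> omega

variable {N : Submodule ℤ L} {a : Fin (m + 2) → L}

/-- The screeners of `√p Dₘ₊₂`, `m + 2 ≠ 4`, are the roots and the vectors `±2eᵢ`. -/
theorem mem_screeners_iff [Module.Free ℤ L] (h : IsLongPath B p (m + 1) b l)
    (hsymm : B.IsSymm) (hpos : ∀ x : L, x ≠ 0 → 0 < B x x) (hp : 0 < p) (hm : m ≠ 2) (hm1 : 1 ≤ m)
    (ha : RootGenerators B N p a)
    (hbN : Submodule.span ℤ (Set.range (longPathFamily (m + 1) b l)) = N)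
    (hN : IsScreenerSummand B N) {x : L} (hx : x ∈ N) :
    x ∈ screeners B ↔ B x x = 2 * p ∨
      ∃ i ≤ m + 1, ∃ s : ℤ, (s = 1 ∨ s = -1) ∧ x = s • axisVec (m + 1) b l i := by
  have hbmem : ∀ j < m + 1, b j ∈ N := fun j hj => by
    have := longPathFamily_mem (b := b) (l := l) (⟨j, by omega⟩ : Fin (m + 2))
    rw [hbN] at this
    simpa [longPathFamily, hj] using this
  have hlmem : l ∈ N := by
    have := longPathFamily_mem (b := b) (l := l) (Fin.last (m + 1))
    rw [hbN] at this
    simpa [longPathFamily] using this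
  rw [ha.mem_screeners_iff hp hpos hsymm hN hx]
  constructor
  · rintro ⟨k, hk, hk2, hk3⟩
    have hx' := hx
    rw [← hbN, mem_span_longPathFamily] at hx'
    obtain ⟨c, hc, rfl⟩ := hx'
    rcases hk with rfl | rfl | rfl
    · left; simpa using hk2
    · right
      obtain ⟨i, hi, s, hs, hcs⟩ := h.eq_axisVec hsymm hp hm hm1 hc hk2
        fun j hj => hk3 _ (hbmem j hj)
      refine ⟨i, hi, s / 2, by omega, ?_⟩
      rw [vec_congr hcs, vec_axis_smul i (by omega)]
    · exact (h.false_of_dvd_three hsymm hp hc hk2 (fun j hj => hk3 _ (hbmem j hj))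
        (hk3 _ hlmem)).elim
  · rintro (h1 | ⟨i, hi, s, hs, rfl⟩)
    · exact ⟨1, Or.inl rfl, by simpa using h1, fun y hy => by simpa using ha.dvd_form hsymm hx hy⟩
    · refine ⟨2, by simp, ?_, fun y hy => ?_⟩
      · have := h.norm_axisVec hsymm hi
        rcases hs with rfl | rfl <;> simp [this]
      · have key : 2 * p ∣ B (axisVec (m + 1) b l i) y := by
          rw [← hbN] at hy
          induction hy using Submodule.span_induction with
          | mem _ h' =>
            obtain ⟨j, rfl⟩ := h'
            rw [longPathFamily]
            split_ifs with hj
            · rw [axisVec, h.form_vec_path hsymm (two_dvd_axis _ _) hj, pathDiff_axis,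
                pathDiff_axis, mul_comm 2 p]
              refine mul_dvd_mul_left p ?_
              split_ifs <;> simp
            · rw [axisVec, h.form_vec_long (two_dvd_axis _ _)]
              exact dvd_mul_right _ _
          | zero => simp
          | add u v _ _ hu hv => rw [map_add]; exact dvd_add hu hv
          | smul n u _ hu => rw [map_smul]; exact hu.mul_left n
        simp only [map_smul, LinearMap.smul_apply]
        exact key.mul_left s

theorem norm_mul_cartan (h : IsLongPath B p (m + 1) b l) (hsymm : B.IsSymm) (i j : Fin (m + 2)) :
    B (longPathFamily (m + 1) b l j) (longPathFamily (m + 1) b l j) * CartanMatrix.C (m + 2) i j =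
      2 * B (longPathFamily (m + 1) b l i) (longPathFamily (m + 1) b l j) := by
  have hsl : ∀ j, B l (b j) = B (b j) l := fun j => hsymm.eq _ _
  obtain ⟨i, hi⟩ := i
  obtain ⟨j, hj⟩ := j
  by_cases hi' : i < m + 1 <;> by_cases hj' : j < m + 1 <;>
    simp only [longPathFamily, CartanMatrix.C, Matrix.of_apply, hi', hj', if_true, if_false,
      Fin.mk.injEq]
  · rw [h.path.norm_eq j hj', h.path.form_apply hsymm hi' hj']
    split_ifs <;> omega
  · obtain rfl : j = m + 1 := by omega
    rw [h.norm_eq]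
    by_cases hi'' : i + 1 = m + 1
    · rw [h.last_eq i hi'', if_neg (by omega), if_pos hi'']
      ring
    · rw [h.far_eq i (by omega)]
      rw [if_neg (by omega), if_neg hi'', if_neg (by omega)]
      ring
  · obtain rfl : i = m + 1 := by omega
    rw [hsl, h.path.norm_eq j hj']
    by_cases hj'' : j + 1 = m + 1
    · rw [h.last_eq j hj'', if_neg (by omega), if_neg (by omega), if_pos hj'', if_pos (by omega)]
      ring
    · rw [h.far_eq j (by omega)]
      rw [if_neg (by omega), if_neg (by omega), if_neg (by omega)]
      ring
  · rw [if_pos (by omega), mul_comm]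

/-- The coroots of the screeners are integral combinations of those of the long path. -/
theorem norm_dvd_mul [Module.Free ℤ L] (h : IsLongPath B p (m + 1) b l)
    (hsymm : B.IsSymm) (hpos : ∀ x : L, x ≠ 0 → 0 < B x x) (heven : ∀ x : L, Even (B x x))
    (hp : 0 < p) (hm : m ≠ 2) (hm1 : 1 ≤ m) (ha : RootGenerators B N p a)
    (hbN : Submodule.span ℤ (Set.range (longPathFamily (m + 1) b l)) = N)
    (hN : IsScreenerSummand B N) {c : Fin (m + 2) → ℤ}
    (hc : ∑ i, c i • longPathFamily (m + 1) b l i ∈ screeners B) (i : Fin (m + 2)) :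
    B (∑ i, c i • longPathFamily (m + 1) b l i) (∑ i, c i • longPathFamily (m + 1) b l i) ∣
      c i * B (longPathFamily (m + 1) b l i) (longPathFamily (m + 1) b l i) := by
  have hmem := fun x (hx : x ∈ N) => h.mem_screeners_iff hsymm hpos hp hm hm1 ha hbN hN hx
  have hfam : ∀ i, longPathFamily (m + 1) b l i ∈ N := fun i => hbN ▸ longPathFamily_mem i
  have hx : ∑ i, c i • longPathFamily (m + 1) b l i ∈ N :=
    N.sum_mem fun i _ => N.smul_mem _ (hfam i)
  set x := ∑ i, c i • longPathFamily (m + 1) b l i with hxdef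
  have hnorm : 2 * p ∣ B (longPathFamily (m + 1) b l i) (longPathFamily (m + 1) b l i) :=
    ha.two_mul_dvd_norm hsymm (hfam i)
  rcases (hmem x hx).mp hc with h1 | ⟨i₀, hi₀, s₀, hs₀, hxs⟩
  · rw [h1]
    exact hnorm.mul_left _
  · have hx4 : B x x = 2 * (2 * p) := by
      have := h.norm_axisVec hsymm hi₀
      rw [hxs]
      rcases hs₀ with rfl | rfl <;> simp [this]
    have hdvd : ∀ j < m + 1, 2 * p ∣ B x (b j) := fun j _ => by
      have := ((_root_.mem_screeners_iff hpos hsymm heven).mp hc).2 (b j)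
      rw [hx4] at this
      exact Int.dvd_of_mul_dvd_mul_left two_ne_zero this
    have hx4' := hx4
    rw [hxdef, sum_longPathFamily] at hx4 hdvd
    obtain ⟨k, -, s, hs, hcs⟩ := h.eq_axisVec hsymm hp hm hm1 (by simp) hx4 hdvd
    rw [hx4']
    by_cases hi : (i : ℕ) < m + 1
    · have h2 : 2 ∣ c i := by
        have := hcs i (by omega)
        simp only [hi, dif_pos] at this
        rw [show c i = _ from this]
        split_ifs <;> omega
      exact mul_dvd_mul h2 hnorm
    · have : longPathFamily (m + 1) b l i = l := by
        unfold longPathFamily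
        exact if_neg hi
      rw [this, h.norm_eq]
      exact ⟨c i, by ring⟩

theorem isRootSetOfType [Module.Finite ℤ L] [Module.Free ℤ L] (h : IsLongPath B p (m + 1) b l)
    (hsymm : B.IsSymm) (hpos : ∀ x : L, x ≠ 0 → 0 < B x x) (heven : ∀ x : L, Even (B x x))
    (hp : 0 < p) (hm : m ≠ 2) (hm1 : 1 ≤ m) (hli : LinearIndependent ℤ a)
    (ha : RootGenerators B N p a)
    (hbN : Submodule.span ℤ (Set.range (longPathFamily (m + 1) b l)) = N)
    (hN : IsScreenerSummand B N) :
    {x | x ∈ N ∧ B x x = 2 * p} ⊆ screeners B ∧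
    ((screeners B ∩ N) \ {x | B x x = 2 * p}).encard = 2 * (m + 2 : ℕ) ∧
    IsRootSetOfType B (screeners B ∩ N) (.C (m + 2)) := by
  have hmem := fun x (hx : x ∈ N) => h.mem_screeners_iff hsymm hpos hp hm hm1 ha hbN hN hx
  have hfam : ∀ i, longPathFamily (m + 1) b l i ∈ N := fun i => hbN ▸ longPathFamily_mem i
  have haxis : ∀ i, axisVec (m + 1) b l i ∈ N := fun i => by
    rw [← hbN, mem_span_longPathFamily]
    exact ⟨_, two_dvd_axis _ _, rfl⟩
  have hl : l = axisVec (m + 1) b l (m + 1) := by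
    rw [axisVec, longPathVec, Finset.sum_eq_zero fun j hj => ?_]
    · simp
    · rw [if_neg (by simp at hj; omega), zero_smul]
  refine ⟨fun x hx => (hmem x hx.1).mpr (Or.inl hx.2), ?_, ?_⟩
  · let f : Fin (m + 2) × Bool → L :=
      fun i => (if i.2 then 1 else -1 : ℤ) • axisVec (m + 1) b l i.1
    have hf : Function.Injective f := by
      rintro ⟨i, s⟩ ⟨k, u⟩ hik
      have := h.axisVec_injective hsymm hp (i := i) (k := k) (by omega) (by omega)
        (s := if s then 1 else -1) (u := if u then 1 else -1)
        (by split_ifs <;> simp) hik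
      refine Prod.ext (Fin.ext this.1) ?_
      have h2 := this.2
      cases s <;> cases u <;> first | rfl | (norm_num at h2)
    have hset : (screeners B ∩ N) \ {x | B x x = 2 * p} = Set.range f := by
      ext x
      constructor
      · rintro ⟨⟨h1, h2⟩, h3⟩
        obtain ⟨i, hi, s, hs, rfl⟩ := ((hmem x h2).mp h1).resolve_left h3
        rcases hs with rfl | rfl
        · exact ⟨(⟨i, by omega⟩, true), by simp [f]⟩
        · exact ⟨(⟨i, by omega⟩, false), by simp [f]⟩
      · rintro ⟨⟨i, s⟩, rfl⟩
        have hi : (i : ℕ) ≤ m + 1 := by omega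
        refine ⟨⟨(hmem _ (N.smul_mem _ (haxis i))).mpr (Or.inr ⟨i, hi, _, ?_, rfl⟩),
          N.smul_mem _ (haxis i)⟩, ?_⟩
        · cases s <;> simp
        · have := h.norm_axisVec hsymm hi
          cases s <;> simp [f, this] <;> omega
    rw [hset, ← Set.image_univ, hf.encard_image, Set.encard_univ]
    simp [ENat.card_eq_coe_fintype_card, mul_comm]
  · refine screeners_inter_isRootSetOfType hpos hsymm heven (t := .C (m + 2)) hli ha.span_eq hbN
      (fun i => (hmem _ (hfam i)).mpr ?_) (fun c hc i => ?_) fun i j => ?_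
    · unfold longPathFamily
      split_ifs with hi
      · exact Or.inl (h.path.norm_eq _ hi)
      · exact Or.inr ⟨m + 1, le_rfl, 1, Or.inl rfl, by rw [one_smul]; exact hl⟩
    · exact h.norm_dvd_mul hsymm hpos heven hp hm hm1 ha hbN hN hc i
    · exact h.norm_mul_cartan hsymm i j

end IsLongPath

end LongPaths

/-! ### The lattices of type E -/

section ExceptionalTypes

variable {L : Type*} [AddCommGroup L] {B : LinearMap.BilinForm ℤ L}

theorem form_sum_apply {ι : Type*} [Fintype ι] {p : ℤ} {a : ι → L} {C : Matrix ι ι ℤ}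
    (hG : ∀ k l, B (a k) (a l) = p * C k l) (c : ι → ℤ) (j : ι) :
    B (∑ i, c i • a i) (a j) = p * ∑ i, c i * C i j := by
  simp only [map_sum, LinearMap.sum_apply, map_smul, LinearMap.smul_apply, smul_eq_mul, hG,
    Finset.mul_sum]
  exact Finset.sum_congr rfl fun i _ => by ring

theorem norm_sum_eq {ι : Type*} [Fintype ι] {p : ℤ} {a : ι → L} {C : Matrix ι ι ℤ}
    (hG : ∀ k l, B (a k) (a l) = p * C k l) (c : ι → ℤ) :
    B (∑ i, c i • a i) (∑ i, c i • a i) = p * ∑ j, c j * ∑ i, c i * C i j := by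
  rw [map_sum, Finset.mul_sum]
  refine Finset.sum_congr rfl fun j _ => ?_
  rw [map_smul, smul_eq_mul, form_sum_apply hG]
  ring

/-- The conditions on the coefficients `c` of a vector of norm `2kp` with inner products in `kpℤ`,
in terms of the Gram matrix `pC`. -/
theorem coeff_conditions {ι : Type*} [Fintype ι] {p : ℤ} (hp : 0 < p) {a : ι → L}
    {C : Matrix ι ι ℤ} (hG : ∀ k l, B (a k) (a l) = p * C k l) {N : Submodule ℤ L}
    (haN : Submodule.span ℤ (Set.range a) = N) {k : ℤ} {c : ι → ℤ}
    (hnorm : B (∑ i, c i • a i) (∑ i, c i • a i) = 2 * (k * p))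
    (hdvd : ∀ y ∈ N, k * p ∣ B (∑ i, c i • a i) y) :
    (∑ j, c j * ∑ i, c i * C i j = 2 * k) ∧ ∀ j, k ∣ ∑ i, c i * C i j := by
  constructor
  · rw [norm_sum_eq hG] at hnorm
    refine mul_left_cancel₀ hp.ne' ?_
    linarith
  · intro j
    have h1 := hdvd (a j) (haN ▸ Submodule.subset_span ⟨j, rfl⟩)
    rw [form_sum_apply hG, mul_comm k p] at h1
    exact Int.dvd_of_mul_dvd_mul_left hp.ne' h1

/-- The discriminant `3` of `E₆` is odd, and the nonzero classes of the dual lattice do not contain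
vectors of norm `2 / 3`: their norms are congruent to `4 / 3` modulo `2`. -/
theorem false_of_E₆ {c : Fin 6 → ℤ} {k : ℤ} (hk : k = 2 ∨ k = 3)
    (hn : ∑ j, c j * ∑ i, c i * CartanMatrix.E₆ i j = 2 * k)
    (hd : ∀ j, k ∣ ∑ i, c i * CartanMatrix.E₆ i j) : False := by
  have h0 := hd 0
  have h1 := hd 1
  have h2 := hd 2
  have h3 := hd 3
  have h4 := hd 4
  have h5 := hd 5
  simp [Fin.sum_univ_succ, CartanMatrix.E₆] at hn h0 h1 h2 h3 h4 h5
  clear hd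
  generalize c 0 = x0 at *
  generalize c 1 = x1 at *
  generalize c 2 = x2 at *
  generalize c 3 = x3 at *
  generalize c 4 = x4 at *
  generalize c 5 = x5 at *
  rcases hk with rfl | rfl
  · obtain ⟨w0, rfl⟩ : ∃ w, x0 = 2 * w := ⟨x0 / 2, by omega⟩
    obtain ⟨w1, rfl⟩ : ∃ w, x1 = 2 * w := ⟨x1 / 2, by omega⟩
    obtain ⟨w2, rfl⟩ : ∃ w, x2 = 2 * w := ⟨x2 / 2, by omega⟩
    obtain ⟨w3, rfl⟩ : ∃ w, x3 = 2 * w := ⟨x3 / 2, by omega⟩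
    obtain ⟨w4, rfl⟩ : ∃ w, x4 = 2 * w := ⟨x4 / 2, by omega⟩
    obtain ⟨w5, rfl⟩ : ∃ w, x5 = 2 * w := ⟨x5 / 2, by omega⟩
    ring_nf at hn
    omega
  -- the kernel of the Cartan matrix modulo `3` is spanned by `(1, 0, -1, 0, 1, -1)`
  · obtain h | h | h : x5 % 3 = 0 ∨ x5 % 3 = 2 ∨ x5 % 3 = 1 := by omega
    · obtain ⟨w0, rfl⟩ : ∃ w, x0 = 3 * w := ⟨x0 / 3, by omega⟩
      obtain ⟨w1, rfl⟩ : ∃ w, x1 = 3 * w := ⟨x1 / 3, by omega⟩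
      obtain ⟨w2, rfl⟩ : ∃ w, x2 = 3 * w := ⟨x2 / 3, by omega⟩
      obtain ⟨w3, rfl⟩ : ∃ w, x3 = 3 * w := ⟨x3 / 3, by omega⟩
      obtain ⟨w4, rfl⟩ : ∃ w, x4 = 3 * w := ⟨x4 / 3, by omega⟩
      obtain ⟨w5, rfl⟩ : ∃ w, x5 = 3 * w := ⟨x5 / 3, by omega⟩
      ring_nf at hn
      omega
    · obtain ⟨w0, rfl⟩ : ∃ w, x0 = 3 * w + 1 := ⟨(x0 - 1) / 3, by omega⟩
      obtain ⟨w1, rfl⟩ : ∃ w, x1 = 3 * w := ⟨x1 / 3, by omega⟩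
      obtain ⟨w2, rfl⟩ : ∃ w, x2 = 3 * w - 1 := ⟨(x2 + 1) / 3, by omega⟩
      obtain ⟨w3, rfl⟩ : ∃ w, x3 = 3 * w := ⟨x3 / 3, by omega⟩
      obtain ⟨w4, rfl⟩ : ∃ w, x4 = 3 * w + 1 := ⟨(x4 - 1) / 3, by omega⟩
      obtain ⟨w5, rfl⟩ : ∃ w, x5 = 3 * w - 1 := ⟨(x5 + 1) / 3, by omega⟩
      ring_nf at hn
      omega
    · obtain ⟨w0, rfl⟩ : ∃ w, x0 = 3 * w - 1 := ⟨(x0 + 1) / 3, by omega⟩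
      obtain ⟨w1, rfl⟩ : ∃ w, x1 = 3 * w := ⟨x1 / 3, by omega⟩
      obtain ⟨w2, rfl⟩ : ∃ w, x2 = 3 * w + 1 := ⟨(x2 - 1) / 3, by omega⟩
      obtain ⟨w3, rfl⟩ : ∃ w, x3 = 3 * w := ⟨x3 / 3, by omega⟩
      obtain ⟨w4, rfl⟩ : ∃ w, x4 = 3 * w - 1 := ⟨(x4 + 1) / 3, by omega⟩
      obtain ⟨w5, rfl⟩ : ∃ w, x5 = 3 * w + 1 := ⟨(x5 - 1) / 3, by omega⟩
      ring_nf at hn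
      omega

/-- The discriminant `2` of `E₇` is prime to `3`, and the nonzero class of the dual lattice does not
contain vectors of norm `1`: the norms are congruent to `3 / 2` modulo `2`. -/
theorem false_of_E₇ {c : Fin 7 → ℤ} {k : ℤ} (hk : k = 2 ∨ k = 3)
    (hn : ∑ j, c j * ∑ i, c i * CartanMatrix.E₇ i j = 2 * k)
    (hd : ∀ j, k ∣ ∑ i, c i * CartanMatrix.E₇ i j) : False := by
  have h0 := hd 0
  have h1 := hd 1
  have h2 := hd 2
  have h3 := hd 3
  have h4 := hd 4
  have h5 := hd 5
  have h6 := hd 6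
  simp [Fin.sum_univ_succ, CartanMatrix.E₇] at hn h0 h1 h2 h3 h4 h5 h6
  clear hd
  generalize c 0 = x0 at *
  generalize c 1 = x1 at *
  generalize c 2 = x2 at *
  generalize c 3 = x3 at *
  generalize c 4 = x4 at *
  generalize c 5 = x5 at *
  generalize c 6 = x6 at *
  rcases hk with rfl | rfl
  -- the kernel of the Cartan matrix modulo `2` is spanned by `(0, 1, 0, 0, 1, 0, 1)`
  · rcases Int.emod_two_eq_zero_or_one x6 with h | h
    · obtain ⟨w0, rfl⟩ : ∃ w, x0 = 2 * w := ⟨x0 / 2, by omega⟩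
      obtain ⟨w1, rfl⟩ : ∃ w, x1 = 2 * w := ⟨x1 / 2, by omega⟩
      obtain ⟨w2, rfl⟩ : ∃ w, x2 = 2 * w := ⟨x2 / 2, by omega⟩
      obtain ⟨w3, rfl⟩ : ∃ w, x3 = 2 * w := ⟨x3 / 2, by omega⟩
      obtain ⟨w4, rfl⟩ : ∃ w, x4 = 2 * w := ⟨x4 / 2, by omega⟩
      obtain ⟨w5, rfl⟩ : ∃ w, x5 = 2 * w := ⟨x5 / 2, by omega⟩
      obtain ⟨w6, rfl⟩ : ∃ w, x6 = 2 * w := ⟨x6 / 2, by omega⟩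
      ring_nf at hn
      omega
    · obtain ⟨w0, rfl⟩ : ∃ w, x0 = 2 * w := ⟨x0 / 2, by omega⟩
      obtain ⟨w1, rfl⟩ : ∃ w, x1 = 2 * w + 1 := ⟨(x1 - 1) / 2, by omega⟩
      obtain ⟨w2, rfl⟩ : ∃ w, x2 = 2 * w := ⟨x2 / 2, by omega⟩
      obtain ⟨w3, rfl⟩ : ∃ w, x3 = 2 * w := ⟨x3 / 2, by omega⟩
      obtain ⟨w4, rfl⟩ : ∃ w, x4 = 2 * w + 1 := ⟨(x4 - 1) / 2, by omega⟩
      obtain ⟨w5, rfl⟩ : ∃ w, x5 = 2 * w := ⟨x5 / 2, by omega⟩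
      obtain ⟨w6, rfl⟩ : ∃ w, x6 = 2 * w + 1 := ⟨(x6 - 1) / 2, by omega⟩
      ring_nf at hn
      omega
  · obtain ⟨w0, rfl⟩ : ∃ w, x0 = 3 * w := ⟨x0 / 3, by omega⟩
    obtain ⟨w1, rfl⟩ : ∃ w, x1 = 3 * w := ⟨x1 / 3, by omega⟩
    obtain ⟨w2, rfl⟩ : ∃ w, x2 = 3 * w := ⟨x2 / 3, by omega⟩
    obtain ⟨w3, rfl⟩ : ∃ w, x3 = 3 * w := ⟨x3 / 3, by omega⟩
    obtain ⟨w4, rfl⟩ : ∃ w, x4 = 3 * w := ⟨x4 / 3, by omega⟩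
    obtain ⟨w5, rfl⟩ : ∃ w, x5 = 3 * w := ⟨x5 / 3, by omega⟩
    obtain ⟨w6, rfl⟩ : ∃ w, x6 = 3 * w := ⟨x6 / 3, by omega⟩
    ring_nf at hn
    omega

/-- The lattice `E₈` is unimodular, so that its elements with inner products divisible by `k` are
divisible by `k`, and their norms by `2k²`. -/
theorem false_of_E₈ {c : Fin 8 → ℤ} {k : ℤ} (hk : k = 2 ∨ k = 3)
    (hn : ∑ j, c j * ∑ i, c i * CartanMatrix.E₈ i j = 2 * k)
    (hd : ∀ j, k ∣ ∑ i, c i * CartanMatrix.E₈ i j) : False := by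
  have h0 := hd 0
  have h1 := hd 1
  have h2 := hd 2
  have h3 := hd 3
  have h4 := hd 4
  have h5 := hd 5
  have h6 := hd 6
  have h7 := hd 7
  simp [Fin.sum_univ_succ, CartanMatrix.E₈] at hn h0 h1 h2 h3 h4 h5 h6 h7
  clear hd
  generalize c 0 = x0 at *
  generalize c 1 = x1 at *
  generalize c 2 = x2 at *
  generalize c 3 = x3 at *
  generalize c 4 = x4 at *
  generalize c 5 = x5 at *
  generalize c 6 = x6 at *
  generalize c 7 = x7 at *
  rcases hk with rfl | rfl
  · obtain ⟨w0, rfl⟩ : ∃ w, x0 = 2 * w := ⟨x0 / 2, by omega⟩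
    obtain ⟨w1, rfl⟩ : ∃ w, x1 = 2 * w := ⟨x1 / 2, by omega⟩
    obtain ⟨w2, rfl⟩ : ∃ w, x2 = 2 * w := ⟨x2 / 2, by omega⟩
    obtain ⟨w3, rfl⟩ : ∃ w, x3 = 2 * w := ⟨x3 / 2, by omega⟩
    obtain ⟨w4, rfl⟩ : ∃ w, x4 = 2 * w := ⟨x4 / 2, by omega⟩
    obtain ⟨w5, rfl⟩ : ∃ w, x5 = 2 * w := ⟨x5 / 2, by omega⟩
    obtain ⟨w6, rfl⟩ : ∃ w, x6 = 2 * w := ⟨x6 / 2, by omega⟩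
    obtain ⟨w7, rfl⟩ : ∃ w, x7 = 2 * w := ⟨x7 / 2, by omega⟩
    ring_nf at hn
    omega
  · obtain ⟨w0, rfl⟩ : ∃ w, x0 = 3 * w := ⟨x0 / 3, by omega⟩
    obtain ⟨w1, rfl⟩ : ∃ w, x1 = 3 * w := ⟨x1 / 3, by omega⟩
    obtain ⟨w2, rfl⟩ : ∃ w, x2 = 3 * w := ⟨x2 / 3, by omega⟩
    obtain ⟨w3, rfl⟩ : ∃ w, x3 = 3 * w := ⟨x3 / 3, by omega⟩
    obtain ⟨w4, rfl⟩ : ∃ w, x4 = 3 * w := ⟨x4 / 3, by omega⟩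
    obtain ⟨w5, rfl⟩ : ∃ w, x5 = 3 * w := ⟨x5 / 3, by omega⟩
    obtain ⟨w6, rfl⟩ : ∃ w, x6 = 3 * w := ⟨x6 / 3, by omega⟩
    obtain ⟨w7, rfl⟩ : ∃ w, x7 = 3 * w := ⟨x7 / 3, by omega⟩
    ring_nf at hn
    omega

end ExceptionalTypes

/-! ### The lattices A₂ and D₄ -/

section SmallTypes

variable {L : Type*} [AddCommGroup L] {B : LinearMap.BilinForm ℤ L}

theorem form_self_mem_span_iff {ι : Type*} [Fintype ι] {p : ℤ} (hp : 0 < p) {a : ι → L}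
    {C : Matrix ι ι ℤ} (hG : ∀ k l, B (a k) (a l) = p * C k l) {N : Submodule ℤ L}
    (ha : RootGenerators B N p a) {k : ℤ} {c : ι → ℤ} :
    (B (∑ i, c i • a i) (∑ i, c i • a i) = 2 * (k * p) ∧
      ∀ y ∈ N, k * p ∣ B (∑ i, c i • a i) y) ↔
    (∑ j, c j * ∑ i, c i * C i j = 2 * k) ∧ ∀ j, k ∣ ∑ i, c i * C i j := by
  constructor
  · rintro ⟨h1, h2⟩
    exact coeff_conditions hp hG ha.span_eq h1 h2
  · rintro ⟨h1, h2⟩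
    refine ⟨by rw [norm_sum_eq hG, h1]; ring, ha.dvd_of_forall fun j => ?_⟩
    rw [form_sum_apply hG, mul_comm k p]
    exact mul_dvd_mul_left p (h2 j)

/-- If only one value `k` besides `1` occurs for the norms `2kp` of the screeners, those which are
not roots are counted in terms of their coefficients. -/
theorem encard_screeners_diff [Module.Free ℤ L] {ι : Type*} [Fintype ι] {p : ℤ} (hp : 0 < p)
    (hpos : ∀ x : L, x ≠ 0 → 0 < B x x) (hsymm : B.IsSymm) {a : ι → L} (hli : LinearIndependent ℤ a)
    {C : Matrix ι ι ℤ} (hG : ∀ k l, B (a k) (a l) = p * C k l) {N : Submodule ℤ L}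
    (ha : RootGenerators B N p a) (hN : IsScreenerSummand B N) {k₀ : ℤ} (hk₀ : k₀ = 2 ∨ k₀ = 3)
    (hk : ∀ k : ℤ, (k = 2 ∨ k = 3) → k ≠ k₀ → ∀ c : ι → ℤ,
      ∑ j, c j * ∑ i, c i * C i j = 2 * k → (∀ j, k ∣ ∑ i, c i * C i j) → False)
    (T : Finset (ι → ℤ))
    (hT : ∀ c, c ∈ T ↔ ∑ j, c j * ∑ i, c i * C i j = 2 * k₀ ∧ ∀ j, k₀ ∣ ∑ i, c i * C i j) :
    ((screeners B ∩ N) \ {x | B x x = 2 * p}).encard = T.card := by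
  have hinj : Function.Injective fun c : ι → ℤ => ∑ i, c i • a i := fun c d hcd =>
    funext fun i => Fintype.linearIndependent_iffₛ.mp hli c d hcd i
  have hset : (screeners B ∩ N) \ {x | B x x = 2 * p} = (fun c : ι → ℤ => ∑ i, c i • a i) '' T := by
    ext x
    constructor
    · rintro ⟨⟨h1, h2⟩, h3⟩
      have h2' : x ∈ N := h2
      obtain ⟨k, hk1, hk2, hk3⟩ := (ha.mem_screeners_iff hp hpos hsymm hN h2).mp h1
      rw [← ha.span_eq, Submodule.mem_span_range_iff_exists_fun] at h2'
      obtain ⟨c, rfl⟩ := h2'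
      have hc := (form_self_mem_span_iff hp hG ha).mp ⟨hk2, hk3⟩
      rcases hk1 with rfl | hk1
      · exact (h3 (by simpa using hk2)).elim
      · by_cases hkk : k = k₀
        · subst hkk
          exact ⟨c, (hT c).mpr hc, rfl⟩
        · exact (hk k hk1 hkk c hc.1 hc.2).elim
    · rintro ⟨c, hc, rfl⟩
      have hmem : ∑ i, c i • a i ∈ N := N.sum_mem fun i _ => N.smul_mem _ (ha.mem i)
      have hc' := (form_self_mem_span_iff hp hG ha).mpr ((hT c).mp hc)
      refine ⟨⟨(ha.mem_screeners_iff hp hpos hsymm hN hmem).mpr ⟨k₀, Or.inr hk₀, hc'.1, hc'.2⟩,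
        hmem⟩, fun h => ?_⟩
      have h4 : B (∑ i, c i • a i) (∑ i, c i • a i) = 2 * p := h
      rw [hc'.1] at h4
      rcases hk₀ with rfl | rfl <;> omega
  rw [hset, hinj.encard_image, Set.encard_coe_eq_coe_finsetCard]

theorem roots_subset_screeners [Module.Free ℤ L] {ι : Type*} {p : ℤ} (hp : 0 < p)
    (hpos : ∀ x : L, x ≠ 0 → 0 < B x x) (hsymm : B.IsSymm) {a : ι → L} {N : Submodule ℤ L}
    (ha : RootGenerators B N p a) (hN : IsScreenerSummand B N) :
    {x | x ∈ N ∧ B x x = 2 * p} ⊆ screeners B := fun x hx =>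
  (ha.mem_screeners_iff hp hpos hsymm hN hx.1).mpr
    ⟨1, Or.inl rfl, by simpa using hx.2, fun y hy => by simpa using ha.dvd_form hsymm hx.1 hy⟩

/-- The screeners form a root system with simple roots `b`, if these are generators satisfying the
conditions on a screener, and if the coefficients of a screener of norm `2kp`, `k = 2, 3`, satisfy
the condition on its coroot. -/
theorem isRootSetOfType_of_gram [Module.Finite ℤ L] [Module.Free ℤ L] {p : ℤ} (hp : 0 < p)
    (hpos : ∀ x : L, x ≠ 0 → 0 < B x x) (hsymm : B.IsSymm) (heven : ∀ x : L, Even (B x x))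
    {t : DynkinType} {a b : Fin t.rank → L} (hli : LinearIndependent ℤ a) {N : Submodule ℤ L}
    (ha : RootGenerators B N p a) (hN : IsScreenerSummand B N)
    (hbN : Submodule.span ℤ (Set.range b) = N) {C : Matrix (Fin t.rank) (Fin t.rank) ℤ}
    (hG : ∀ k l, B (b k) (b l) = p * C k l) (k : Fin t.rank → ℤ)
    (hk : ∀ i, k i = 1 ∨ k i = 2 ∨ k i = 3) (hkC : ∀ i, C i i = 2 * k i)
    (hkd : ∀ i j, k i ∣ C i j) (hC : ∀ i j, C j j * t.cartan i j = 2 * C i j)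
    (hc : ∀ q : ℤ, (q = 2 ∨ q = 3) → ∀ c : Fin t.rank → ℤ,
      ∑ j, c j * ∑ i, c i * C i j = 2 * q → (∀ j, q ∣ ∑ i, c i * C i j) → ∀ i, q ∣ c i * k i) :
    IsRootSetOfType B (screeners B ∩ N) t := by
  have hb : ∀ i, b i ∈ N := fun i => hbN ▸ Submodule.subset_span ⟨i, rfl⟩
  refine screeners_inter_isRootSetOfType hpos hsymm heven hli ha.span_eq hbN
    (fun i => (ha.mem_screeners_iff hp hpos hsymm hN (hb i)).mpr ⟨k i, hk i, ?_, fun y hy => ?_⟩)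
    (fun c hcs i => ?_) fun i j => ?_
  · rw [hG, hkC]; ring
  · rw [← hbN] at hy
    induction hy using Submodule.span_induction with
    | mem _ h' =>
      obtain ⟨j, rfl⟩ := h'
      rw [hG, mul_comm (k i)]
      exact mul_dvd_mul_left p (hkd i j)
    | zero => simp
    | add u v _ _ hu hv => rw [map_add]; exact dvd_add hu hv
    | smul m u _ hu => rw [map_smul]; exact hu.mul_left m
  · have hx : ∑ i, c i • b i ∈ N := N.sum_mem fun i _ => N.smul_mem _ (hb i)
    obtain ⟨q, hq1, hq2, hq3⟩ := (ha.mem_screeners_iff hp hpos hsymm hN hx).mp hcs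
    have hcc := coeff_conditions hp hG hbN hq2 hq3
    rw [hq2, hG, hkC]
    rcases hq1 with rfl | hq1
    · exact ⟨c i * k i, by ring⟩
    · obtain ⟨m, hm⟩ := hc q hq1 c hcc.1 hcc.2 i
      exact ⟨m, by linear_combination (2 * p) * hm⟩
  · rw [hG, hG]
    linear_combination p * hC i j

theorem bounds_of_sq_add_sq {x y q : ℤ} (h : x ^ 2 + 3 * y ^ 2 ≤ q) (hq : q ≤ 12) :
    -3 ≤ x ∧ x ≤ 3 ∧ -2 ≤ y ∧ y ≤ 2 := by
  refine ⟨?_, ?_, ?_, ?_⟩ <;> nlinarith [sq_nonneg x, sq_nonneg y]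

theorem span_eq_of_mem {ι κ : Type*} {N : Submodule ℤ L} {a : ι → L} {b : κ → L}
    (haN : Submodule.span ℤ (Set.range a) = N) (hb : ∀ i, b i ∈ N)
    (ha : ∀ i, a i ∈ Submodule.span ℤ (Set.range b)) : Submodule.span ℤ (Set.range b) = N := by
  refine le_antisymm (Submodule.span_le.mpr ?_) ?_
  · rintro _ ⟨i, rfl⟩
    exact hb i
  · rw [← haN, Submodule.span_le]
    rintro _ ⟨i, rfl⟩
    exact ha i

theorem encard_screeners_A₂ [Module.Free ℤ L] {p : ℤ} (hp : 0 < p)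
    (hpos : ∀ x : L, x ≠ 0 → 0 < B x x) (hsymm : B.IsSymm)
    {N : Submodule ℤ L} (hN : IsScreenerSummand B N) {a : Fin 2 → L} (hli : LinearIndependent ℤ a)
    (ha : RootGenerators B N p a) (hG : ∀ k l, B (a k) (a l) = p * CartanMatrix.A 2 k l) :
    ((screeners B ∩ N) \ {x | B x x = 2 * p}).encard = 6 := by
  rw [CartanMatrix.A_two] at hG
  let T : Finset (Fin 2 → ℤ) := (Fintype.piFinset fun _ => Finset.Icc (-2) 2).filter fun c =>
    c 0 * (2 * c 0 - c 1) + c 1 * (2 * c 1 - c 0) = 6 ∧ 3 ∣ 2 * c 0 - c 1 ∧ 3 ∣ 2 * c 1 - c 0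
  have hT : T.card = 6 := by decide +kernel
  rw [encard_screeners_diff hp hpos hsymm hli hG ha hN (k₀ := 3) (Or.inr rfl) ?_ T ?_, hT]
  · rfl
  · intro k hk hk3 c hn hd
    obtain rfl : k = 2 := hk.resolve_right hk3
    have h0 := hd 0
    have h1 := hd 1
    simp at hn h0 h1
    clear hd
    generalize c 0 = x0 at *
    generalize c 1 = x1 at *
    obtain ⟨w0, rfl⟩ : ∃ w, x0 = 2 * w := ⟨x0 / 2, by omega⟩
    obtain ⟨w1, rfl⟩ : ∃ w, x1 = 2 * w := ⟨x1 / 2, by omega⟩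
    ring_nf at hn
    omega
  · intro c
    simp [T, Fin.forall_fin_two]
    generalize c 0 = x0
    generalize c 1 = x1
    constructor
    · rintro ⟨-, h1, h2, h3⟩
      exact ⟨by linarith, by omega⟩
    · rintro ⟨h1, h2, h3⟩
      have hb := bounds_of_sq_add_sq (x := 2 * x0 - x1) (y := x1) (q := 12) (by nlinarith) le_rfl
      exact ⟨by omega, by linarith, by omega, by omega⟩

/-- The difference `a₁ - a₀` is a screener of norm `6p`, the long simple root of `G₂`. -/
theorem screeners_A₂ [Module.Finite ℤ L] [Module.Free ℤ L] {p : ℤ} (hp : 0 < p)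
    (hpos : ∀ x : L, x ≠ 0 → 0 < B x x) (hsymm : B.IsSymm) (heven : ∀ x : L, Even (B x x))
    {N : Submodule ℤ L} (hN : IsScreenerSummand B N) {a : Fin 2 → L} (hli : LinearIndependent ℤ a)
    (ha : RootGenerators B N p a) (hG : ∀ k l, B (a k) (a l) = p * CartanMatrix.A 2 k l) :
    IsRootSetOfType B (screeners B ∩ N) .G₂ := by
  rw [CartanMatrix.A_two] at hG
  have hbN : Submodule.span ℤ (Set.range ![a 1 - a 0, a 0]) = N := by
    refine span_eq_of_mem ha.span_eq ?_ ?_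
    · rw [Fin.forall_fin_two]
      exact ⟨N.sub_mem (ha.mem 1) (ha.mem 0), ha.mem 0⟩
    · have h0 : a 0 ∈ Submodule.span ℤ (Set.range ![a 1 - a 0, a 0]) :=
        Submodule.subset_span ⟨1, rfl⟩
      have h1 : a 1 - a 0 ∈ Submodule.span ℤ (Set.range ![a 1 - a 0, a 0]) :=
        Submodule.subset_span ⟨0, rfl⟩
      rw [Fin.forall_fin_two]
      exact ⟨h0, (Submodule.sub_mem_iff_left _ h0).mp h1⟩
  have hG' : ∀ k l, B (![a 1 - a 0, a 0] k) (![a 1 - a 0, a 0] l) =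
      p * !![6, -3; -3, 2] k l := by
    intro k l
    fin_cases k <;> fin_cases l <;> simp [hG] <;> ring
  have hkd : ∀ i j : Fin 2, (![3, 1] : Fin 2 → ℤ) i ∣
      (!![6, -3; -3, 2] : Matrix (Fin 2) (Fin 2) ℤ) i j := by
    intro i j
    fin_cases i <;> fin_cases j <;> norm_num
  refine isRootSetOfType_of_gram (t := .G₂) (a := a) hp hpos hsymm heven hli ha hN hbN hG' ![3, 1]
    (by change ∀ i : Fin 2, _; decide) (by decide) hkd
    (by decide) ?_
  intro q hq c hn hd
  have hn' : ∑ j : Fin 2, c j * ∑ i : Fin 2, c i * !![6, -3; -3, 2] i j = 2 * q := hn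
  have hd' : ∀ j : Fin 2, q ∣ ∑ i : Fin 2, c i * !![6, -3; -3, 2] i j := hd
  have h0 := hd' 0
  have h1 := hd' 1
  have goal : ∀ i : Fin 2, q ∣ c i * ![3, 1] i := by
    clear hn hd hd'
    change Fin 2 → ℤ at c
    rw [Fin.forall_fin_two]
    simp at hn' h0 h1 ⊢
    generalize c 0 = x0 at *
    generalize c 1 = x1 at *
    rcases hq with rfl | rfl
    · exfalso
      obtain ⟨w1, rfl⟩ : ∃ w, x1 = 2 * w := ⟨x1 / 2, by omega⟩
      obtain ⟨w0, rfl⟩ : ∃ w, x0 = 2 * w := ⟨x0 / 2, by omega⟩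
      ring_nf at hn'
      omega
    · omega
  exact goal

theorem encard_screeners_D₄ [Module.Free ℤ L] {p : ℤ} (hp : 0 < p)
    (hpos : ∀ x : L, x ≠ 0 → 0 < B x x) (hsymm : B.IsSymm)
    {N : Submodule ℤ L} (hN : IsScreenerSummand B N) {a : Fin 4 → L} (hli : LinearIndependent ℤ a)
    (ha : RootGenerators B N p a) (hG : ∀ k l, B (a k) (a l) = p * CartanMatrix.D 4 k l) :
    ((screeners B ∩ N) \ {x | B x x = 2 * p}).encard = 24 := by
  rw [CartanMatrix.D_four] at hG
  let T : Finset (Fin 4 → ℤ) := (Fintype.piFinset fun _ => Finset.Icc (-2) 2).filter fun c =>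
    c 0 * (2 * c 0 - c 1) + c 1 * (2 * c 1 - c 0 - c 2 - c 3) + c 2 * (2 * c 2 - c 1) +
      c 3 * (2 * c 3 - c 1) = 4 ∧ 2 ∣ c 1 ∧ 2 ∣ c 0 + c 2 + c 3
  have hT : T.card = 24 := by decide +kernel
  rw [encard_screeners_diff hp hpos hsymm hli hG ha hN (k₀ := 2) (Or.inl rfl) ?_ T ?_, hT]
  · rfl
  · intro k hk hk3 c hn hd
    obtain rfl : k = 3 := hk.resolve_left hk3
    have h0 := hd 0
    have h1 := hd 1
    have h2 := hd 2
    have h3 := hd 3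
    simp [Fin.sum_univ_succ] at hn h0 h1 h2 h3
    clear hd
    generalize c 0 = x0 at *
    generalize c 1 = x1 at *
    generalize c 2 = x2 at *
    generalize c 3 = x3 at *
    obtain ⟨w0, rfl⟩ : ∃ w, x0 = 3 * w := ⟨x0 / 3, by omega⟩
    obtain ⟨w1, rfl⟩ : ∃ w, x1 = 3 * w := ⟨x1 / 3, by omega⟩
    obtain ⟨w2, rfl⟩ : ∃ w, x2 = 3 * w := ⟨x2 / 3, by omega⟩
    obtain ⟨w3, rfl⟩ : ∃ w, x3 = 3 * w := ⟨x3 / 3, by omega⟩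
    ring_nf at hn
    omega
  · intro c
    simp [T, Fin.forall_fin_succ, Fin.sum_univ_succ]
    generalize c 0 = x0
    generalize c 1 = x1
    generalize c 2 = x2
    generalize c 3 = x3
    constructor
    · rintro ⟨-, h1, h2, h3⟩
      exact ⟨by linarith, by omega⟩
    · rintro ⟨h1, h2, h3, h4⟩
      have hs : (2 * x0 - x1) ^ 2 + (2 * x2 - x1) ^ 2 + (2 * x3 - x1) ^ 2 + x1 ^ 2 = 8 := by
        linear_combination 2 * h1
      have hb : ∀ y : ℤ, y ^ 2 ≤ 8 → -2 ≤ y ∧ y ≤ 2 := fun y hy =>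
        ⟨by nlinarith, by nlinarith⟩
      have h6 := sq_nonneg (2 * x0 - x1)
      have h7 := sq_nonneg (2 * x2 - x1)
      have h8 := sq_nonneg (2 * x3 - x1)
      have h9 := sq_nonneg x1
      have b0 := hb (2 * x0 - x1) (by linarith)
      have b1 := hb x1 (by linarith)
      have b2 := hb (2 * x2 - x1) (by linarith)
      have b3 := hb (2 * x3 - x1) (by linarith)
      exact ⟨⟨by omega, by omega, by omega, by omega⟩, by linarith, by omega, by omega⟩

/-- The simple roots of `F₄` are the differences `a₃ - a₂` and `a₂ - a₀` of outer simple roots of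
`D₄`, of norm `4p`, followed by `a₀` and by the central root `a₁`. -/
theorem screeners_D₄ [Module.Finite ℤ L] [Module.Free ℤ L] {p : ℤ} (hp : 0 < p)
    (hpos : ∀ x : L, x ≠ 0 → 0 < B x x) (hsymm : B.IsSymm) (heven : ∀ x : L, Even (B x x))
    {N : Submodule ℤ L} (hN : IsScreenerSummand B N) {a : Fin 4 → L} (hli : LinearIndependent ℤ a)
    (ha : RootGenerators B N p a) (hG : ∀ k l, B (a k) (a l) = p * CartanMatrix.D 4 k l) :
    IsRootSetOfType B (screeners B ∩ N) .F₄ := by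
  rw [CartanMatrix.D_four] at hG
  set b : Fin 4 → L := ![a 3 - a 2, a 2 - a 0, a 0, a 1] with hb
  have hbN : Submodule.span ℤ (Set.range b) = N := by
    have hmem : ∀ i, b i ∈ Submodule.span ℤ (Set.range b) := fun i => Submodule.subset_span ⟨i, rfl⟩
    refine span_eq_of_mem ha.span_eq ?_ ?_
    · simp only [Fin.forall_fin_succ, IsEmpty.forall_iff, and_true]
      exact ⟨N.sub_mem (ha.mem 3) (ha.mem 2), N.sub_mem (ha.mem 2) (ha.mem 0), ha.mem 0, ha.mem 1⟩
    · have h0 : a 0 ∈ Submodule.span ℤ (Set.range b) := hmem 2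
      have h2 : a 2 ∈ Submodule.span ℤ (Set.range b) := (Submodule.sub_mem_iff_left _ h0).mp (hmem 1)
      simp only [Fin.forall_fin_succ, IsEmpty.forall_iff, and_true]
      exact ⟨h0, hmem 3, h2, (Submodule.sub_mem_iff_left _ h2).mp (hmem 0)⟩
  have hG' : ∀ k l, B (b k) (b l) =
      p * !![4, -2, 0, 0; -2, 4, -2, 0; 0, -2, 2, -1; 0, 0, -1, 2] k l := by
    intro k l
    fin_cases k <;> fin_cases l <;> simp [hb, hG] <;> ring
  have hkd : ∀ i j : Fin 4, (![2, 2, 1, 1] : Fin 4 → ℤ) i ∣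
      (!![4, -2, 0, 0; -2, 4, -2, 0; 0, -2, 2, -1; 0, 0, -1, 2] : Matrix (Fin 4) (Fin 4) ℤ) i j := by
    intro i j
    fin_cases i <;> fin_cases j <;> norm_num
  refine isRootSetOfType_of_gram (t := .F₄) (a := a) hp hpos hsymm heven hli ha hN hbN hG'
    ![2, 2, 1, 1] (by change ∀ i : Fin 4, _; decide) (by decide)
    hkd (by decide) ?_
  intro q hq c hn hd
  have hn' : ∑ j : Fin 4, c j * ∑ i : Fin 4, c i *
    !![4, -2, 0, 0; -2, 4, -2, 0; 0, -2, 2, -1; 0, 0, -1, 2] i j = 2 * q := hn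
  have hd' : ∀ j : Fin 4, q ∣ ∑ i : Fin 4, c i *
    !![4, -2, 0, 0; -2, 4, -2, 0; 0, -2, 2, -1; 0, 0, -1, 2] i j := hd
  have h0 := hd' 0
  have h1 := hd' 1
  have h2 := hd' 2
  have h3 := hd' 3
  have goal : ∀ i : Fin 4, q ∣ c i * ![2, 2, 1, 1] i := by
    clear hn hd hd'
    change Fin 4 → ℤ at c
    simp [Fin.sum_univ_succ] at hn' h0 h1 h2 h3
    simp [Fin.forall_fin_succ]
    generalize c 0 = x0 at *
    generalize c 1 = x1 at *
    generalize c 2 = x2 at *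
    generalize c 3 = x3 at *
    rcases hq with rfl | rfl
    · omega
    · exfalso
      obtain ⟨w0, rfl⟩ : ∃ w, x0 = 3 * w := ⟨x0 / 3, by omega⟩
      obtain ⟨w1, rfl⟩ : ∃ w, x1 = 3 * w := ⟨x1 / 3, by omega⟩
      obtain ⟨w2, rfl⟩ : ∃ w, x2 = 3 * w := ⟨x2 / 3, by omega⟩
      obtain ⟨w3, rfl⟩ : ∃ w, x3 = 3 * w := ⟨x3 / 3, by omega⟩
      ring_nf at hn'
      omega
  exact goal

end SmallTypes

/-! ### Screeners of the rescaled root lattices -/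

section OrthogonalType

variable {L : Type*} [AddCommGroup L] {B : LinearMap.BilinForm ℤ L}

theorem IsScaledRootLattice.exists_orthogonal_family {N : Submodule ℤ L} {p m : ℕ}
    (h : IsScaledRootLattice B N p m (.A 1)) :
    ∃ a : Fin m → L, LinearIndependent ℤ a ∧ Submodule.span ℤ (Set.range a) = N ∧
      ∀ i j, B (a i) (a j) = if i = j then 2 * (p : ℤ) else 0 := by
  obtain ⟨b, hb⟩ := h
  change Module.Basis (Fin m × Fin 1) ℤ N at b
  let b' := b.reindex (Equiv.prodUnique (Fin m) (Fin 1))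
  refine ⟨fun k => b' k, b'.linearIndependent.map' _ (Submodule.ker_subtype _), ?_, fun k l => ?_⟩
  · have : Set.range (fun k => (b' k : L)) = N.subtype '' Set.range b' := by
      rw [← Set.range_comp]; rfl
    rw [this, Submodule.span_image, b'.span_eq, Submodule.map_top, Submodule.range_subtype]
  · have h1 : B (b (k, 0)) (b (l, 0)) = if k = l then (p : ℤ) * 2 else 0 :=
      hb k l (0 : Fin 1) (0 : Fin 1)
    rw [mul_comm] at h1
    simpa [b'] using h1

/-- Differences of consecutive vectors of an orthogonal frame, followed by the last one: simple
roots of type `Bₙ`. -/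
def frameRoots (n : ℕ) (a : ℕ → L) : Fin (n + 1) → L :=
  fun i => if (i : ℕ) < n then a i - a (i + 1) else a n

theorem span_frameRoots {n : ℕ} {a : ℕ → L} {N : Submodule ℤ L}
    (haN : Submodule.span ℤ (Set.range fun i : Fin (n + 1) => a i) = N) :
    Submodule.span ℤ (Set.range (frameRoots n a)) = N := by
  have ha : ∀ i ≤ n, a i ∈ N := fun i hi =>
    haN ▸ Submodule.subset_span ⟨⟨i, by omega⟩, rfl⟩
  refine span_eq_of_mem haN (fun i => ?_) fun i => ?_
  · unfold frameRoots
    split_ifs with hi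
    · exact N.sub_mem (ha _ (by omega)) (ha _ (by omega))
    · exact ha n le_rfl
  · have key : ∀ k ≤ n, a (n - k) ∈ Submodule.span ℤ (Set.range (frameRoots n a)) := by
      intro k hk
      induction k with
      | zero =>
        refine Submodule.subset_span ⟨Fin.last n, ?_⟩
        simp [frameRoots]
      | succ k ih =>
        have h1 : a (n - (k + 1)) - a (n - k) ∈ Submodule.span ℤ (Set.range (frameRoots n a)) := by
          refine Submodule.subset_span ⟨⟨n - (k + 1), by omega⟩, ?_⟩
          simp only [frameRoots]
          rw [if_pos (by omega), show n - (k + 1) + 1 = n - k by omega]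
        exact (Submodule.sub_mem_iff_left _ (ih (by omega))).mp h1
    have := key (n - i) (by omega)
    rwa [show n - (n - (i : ℕ)) = i by omega] at this

theorem form_frameRoots_mul_cartan {n : ℕ} {a : ℕ → L} {p : ℤ}
    (hG : ∀ i ≤ n, ∀ j ≤ n, B (a i) (a j) = if i = j then 2 * p else 0) (i j : Fin (n + 1)) :
    B (frameRoots n a j) (frameRoots n a j) * CartanMatrix.B (n + 1) i j =
      2 * B (frameRoots n a i) (frameRoots n a j) := by
  obtain ⟨i, hi⟩ := i
  obtain ⟨j, hj⟩ := j
  by_cases hi' : i < n <;> by_cases hj' : j < n <;>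
    simp only [frameRoots, CartanMatrix.B, Matrix.of_apply, hi', hj', if_true, if_false,
      Fin.mk.injEq, map_sub, LinearMap.sub_apply]
  · rw [hG _ (by omega) _ (by omega), hG _ (by omega) _ (by omega), hG _ (by omega) _ (by omega),
      hG _ (by omega) _ (by omega), hG _ (by omega) _ (by omega), hG _ (by omega) _ (by omega),
      hG _ (by omega) _ (by omega), hG _ (by omega) _ (by omega)]
    split_ifs <;> omega
  · obtain rfl : j = n := by omega
    rw [hG _ (by omega) _ (by omega), hG _ (by omega) _ (by omega), hG _ (by omega) _ (by omega)]
    split_ifs <;> omega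
  · obtain rfl : i = n := by omega
    rw [hG _ (by omega) _ (by omega), hG _ (by omega) _ (by omega), hG _ (by omega) _ (by omega),
      hG _ (by omega) _ (by omega), hG _ (by omega) _ (by omega), hG _ (by omega) _ (by omega)]
    split_ifs <;> omega
  · rw [if_pos (by omega), mul_comm]

/-- In `n + 1 ≥ 1` orthogonal copies of `√p A₁`, the screeners have norm `2p` or `4p`, and the last
coefficient of those of norm `4p` is even, being the sum of the coordinates. -/
theorem screeners_A₁_copies [Module.Finite ℤ L] [Module.Free ℤ L] {p : ℤ} (hp : 0 < p)
    (hpos : ∀ x : L, x ≠ 0 → 0 < B x x) (hsymm : B.IsSymm) (heven : ∀ x : L, Even (B x x))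
    {N : Submodule ℤ L} (hN : IsScreenerSummand B N) {n : ℕ} {a : ℕ → L}
    (hli : LinearIndependent ℤ fun i : Fin (n + 1) => a i)
    (haN : Submodule.span ℤ (Set.range fun i : Fin (n + 1) => a i) = N)
    (hG : ∀ i ≤ n, ∀ j ≤ n, B (a i) (a j) = if i = j then 2 * p else 0) :
    IsRootSetOfType B (screeners B ∩ N) (.B (n + 1)) := by
  have hG' : ∀ i j : Fin (n + 1), B (a i) (a j) = p * (Matrix.diagonal fun _ => (2 : ℤ)) i j := by
    intro i j
    rw [hG _ (by omega) _ (by omega), Matrix.diagonal_apply]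
    simp only [Fin.ext_iff]
    split_ifs <;> ring
  have ha : RootGenerators B N p fun i : Fin (n + 1) => a i :=
    ⟨haN, fun i => by rw [hG _ (by omega) _ (by omega), if_pos rfl],
      fun i j => by rw [hG']; exact dvd_mul_right _ _⟩
  have hbN := span_frameRoots haN
  have hb : ∀ i, frameRoots n a i ∈ N := fun i => hbN ▸ Submodule.subset_span ⟨i, rfl⟩
  have hnormb : ∀ i : Fin (n + 1), B (frameRoots n a i) (frameRoots n a i) =
      if (i : ℕ) < n then 4 * p else 2 * p := by
    intro i
    unfold frameRoots
    split_ifs with hi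
    · simp only [map_sub, LinearMap.sub_apply]
      rw [hG _ (by omega) _ (by omega), hG _ (by omega) _ (by omega), hG _ (by omega) _ (by omega),
        hG _ (by omega) _ (by omega)]
      split_ifs <;> omega
    · rw [hG _ le_rfl _ le_rfl, if_pos rfl]
  have hdvd2 : ∀ x ∈ N, ∀ y ∈ N, 2 * p ∣ B x y := by
    intro x hx
    refine ha.dvd_of_forall fun i => ?_
    rw [show B x (a i) = B (a i) x from hsymm.eq _ _]
    refine ha.dvd_of_forall (fun j => ?_) x hx
    rw [hG _ (by omega) _ (by omega)]
    split_ifs <;> simp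
  have hmem := fun x (hx : x ∈ N) => ha.mem_screeners_iff hp hpos hsymm hN hx
  -- conditions on the coordinates of a screener
  have hcoord : ∀ x ∈ N, ∀ q : ℤ, B x x = 2 * (q * p) → (∀ y ∈ N, q * p ∣ B x y) →
      ∃ y : Fin (n + 1) → ℤ, x = ∑ i, y i • a i ∧ ∑ i, y i ^ 2 = q ∧ ∀ i, q ∣ 2 * y i := by
    intro x hx q h1 h2
    rw [← haN, Submodule.mem_span_range_iff_exists_fun] at hx
    obtain ⟨y, rfl⟩ := hx
    have hc := coeff_conditions hp hG' haN h1 h2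
    refine ⟨y, rfl, ?_, fun i => ?_⟩
    · have := hc.1
      simp only [Matrix.diagonal_apply, mul_ite, mul_zero, Finset.sum_ite_eq', Finset.mem_univ,
        if_true] at this
      refine mul_left_cancel₀ (two_ne_zero (α := ℤ)) ?_
      rw [← this, Finset.mul_sum]
      exact Finset.sum_congr rfl fun i _ => by ring
    · have := hc.2 i
      simp only [Matrix.diagonal_apply, mul_ite, mul_zero, Finset.sum_ite_eq', Finset.mem_univ,
        if_true] at this
      rwa [mul_comm]
  have hlast : ∀ c : Fin (n + 1) → ℤ, ∑ i, c i • frameRoots n a i ∈ screeners B →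
      ∀ i, B (∑ i, c i • frameRoots n a i) (∑ i, c i • frameRoots n a i) ∣
        c i * B (frameRoots n a i) (frameRoots n a i) := by
    intro c hc i
    have hx : ∑ i, c i • frameRoots n a i ∈ N := N.sum_mem fun i _ => N.smul_mem _ (hb i)
    obtain ⟨q, hq1, hq2, hq3⟩ := (hmem _ hx).mp hc
    rw [hq2]
    obtain ⟨y, hy1, hy2, hy3⟩ := hcoord _ hx q hq2 hq3
    rcases hq1 with rfl | rfl | rfl
    · rw [one_mul]
      exact (ha.two_mul_dvd_norm hsymm (hb i)).mul_left _
    · rw [hnormb]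
      split_ifs with hi
      · exact ⟨c i, by ring⟩
      · obtain rfl : i = Fin.last n := Fin.ext (by simp; omega)
        -- the inner product with the sum of the frame gives the sum of the coordinates
        have h1 : B (∑ i, c i • frameRoots n a i) (∑ j : Fin (n + 1), a j) =
            2 * p * c (Fin.last n) := by
          have hs : ∀ i ≤ n, B (a i) (∑ j : Fin (n + 1), a j) = 2 * p := by
            intro i hi
            rw [map_sum, Finset.sum_eq_single ⟨i, by omega⟩, hG _ hi _ hi, if_pos rfl]
            · intro j _ hj
              rw [hG _ hi _ (by omega), if_neg fun h => hj (Fin.ext h.symm)]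
            · simp
          generalize ∑ j : Fin (n + 1), a j = s at hs ⊢
          rw [map_sum, LinearMap.sum_apply, Fin.sum_univ_castSucc, Finset.sum_eq_zero, zero_add]
          · simp only [map_smul, LinearMap.smul_apply, smul_eq_mul, frameRoots, Fin.val_last,
              lt_irrefl, if_false]
            rw [hs n le_rfl, mul_comm]
          · intro k _
            simp only [map_smul, LinearMap.smul_apply, smul_eq_mul, frameRoots,
              Fin.val_castSucc, k.is_lt, if_true, map_sub, LinearMap.sub_apply]
            rw [hs _ (by omega), hs _ (by omega), sub_self, mul_zero]
        have h2 : B (∑ i, c i • frameRoots n a i) (∑ j : Fin (n + 1), a j) =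
            2 * p * ∑ i, y i := by
          rw [hy1, map_sum, Finset.mul_sum]
          refine Finset.sum_congr rfl fun j _ => ?_
          rw [form_sum_apply (a := fun i : Fin (n + 1) => a i) hG']
          simp only [Matrix.diagonal_apply, mul_ite, mul_zero, Finset.sum_ite_eq', Finset.mem_univ,
            if_true]
          ring
        have h3 : c (Fin.last n) = ∑ i, y i :=
          mul_left_cancel₀ (mul_pos two_pos hp).ne' (h1.symm.trans h2)
        have h4 : (2 : ℤ) ∣ ∑ i, (y i ^ 2 - y i) := Finset.dvd_sum fun i _ => by
          obtain ⟨f, hf⟩ := Int.even_mul_pred_self (y i)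
          exact ⟨f, by linear_combination hf⟩
        rw [Finset.sum_sub_distrib, hy2, ← h3] at h4
        obtain ⟨d, hd⟩ : (2 : ℤ) ∣ c (Fin.last n) := by omega
        exact ⟨d, by rw [hd]; ring⟩
    · exfalso
      have h5 : (9 : ℤ) ∣ ∑ i, y i ^ 2 := Finset.dvd_sum fun i _ => by
        obtain ⟨z, hz⟩ : (3 : ℤ) ∣ y i := by have := hy3 i; omega
        exact ⟨z ^ 2, by rw [hz]; ring⟩
      rw [hy2] at h5
      omega
  have hscr : ∀ i : Fin (n + 1), frameRoots n a i ∈ screeners B := by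
    intro i
    refine (hmem _ (hb i)).mpr ?_
    by_cases hi : (i : ℕ) < n
    · exact ⟨2, by simp, by rw [hnormb, if_pos hi]; ring, hdvd2 _ (hb i)⟩
    · exact ⟨1, by simp, by rw [hnormb, if_neg hi]; ring,
        fun y hy => by simpa using ha.dvd_form hsymm (hb i) hy⟩
  exact screeners_inter_isRootSetOfType hpos hsymm heven (t := .B (n + 1)) hli haN hbN hscr hlast
    (form_frameRoots_mul_cartan hG)

theorem screeners_A₁ [Module.Finite ℤ L] [Module.Free ℤ L] {p : ℤ} (hp : 0 < p)
    (hpos : ∀ x : L, x ≠ 0 → 0 < B x x) (hsymm : B.IsSymm) (heven : ∀ x : L, Even (B x x))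
    {N : Submodule ℤ L} (hN : IsScreenerSummand B N) {a : Fin 1 → L} (hli : LinearIndependent ℤ a)
    (haN : Submodule.span ℤ (Set.range a) = N)
    (hG : ∀ k l, B (a k) (a l) = p * CartanMatrix.A 1 k l) :
    IsRootSetOfType B (screeners B ∩ N) (.A 1) := by
  refine (screeners_inter_isRootSetOfType_of_norm hpos hsymm heven hp (t := .A 1) hli haN hG hN
    fun k hk x hx h1 h2 => ?_).2
  rw [← haN, Submodule.mem_span_range_iff_exists_fun] at hx
  obtain ⟨c, rfl⟩ := hx
  have hc := (coeff_conditions hp hG haN h1 h2).1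
  simp [CartanMatrix.A_one] at hc
  have h3 : -1 ≤ c 0 := by rcases hk with rfl | rfl <;> nlinarith
  have h4 : c 0 ≤ 1 := by rcases hk with rfl | rfl <;> nlinarith
  generalize c 0 = y at *
  interval_cases y <;> omega

end OrthogonalType

section SequenceTypes

variable {L : Type*} [AddCommGroup L] {B : LinearMap.BilinForm ℤ L}

/-- A finite family as the start of a sequence continued by zeros. -/
def extendZero {M : Type*} [Zero M] {n : ℕ} (a : Fin n → M) : ℕ → M :=
  fun i => if h : i < n then a ⟨i, h⟩ else 0

theorem extendZero_of_lt {M : Type*} [Zero M] {n : ℕ} (a : Fin n → M) {i : ℕ} (h : i < n) :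
    extendZero a i = a ⟨i, h⟩ := dif_pos h

theorem extendZero_val {M : Type*} [Zero M] {n : ℕ} (a : Fin n → M) (i : Fin n) :
    extendZero a i = a i := extendZero_of_lt a i.is_lt

theorem sum_extendZero {n : ℕ} (a : Fin n → L) (c : Fin n → ℤ) :
    ∑ i, c i • a i = ∑ i ∈ Finset.range n, extendZero c i • extendZero a i := by
  rw [Finset.sum_range]
  exact Finset.sum_congr rfl fun i _ => by rw [extendZero_val, extendZero_val]

theorem isRootPath_of_cartan {p : ℤ} {n : ℕ} {a : Fin n → L}
    (hG : ∀ k l, B (a k) (a l) = p * CartanMatrix.A n k l) : IsRootPath B p n (extendZero a) := by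
  refine ⟨fun i hi => ?_, fun i hi => ?_, fun i j hij hj => ?_⟩
  · rw [extendZero_of_lt a hi, hG]
    simp [CartanMatrix.A, mul_comm]
  · rw [extendZero_of_lt a (show i < n by omega), extendZero_of_lt a hi, hG]
    simp [CartanMatrix.A]
  · rw [extendZero_of_lt a (show i < n by omega), extendZero_of_lt a hj, hG]
    simp only [CartanMatrix.A, Matrix.of_apply, Fin.mk.injEq]
    rw [if_neg (by omega), if_neg (by omega), mul_zero]

/-- Besides the roots, there are no screeners in `√p Aₙ`, `n > 3`. -/
theorem screeners_A [Module.Finite ℤ L] [Module.Free ℤ L] {p : ℤ} (hp : 0 < p)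
    (hpos : ∀ x : L, x ≠ 0 → 0 < B x x) (hsymm : B.IsSymm) (heven : ∀ x : L, Even (B x x))
    {N : Submodule ℤ L} (hN : IsScreenerSummand B N) {n : ℕ} (hn : 3 < n) {a : Fin n → L}
    (hli : LinearIndependent ℤ a) (haN : Submodule.span ℤ (Set.range a) = N)
    (hG : ∀ k l, B (a k) (a l) = p * CartanMatrix.A n k l) :
    screeners B ∩ N = {x | x ∈ N ∧ B x x = 2 * p} ∧
      IsRootSetOfType B (screeners B ∩ N) (.A n) := by
  refine screeners_inter_isRootSetOfType_of_norm hpos hsymm heven hp (t := .A n) hli haN hG hN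
    fun k hk x hx h1 h2 => ?_
  have hpath := isRootPath_of_cartan hG
  rw [← haN, Submodule.mem_span_range_iff_exists_fun] at hx
  obtain ⟨c, rfl⟩ := hx
  rw [sum_extendZero] at h1 h2
  refine hpath.false_of_dvd hsymm hp hn hk h1 fun j hj => h2 _ ?_
  rw [extendZero_of_lt a hj, ← haN]
  exact Submodule.subset_span ⟨_, rfl⟩

/-- Besides the roots, there are no screeners in `√p E₆`, `√p E₇` and `√p E₈`. -/
theorem screeners_E [Module.Finite ℤ L] [Module.Free ℤ L] {p : ℤ} (hp : 0 < p)
    (hpos : ∀ x : L, x ≠ 0 → 0 < B x x) (hsymm : B.IsSymm) (heven : ∀ x : L, Even (B x x))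
    {N : Submodule ℤ L} (hN : IsScreenerSummand B N) {E : DynkinType}
    (hE : E = .E₆ ∨ E = .E₇ ∨ E = .E₈) {a : Fin E.rank → L}
    (hli : LinearIndependent ℤ a) (haN : Submodule.span ℤ (Set.range a) = N)
    (hG : ∀ k l, B (a k) (a l) = p * E.cartan k l) :
    screeners B ∩ N = {x | x ∈ N ∧ B x x = 2 * p} ∧
      IsRootSetOfType B (screeners B ∩ N) E := by
  refine screeners_inter_isRootSetOfType_of_norm hpos hsymm heven hp hli haN hG hN
    fun k hk x hx h1 h2 => ?_
  rw [← haN, Submodule.mem_span_range_iff_exists_fun] at hx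
  obtain ⟨c, rfl⟩ := hx
  have hc := coeff_conditions hp hG haN h1 h2
  rcases hE with rfl | rfl | rfl
  · exact false_of_E₆ hk hc.1 hc.2
  · exact false_of_E₇ hk hc.1 hc.2
  · exact false_of_E₈ hk hc.1 hc.2

/-- The simple roots of `Dₘ₊₂`, the last of which is replaced by its difference from the previous
one. -/
theorem isLongPath_of_cartan_D {p : ℤ} {m : ℕ} (hm : 2 ≤ m) {a : Fin (m + 2) → L}
    (hsymm : B.IsSymm) (hG : ∀ k l, B (a k) (a l) = p * CartanMatrix.D (m + 2) k l) :
    IsLongPath B p (m + 1) (extendZero a) (extendZero a (m + 1) - extendZero a m) := by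
  have hG' : ∀ i j, i < m + 2 → j < m + 2 → B (extendZero a i) (extendZero a j) =
      p * (if i = j then 2 else if i + 1 = j ∧ j < m + 1 then -1 else if j + 1 = i ∧ i < m + 1 then -1
        else if i + 1 = m ∧ j = m + 1 then -1 else if j + 1 = m ∧ i = m + 1 then -1 else 0) := by
    intro i j hi hj
    rw [extendZero_of_lt a hi, extendZero_of_lt a hj, hG]
    congr 1
    simp only [CartanMatrix.D, Matrix.of_apply, Fin.mk.injEq]
    split_ifs <;> omega
  have h1 : B (extendZero a m) (extendZero a (m + 1)) = 0 := by
    rw [hG' _ _ (by omega) (by omega), if_neg (by omega), if_neg (by omega), if_neg (by omega),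
      if_neg (by omega), if_neg (by omega), mul_zero]
  refine ⟨⟨fun i hi => ?_, fun i hi => ?_, fun i j hij hj => ?_⟩, ?_, fun j hj => ?_, fun j hj => ?_⟩
  · rw [hG' i i (by omega) (by omega), if_pos rfl, mul_comm]
  · rw [hG' _ _ (by omega) (by omega), if_neg (by omega), if_pos (by omega)]
    ring
  · rw [hG' _ _ (by omega) (by omega), if_neg (by omega), if_neg (by omega), if_neg (by omega),
      if_neg (by omega), if_neg (by omega), mul_zero]
  · have h2 : B (extendZero a (m + 1)) (extendZero a m) = 0 := (hsymm.eq _ _).trans h1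
    simp only [map_sub, LinearMap.sub_apply]
    rw [h1, h2, hG' _ _ (by omega) (by omega), hG' _ _ (by omega) (by omega), if_pos rfl,
      if_pos rfl]
    ring
  · obtain rfl : j = m := by omega
    rw [map_sub, h1, hG' _ _ (by omega) (by omega), if_pos rfl]
    ring
  · rw [map_sub, hG' _ _ (by omega) (by omega), hG' _ _ (by omega) (by omega), if_neg (by omega),
      if_neg (by omega), if_neg (by omega), if_neg (by omega : j ≠ m)]
    by_cases hjm : j + 1 = m
    · rw [if_pos (by omega), if_pos (by omega), sub_self]
    · rw [if_neg (by omega), if_neg (by omega), if_neg (by omega), if_neg (by omega),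
        if_neg (by omega), if_neg (by omega), sub_self]

/-- Besides the roots, the screeners of `√p Dₙ`, `n > 4`, are `±2` times the coordinate vectors. -/
theorem screeners_D [Module.Finite ℤ L] [Module.Free ℤ L] {p : ℤ} (hp : 0 < p)
    (hpos : ∀ x : L, x ≠ 0 → 0 < B x x) (hsymm : B.IsSymm) (heven : ∀ x : L, Even (B x x))
    {N : Submodule ℤ L} (hN : IsScreenerSummand B N) {n : ℕ} (hn : 4 < n) {a : Fin n → L}
    (hli : LinearIndependent ℤ a) (haN : Submodule.span ℤ (Set.range a) = N)
    (hG : ∀ k l, B (a k) (a l) = p * CartanMatrix.D n k l) :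
    {x | x ∈ N ∧ B x x = 2 * p} ⊆ screeners B ∧
    ((screeners B ∩ N) \ {x | B x x = 2 * p}).encard = 2 * (n : ℕ) ∧
    IsRootSetOfType B (screeners B ∩ N) (.C n) := by
  obtain ⟨m, rfl⟩ : ∃ m, n = m + 2 := ⟨n - 2, by omega⟩
  have hlong := isLongPath_of_cartan_D (by omega) hsymm hG
  have ha := RootGenerators.of_cartan (t := .D (m + 2)) haN hG
  have hmem : ∀ i, i < m + 2 → extendZero a i ∈ N := fun i hi => by
    rw [extendZero_of_lt a hi]
    exact ha.mem _
  refine hlong.isRootSetOfType hsymm hpos heven hp (by omega) (by omega) hli ha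
    (span_eq_of_mem haN (fun i => ?_) fun i => ?_) hN
  · unfold longPathFamily
    split_ifs with hi
    · exact hmem _ (by omega)
    · exact N.sub_mem (hmem _ (by omega)) (hmem _ (by omega))
  · set S := Submodule.span ℤ (Set.range (longPathFamily (m + 1) (extendZero a)
      (extendZero a (m + 1) - extendZero a m))) with hS
    have h1 : ∀ i < m + 1, extendZero a i ∈ S := fun i hi => by
      refine Submodule.subset_span ⟨⟨i, by omega⟩, ?_⟩
      simp [longPathFamily, hi]
    have h2 : extendZero a (m + 1) - extendZero a m ∈ S := by
      refine Submodule.subset_span ⟨Fin.last _, ?_⟩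
      simp [longPathFamily]
    rw [← extendZero_val a i]
    by_cases hi : (i : ℕ) < m + 1
    · exact h1 _ hi
    · rw [show (i : ℕ) = m + 1 by omega]
      exact (Submodule.sub_mem_iff_left _ (h1 m (by omega))).mp h2

/-- The lattice `A₃` is `D₃`: a long path starts with the middle simple root. -/
theorem screeners_A₃ [Module.Finite ℤ L] [Module.Free ℤ L] {p : ℤ} (hp : 0 < p)
    (hpos : ∀ x : L, x ≠ 0 → 0 < B x x) (hsymm : B.IsSymm) (heven : ∀ x : L, Even (B x x))
    {N : Submodule ℤ L} (hN : IsScreenerSummand B N) {a : Fin 3 → L}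
    (hli : LinearIndependent ℤ a) (haN : Submodule.span ℤ (Set.range a) = N)
    (hG : ∀ k l, B (a k) (a l) = p * CartanMatrix.A 3 k l) :
    {x | x ∈ N ∧ B x x = 2 * p} ⊆ screeners B ∧
    ((screeners B ∩ N) \ {x | B x x = 2 * p}).encard = 6 ∧
    IsRootSetOfType B (screeners B ∩ N) (.C 3) := by
  have ha := RootGenerators.of_cartan (t := .A 3) haN hG
  have hmemN : ∀ i : Fin 3, a i ∈ N := ha.mem
  rw [CartanMatrix.A_three] at hG
  set b : ℕ → L := fun i => if i = 0 then a 1 else a 0 with hb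
  have hlong : IsLongPath B p 2 b (a 2 - a 0) := by
    refine ⟨⟨fun i hi => ?_, fun i hi => ?_, fun i j hij hj => by omega⟩, ?_, fun j hj => ?_,
      fun j hj => ?_⟩
    · interval_cases i <;> simp [hb, hG, mul_comm]
    · obtain rfl : i = 0 := by omega
      simp [hb, hG]
    · simp [hG]; ring
    · obtain rfl : j = 1 := by omega
      simp [hb, hG]; ring
    · obtain rfl : j = 0 := by omega
      simp [hb, hG]
  have hfam : longPathFamily 2 b (a 2 - a 0) = ![a 1, a 0, a 2 - a 0] := by
    funext i
    fin_cases i <;> simp [longPathFamily, hb]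
  have := hlong.isRootSetOfType (m := 1) hsymm hpos heven hp (by omega) (by omega) hli ha ?_ hN
  · refine ⟨this.1, this.2.1.trans ?_, this.2.2⟩
    norm_num
  · rw [hfam]
    have hmem : ∀ i, ![a 1, a 0, a 2 - a 0] i ∈
        Submodule.span ℤ (Set.range ![a 1, a 0, a 2 - a 0]) :=
      fun i => Submodule.subset_span ⟨i, rfl⟩
    refine span_eq_of_mem haN ?_ ?_
    · simp only [Fin.forall_fin_succ, IsEmpty.forall_iff, and_true]
      exact ⟨hmemN 1, hmemN 0, N.sub_mem (hmemN 2) (hmemN 0)⟩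
    · simp only [Fin.forall_fin_succ, IsEmpty.forall_iff, and_true]
      exact ⟨hmem 1, hmem 0, (Submodule.sub_mem_iff_left _ (hmem 1)).mp (hmem 2)⟩

end SequenceTypes

section AllTypes

variable {L : Type*} [AddCommGroup L] {B : LinearMap.BilinForm ℤ L}

/-- The type of the screeners of each of the summands. -/
theorem ScreenerType.isRootSetOfType [Module.Finite ℤ L] [Module.Free ℤ L]
    {p : ℕ} (hp : 0 < p) (hpos : ∀ x : L, x ≠ 0 → 0 < B x x) (hsymm : B.IsSymm)
    (heven : ∀ x : L, Even (B x x)) {N : Submodule ℤ L} (hN : IsScreenerSummand B N)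
    {K X : DynkinType} {m : ℕ} (hKX : ScreenerType K m X) (h : IsScaledRootLattice B N p m K) :
    IsRootSetOfType B (screeners B ∩ N) X := by
  have hp' : (0 : ℤ) < p := by exact_mod_cast hp
  cases hKX with
  | A_one_copies n hn =>
    obtain ⟨a, hli, haN, hG⟩ := h.exists_orthogonal_family
    obtain ⟨r, rfl⟩ : ∃ r, m = r + 1 := ⟨m - 1, by omega⟩
    have he : (fun i : Fin (r + 1) => extendZero a i) = a := funext fun i => extendZero_val a i
    refine screeners_A₁_copies hp' hpos hsymm heven hN (a := extendZero a) (by rwa [he])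
      (by rwa [he]) fun i hi j hj => ?_
    rw [extendZero_of_lt a (by omega : i < r + 1), extendZero_of_lt a (by omega : j < r + 1), hG]
    simp only [Fin.mk.injEq]
  | A_one =>
    obtain ⟨a, hli, haN, hG⟩ := h.exists_family
    exact screeners_A₁ hp' hpos hsymm heven hN hli haN hG
  | A_two =>
    obtain ⟨a, hli, haN, hG⟩ := h.exists_family
    exact screeners_A₂ hp' hpos hsymm heven hN hli (.of_cartan haN hG) hG
  | A_three =>
    obtain ⟨a, hli, haN, hG⟩ := h.exists_family
    exact (screeners_A₃ hp' hpos hsymm heven hN hli haN hG).2.2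
  | A n hn =>
    obtain ⟨a, hli, haN, hG⟩ := h.exists_family
    exact (screeners_A hp' hpos hsymm heven hN hn hli haN hG).2
  | D_four =>
    obtain ⟨a, hli, haN, hG⟩ := h.exists_family
    exact screeners_D₄ hp' hpos hsymm heven hN hli (.of_cartan haN hG) hG
  | D n hn =>
    obtain ⟨a, hli, haN, hG⟩ := h.exists_family
    exact (screeners_D hp' hpos hsymm heven hN hn hli haN hG).2.2
  | E_six =>
    obtain ⟨a, hli, haN, hG⟩ := h.exists_family
    exact (screeners_E hp' hpos hsymm heven hN (by simp) hli haN hG).2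
  | E_seven =>
    obtain ⟨a, hli, haN, hG⟩ := h.exists_family
    exact (screeners_E hp' hpos hsymm heven hN (by simp) hli haN hG).2
  | E_eight =>
    obtain ⟨a, hli, haN, hG⟩ := h.exists_family
    exact (screeners_E hp' hpos hsymm heven hN (by simp) hli haN hG).2

theorem ScreenerType.isListed {K X : DynkinType} {m : ℕ} (h : ScreenerType K m X) :
    IsListed X := by
  cases h with
  | A_one => exact .A_one
  | A_one_copies n hn =>
    obtain rfl | rfl | rfl | h : m = 2 ∨ m = 3 ∨ m = 4 ∨ 4 < m := by omega
    · exact .B_two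
    · exact .B_three
    · exact .B_four
    · exact .B m h
  | A_two => exact .G_two
  | A_three => exact .C_three
  | A n hn =>
    obtain rfl | h : n = 4 ∨ 4 < n := by omega
    · exact .A_four
    · exact .A n h
  | D_four => exact .F_four
  | D n hn => exact .C n hn
  | E_six => exact .E_six
  | E_seven => exact .E_seven
  | E_eight => exact .E_eight

end AllTypes

/-! ### Enlarging sublattices generated by roots -/

section RootExtension

variable {L : Type*} [AddCommGroup L] {B : LinearMap.BilinForm ℤ L}

/-- The vectors of `R` have norm `2p` and inner products in `pℤ`, and `R` contains the difference of
any two of its elements that have inner product `p`. -/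
structure IsRootLike (B : LinearMap.BilinForm ℤ L) (p : ℤ) (R : Set L) : Prop where
  norm_eq : ∀ x ∈ R, B x x = 2 * p
  dvd : ∀ x ∈ R, ∀ y ∈ R, p ∣ B x y
  sub_mem : ∀ x ∈ R, ∀ y ∈ R, B x y = p → y - x ∈ R

theorem form_eq_zero_of_mem_span {S : Set L} {x : L} (h : ∀ y ∈ S, B x y = 0) :
    ∀ y ∈ Submodule.span ℤ S, B x y = 0 := by
  intro y hy
  induction hy using Submodule.span_induction with
  | mem y hy => exact h y hy
  | zero => simp
  | add u v _ _ hu hv => rw [map_add, hu, hv, add_zero]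
  | smul m u _ hu => rw [map_smul, hu, smul_zero]

theorem eq_of_sub_mem_span (hpos : ∀ x : L, x ≠ 0 → 0 < B x x) {S : Set L} {x y : L}
    (hxy : x - y ∈ Submodule.span ℤ S) (h : ∀ z ∈ S, B x z = B y z) : x = y := by
  have h0 := form_eq_zero_of_mem_span (B := B) (S := S) (x := x - y)
    (fun z hz => by rw [map_sub, LinearMap.sub_apply, h z hz, sub_self]) _ hxy
  exact sub_eq_zero.mp (eq_zero_of_form_self_nonpos hpos h0.le)

namespace IsRootLike

variable {p : ℤ} {R : Set L}

theorem form_cases [Module.Free ℤ L] (hR : IsRootLike B p R) (hsymm : B.IsSymm)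
    (hpos : ∀ x : L, x ≠ 0 → 0 < B x x) {x y : L} (hx : x ∈ R) (hy : y ∈ R) (h1 : y ≠ x)
    (h2 : y ≠ -x) : B x y = -p ∨ B x y = 0 ∨ B x y = p := by
  obtain ⟨t, ht⟩ := hR.dvd x hx y hy
  have hlt : ¬ B x x ^ 2 ≤ B x y ^ 2 := fun h => by
    rcases eq_or_eq_neg_of_form_sq hsymm hpos (by rw [hR.norm_eq x hx, hR.norm_eq y hy]) h with h | h
    · exact h1 h
    · exact h2 h
  rw [hR.norm_eq x hx, ht] at hlt
  have h3 : t ^ 2 < 4 := by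
    by_contra h4
    exact hlt (by nlinarith [sq_nonneg p])
  have h4 : -2 < t := by nlinarith
  have h5 : t < 2 := by nlinarith
  obtain rfl | rfl | rfl : t = -1 ∨ t = 0 ∨ t = 1 := by omega
  · left; rw [ht]; ring
  · right; left; rw [ht]; ring
  · right; right; rw [ht]; ring

/-- A vector of `R` can be changed modulo the span of independent vectors `gᵢ` of `R` so that its
inner products with all `gᵢ` are not positive. -/
theorem exists_antidominant (hR : IsRootLike B p R) (hp : 0 < p) (hsymm : B.IsSymm)
    (hpos : ∀ x : L, x ≠ 0 → 0 < B x x) {ι : Type*} [Fintype ι] {g : ι → L}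
    (hg : ∀ i, g i ∈ R) (hli : LinearIndependent ℤ g) {x : L} (hx : x ∈ R)
    (hval : ∀ y ∈ R, y - x ∈ Submodule.span ℤ (Set.range g) → ∀ i,
      B (g i) y = -p ∨ B (g i) y = 0 ∨ B (g i) y = p) :
    ∃ y ∈ R, y - x ∈ Submodule.span ℤ (Set.range g) ∧
      ∀ i, B y (g i) = -p ∨ B y (g i) = 0 := by
  let T : Set L := {y | y ∈ R ∧ y - x ∈ Submodule.span ℤ (Set.range g)}
  have hTfin : T.Finite := by
    refine Set.Finite.of_finite_image (f := fun y i => B y (g i))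
      ((Set.Finite.pi' fun _ : ι => Set.finite_Icc (-p) p).subset ?_) ?_
    · rintro _ ⟨y, hy, rfl⟩ i
      have h1 := hval y hy.1 hy.2 i
      rw [show B (g i) y = B y (g i) from hsymm.eq _ _] at h1
      simp only [Set.mem_Icc]
      omega
    · intro y hy z hz hyz
      refine eq_of_sub_mem_span hpos (S := Set.range g) ?_ ?_
      · have := Submodule.sub_mem _ hy.2 hz.2
        rwa [sub_sub_sub_cancel_right] at this
      · rintro _ ⟨i, rfl⟩
        exact congrFun hyz i
  -- minimal elements for the order with the non-negative combinations of the `gᵢ` as positive cone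
  let C := Submodule.span ℕ (Set.range g)
  let _ : Preorder L :=
    { le := fun y z => z - y ∈ C
      le_refl := fun y => by simp
      le_trans := fun u v w h1 h2 => by
        have := C.add_mem h2 h1
        rwa [sub_add_sub_cancel] at this }
  obtain ⟨y, hy⟩ := hTfin.exists_minimal ⟨x, hx, by simp⟩
  refine ⟨y, hy.1.1, hy.1.2, fun i => ?_⟩
  rw [show B y (g i) = B (g i) y from hsymm.eq _ _]
  rcases hval y hy.1.1 hy.1.2 i with h | h | h
  · exact Or.inl h
  · exact Or.inr h
  · exfalso
    have hmem : y - g i ∈ T := by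
      refine ⟨hR.sub_mem _ (hg i) _ hy.1.1 h, ?_⟩
      rw [sub_right_comm]
      exact Submodule.sub_mem _ hy.1.2 (Submodule.subset_span ⟨i, rfl⟩)
    have h1 : y - g i ≤ y := by
      change y - (y - g i) ∈ C
      rw [sub_sub_cancel]
      exact Submodule.subset_span ⟨i, rfl⟩
    have h2 : y - g i - y ∈ C := hy.2 hmem h1
    rw [sub_sub_cancel_left, Submodule.mem_span_range_iff_exists_fun] at h2
    obtain ⟨c, hc⟩ := h2
    classical
    have h3 : ∑ j, ((c j : ℤ) + if j = i then 1 else 0) • g j = 0 := by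
      simp only [add_smul, Finset.sum_add_distrib, ite_smul, one_smul, zero_smul,
        Finset.sum_ite_eq', Finset.mem_univ, if_true, natCast_zsmul]
      rw [hc, neg_add_cancel]
    have h4 := Fintype.linearIndependent_iff.mp hli _ h3 i
    rw [if_pos rfl] at h4
    omega

/-- If a vector of `R` does not belong and is not orthogonal to the span of independent vectors of
`R`, among the non-negative combinations of which there is a "highest root" `∑ mᵢ gᵢ`, it can be
changed modulo this span so that it is attached to exactly one `gᵢ`, and that `mᵢ = 1`. -/
theorem exists_attached [Module.Free ℤ L] (hR : IsRootLike B p R) (hp : 0 < p) (hsymm : B.IsSymm)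
    (hpos : ∀ x : L, x ≠ 0 → 0 < B x x) {ι : Type*} [Fintype ι] {g : ι → L}
    (hg : ∀ i, g i ∈ R) (hli : LinearIndependent ℤ g) {m : ι → ℤ} (hm : ∀ i, 1 ≤ m i)
    (hθ : B (∑ i, m i • g i) (∑ i, m i • g i) = 2 * p) {x : L} (hx : x ∈ R)
    (hxM : x ∉ Submodule.span ℤ (Set.range g)) (hxg : ∃ i, B x (g i) ≠ 0) :
    ∃ y ∈ R, y - x ∈ Submodule.span ℤ (Set.range g) ∧
      ∃ i, m i = 1 ∧ B y (g i) = -p ∧ ∀ j ≠ i, B y (g j) = 0 := by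
  have hmem : ∀ i, g i ∈ Submodule.span ℤ (Set.range g) := fun i => Submodule.subset_span ⟨i, rfl⟩
  have hnot : ∀ y, y - x ∈ Submodule.span ℤ (Set.range g) →
      y ∉ Submodule.span ℤ (Set.range g) := fun y hy hy' => by
    have := Submodule.sub_mem _ hy' hy
    rw [sub_sub_cancel] at this
    exact hxM this
  obtain ⟨y, hyR, hyx, hy⟩ := hR.exists_antidominant hp hsymm hpos hg hli hx
    fun y hy hyx i => hR.form_cases hsymm hpos (hg i) hy
      (fun h => hnot y hyx (h ▸ hmem i)) (fun h => hnot y hyx (h ▸ Submodule.neg_mem _ (hmem i)))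
  refine ⟨y, hyR, hyx, ?_⟩
  obtain ⟨i, hi⟩ : ∃ i, B y (g i) = -p := by
    by_contra! hcon
    have h0 : ∀ i, B y (g i) = 0 := fun i => (hy i).resolve_left (hcon i)
    have h1 : B y (y - x) = 0 :=
      form_eq_zero_of_mem_span (by rintro _ ⟨i, rfl⟩; exact h0 i) _ hyx
    have h2 : B (y - x) (y - x) = 0 := by
      have h3 : B y x = 2 * p := by rw [map_sub, hR.norm_eq y hyR] at h1; omega
      simp only [map_sub, LinearMap.sub_apply, show B x y = B y x from hsymm.eq _ _, h3,
        hR.norm_eq y hyR, hR.norm_eq x hx]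
      ring
    have h4 := sub_eq_zero.mp (eq_zero_of_form_self_nonpos hpos h2.le)
    obtain ⟨i, hi⟩ := hxg
    exact hi (h4 ▸ h0 i)
  have hsum : B y (∑ i, m i • g i) = ∑ i, m i * B y (g i) := by
    simp only [map_sum, map_smul, smul_eq_mul]
  have hgt : -(2 * p) < B y (∑ i, m i • g i) := by
    by_contra! hle
    have h1 : B y y ^ 2 ≤ B y (∑ i, m i • g i) ^ 2 := by
      rw [hR.norm_eq y hyR]; nlinarith
    have hθM : ∑ i, m i • g i ∈ Submodule.span ℤ (Set.range g) :=
      Submodule.sum_mem _ fun i _ => Submodule.smul_mem _ _ (hmem i)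
    rcases eq_or_eq_neg_of_form_sq hsymm hpos (by rw [hR.norm_eq y hyR, hθ]) h1 with h | h
    · exact hnot y hyx (h ▸ hθM)
    · refine hnot y hyx ?_
      rw [← neg_neg y, ← h]
      exact Submodule.neg_mem _ hθM
  classical
  rw [hsum, ← Finset.add_sum_erase _ _ (Finset.mem_univ i), hi] at hgt
  have hle : ∀ j, m j * B y (g j) ≤ B y (g j) := fun j => by
    rcases hy j with h | h <;> rw [h]
    · nlinarith [hm j]
    · simp
  have hle0 : ∀ j, B y (g j) ≤ 0 := fun j => by rcases hy j with h | h <;> omega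
  refine ⟨i, ?_, hi, fun j hj => ?_⟩
  · have h1 : ∑ j ∈ Finset.univ.erase i, m j * B y (g j) ≤ 0 :=
      Finset.sum_nonpos fun j _ => (hle j).trans (hle0 j)
    have h2 := hm i
    by_contra h3
    have h4 : 2 ≤ m i := by omega
    nlinarith
  · refine (hy j).resolve_left fun hj' => ?_
    rw [← Finset.add_sum_erase _ _ (Finset.mem_erase.mpr ⟨hj, Finset.mem_univ j⟩), hj'] at hgt
    have h1 : ∑ j ∈ (Finset.univ.erase i).erase j, m j * B y (g j) ≤ 0 :=
      Finset.sum_nonpos fun j _ => (hle j).trans (hle0 j)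
    nlinarith [hm i, hm j]

end IsRootLike

end RootExtension

/-! ### Forks of roots -/

section RootForks

variable {L : Type*} [AddCommGroup L] {B : LinearMap.BilinForm ℤ L}

/-- A path with one more vector attached to the vector `aₖ`. -/
structure IsRootFork (B : LinearMap.BilinForm ℤ L) (p : ℤ) (n k : ℕ) (a : ℕ → L) (x : L) :
    Prop where
  path : IsRootPath B p n a
  norm_eq : B x x = 2 * p
  eq_neg : B x (a k) = -p
  eq_zero : ∀ j < n, j ≠ k → B x (a j) = 0

namespace IsRootPath

variable {p : ℤ} {n : ℕ} {a : ℕ → L}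

theorem sub (h : IsRootPath B p n a) {s m : ℕ} (hm : s + m ≤ n) :
    IsRootPath B p m fun i => a (s + i) :=
  ⟨fun i hi => h.norm_eq _ (by omega), fun i hi => h.succ_eq (s + i) (by omega),
    fun i j hij hj => h.far_eq _ _ (by omega) (by omega)⟩

theorem reverse (h : IsRootPath B p n a) (hsymm : B.IsSymm) :
    IsRootPath B p n fun i => a (n - 1 - i) := by
  refine ⟨fun i hi => h.norm_eq _ (by omega), fun i hi => ?_, fun i j hij hj => ?_⟩
  · rw [show B (a (n - 1 - i)) _ = B (a (n - 1 - (i + 1))) (a (n - 1 - i)) from hsymm.eq _ _,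
      show n - 1 - i = n - 1 - (i + 1) + 1 by omega]
    exact h.succ_eq _ (by omega)
  · rw [show B (a (n - 1 - i)) _ = B (a (n - 1 - j)) (a (n - 1 - i)) from hsymm.eq _ _]
    exact h.far_eq _ _ (by omega) (by omega)

end IsRootPath

/-- The sequence `x, a₀, a₁, …` -/
def consSeq (x : L) (a : ℕ → L) : ℕ → L
  | 0 => x
  | i + 1 => a i

namespace IsRootFork

variable {p : ℤ} {n k : ℕ} {a : ℕ → L} {x : L}

theorem form_apply (h : IsRootFork B p n k a x) {j : ℕ} (hj : j < n) :
    B x (a j) = if j = k then -p else 0 := by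
  split_ifs with hjk
  · rw [hjk, h.eq_neg]
  · exact h.eq_zero j hj hjk

theorem reverse (h : IsRootFork B p n k a x) (hsymm : B.IsSymm) (hk : k < n) :
    IsRootFork B p n (n - 1 - k) (fun i => a (n - 1 - i)) x := by
  refine ⟨h.path.reverse hsymm, h.norm_eq, ?_, fun j hj hjk => h.eq_zero _ (by omega) (by omega)⟩
  rw [show n - 1 - (n - 1 - k) = k by omega]
  exact h.eq_neg

theorem sub (h : IsRootFork B p n k a x) {s m : ℕ} (hm : s + m ≤ n) (hk : s ≤ k) :
    IsRootFork B p m (k - s) (fun i => a (s + i)) x :=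
  ⟨h.path.sub hm, h.norm_eq, by rw [show s + (k - s) = k by omega]; exact h.eq_neg,
    fun j hj hjk => h.eq_zero _ (by omega) (by omega)⟩

theorem isRootPath_consSeq (h : IsRootFork B p n 0 a x) : IsRootPath B p (n + 1) (consSeq x a) := by
  refine ⟨fun i hi => ?_, fun i hi => ?_, fun i j hij hj => ?_⟩
  · cases i with
    | zero => exact h.norm_eq
    | succ i => exact h.path.norm_eq i (by omega)
  · cases i with
    | zero => exact h.eq_neg
    | succ i => exact h.path.succ_eq i (by omega)
  · obtain ⟨j, rfl⟩ : ∃ r, j = r + 1 := ⟨j - 1, by omega⟩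
    cases i with
    | zero => exact h.eq_zero j (by omega) (by omega)
    | succ i => exact h.path.far_eq i j (by omega) (by omega)

theorem cons (h : IsRootFork B p n k a x) (hsymm : B.IsSymm) {y : L}
    (hy : IsRootFork B p n 0 a y) (hyx : B y x = 0) :
    IsRootFork B p (n + 1) (k + 1) (consSeq y a) x := by
  refine ⟨hy.isRootPath_consSeq, h.norm_eq, h.eq_neg, fun j hj hjk => ?_⟩
  cases j with
  | zero => exact (hsymm.eq _ _).trans hyx
  | succ j => exact h.eq_zero j (by omega) (by omega)

/-- A vector attached to the end of the path prolongs the path. -/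
theorem append (h : IsRootFork B p n k a x) (hsymm : B.IsSymm) (hk : k < n) {y : L}
    (hy : IsRootFork B p n (n - 1) a y) (hyx : B y x = 0) :
    IsRootFork B p (n + 1) k (Function.update a n y) x := by
  have hlt : ∀ i, i ≠ n → Function.update a n y i = a i := fun i hi =>
    Function.update_of_ne hi _ _
  have hn : Function.update a n y n = y := Function.update_self _ _ _
  refine ⟨⟨fun i hi => ?_, fun i hi => ?_, fun i j hij hj => ?_⟩, h.norm_eq, ?_, fun j hj hjk => ?_⟩
  · by_cases hin : i = n
    · rw [hin, hn]; exact hy.norm_eq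
    · rw [hlt i hin]; exact h.path.norm_eq i (by omega)
  · rw [hlt i (by omega)]
    by_cases hin : i + 1 = n
    · rw [hin, hn, show B (a i) y = B y (a i) from hsymm.eq _ _, show i = n - 1 by omega]
      exact hy.eq_neg
    · rw [hlt _ hin]; exact h.path.succ_eq i (by omega)
  · rw [hlt i (by omega)]
    by_cases hjn : j = n
    · rw [hjn, hn, show B (a i) y = B y (a i) from hsymm.eq _ _]
      exact hy.eq_zero i (by omega) (by omega)
    · rw [hlt _ hjn]; exact h.path.far_eq i j hij (by omega)
  · rw [hlt k hk.ne]; exact h.eq_neg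
  · by_cases hjn : j = n
    · rw [hjn, hn]; exact (hsymm.eq _ _).trans hyx
    · rw [hlt _ hjn]; exact h.eq_zero j (by omega) hjk

/-- In the type `D`, the vector attached to `a₁` and `a₀` can be exchanged. -/
theorem swap (h : IsRootFork B p n 1 a x) (hsymm : B.IsSymm) (hn : 2 ≤ n) :
    IsRootFork B p n 1 (consSeq x fun i => a (1 + i)) (a 0) := by
  have h1 := (h.sub (s := 1) (m := n - 1) (by omega) le_rfl).isRootPath_consSeq
  rw [show n - 1 + 1 = n by omega] at h1
  refine ⟨h1, h.path.norm_eq 0 (by omega), h.path.succ_eq 0 (by omega), fun j hj hjk => ?_⟩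
  cases j with
  | zero => exact (hsymm.eq _ _).trans (h.eq_zero 0 (by omega) (by omega))
  | succ j => exact h.path.far_eq 0 (1 + j) (by omega) (by omega)

theorem form_sum (h : IsRootFork B p n k a x) (c : ℕ → ℤ) {m : ℕ}
    (hm : m ≤ n) (hkm : k < m) :
    B x (∑ i ∈ Finset.range m, c i • a i) = -(p * c k) := by
  simp only [map_sum, map_smul, smul_eq_mul]
  rw [Finset.sum_eq_single k, h.eq_neg]
  · ring
  · intro j hj hjk
    rw [h.eq_zero j (by simp at hj; omega) hjk, mul_zero]
  · intro hk'
    exact absurd (Finset.mem_range.mpr hkm) hk'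

/-- The quadratic form of a fork, with the path in the coordinates of `ℤᵐ⁺²`. -/
theorem norm_sum (h : IsRootFork B p n k a x) (hsymm : B.IsSymm) (c : ℕ → ℤ) (d : ℤ)
    {m : ℕ} (hm : m < n) (hkm : k ≤ m) :
    B (∑ i ∈ Finset.range (m + 1), c i • a i + d • x)
        (∑ i ∈ Finset.range (m + 1), c i • a i + d • x) =
      p * (∑ j ∈ Finset.range (m + 1), pathDiff c j ^ 2 + c m ^ 2 + 2 * d ^ 2 - 2 * d * c k) := by
  have h1 := h.path.norm_sum hsymm c hm
  have h2 := h.form_sum c (show m + 1 ≤ n by omega) (by omega)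
  generalize ∑ i ∈ Finset.range (m + 1), c i • a i = s at h1 h2 ⊢
  simp only [map_add, LinearMap.add_apply, map_smul, LinearMap.smul_apply, smul_eq_mul,
    show B s x = B x s from hsymm.eq _ _, h1, h2, h.norm_eq]
  ring

/-- The coefficients of a relation between the vectors of a fork grow linearly from the start of the
path, with a slope smaller by the coefficient `d` of the attached vector from `aₖ` on. -/
theorem apply_eq_of_pathDiff_sub {c : ℕ → ℤ} {d : ℤ} {n k : ℕ} (hk : k < n)
    (hc : ∀ j < n, pathDiff c j - pathDiff c (j + 1) = if j = k then d else 0) :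
    ∀ j < n, c j = (j + 1) * c 0 - (j - k : ℕ) * d ∧
      c (j + 1) = (j + 2) * c 0 - (j + 1 - k : ℕ) * d := by
  intro j hj
  induction j with
  | zero =>
    have h0 := hc 0 hj
    simp only [pathDiff] at h0
    refine ⟨by simp, ?_⟩
    split_ifs at h0 with hk0
    · subst hk0; push_cast; linear_combination -h0
    · rw [show 0 + 1 - k = 0 by omega]; push_cast; linear_combination -h0
  | succ j ih =>
    obtain ⟨h1, h2⟩ := ih (by omega)
    have h0 := hc (j + 1) hj
    simp only [pathDiff] at h0
    refine ⟨by rw [h2]; push_cast; ring, ?_⟩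
    rcases lt_trichotomy (j + 1) k with hjk | hjk | hjk
    · rw [if_neg (by omega)] at h0
      rw [show j - k = 0 by omega] at h1
      rw [show j + 1 - k = 0 by omega] at h2
      rw [show j + 1 + 1 - k = 0 by omega]
      push_cast at *
      linear_combination 2 * h2 - h1 - h0
    · rw [if_pos hjk] at h0
      rw [show j - k = 0 by omega] at h1
      rw [show j + 1 - k = 0 by omega] at h2
      rw [show j + 1 + 1 - k = 1 by omega]
      push_cast at *
      linear_combination 2 * h2 - h1 - h0
    · rw [if_neg (by omega)] at h0
      obtain ⟨r, rfl⟩ : ∃ r, j = k + r := ⟨j - k, by omega⟩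
      rw [show k + r - k = r by omega] at h1
      rw [show k + r + 1 - k = r + 1 by omega] at h2
      rw [show k + r + 1 + 1 - k = r + 2 by omega]
      push_cast at *
      linear_combination 2 * h2 - h1 - h0

/-- The vectors of a fork, as a finite family. -/
def family (n : ℕ) (a : ℕ → L) (x : L) : Option (Fin n) → L
  | none => x
  | some i => a i

theorem sum_family (a : ℕ → L) (x : L) (c : Option (Fin n) → ℤ) :
    ∑ i, c i • family n a x i =
      ∑ i ∈ Finset.range n, extendZero (fun i => c (some i)) i • a i + c none • x := by
  rw [Fintype.sum_option, add_comm, Finset.sum_range]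
  congr 1
  exact Finset.sum_congr rfl fun i _ => by rw [extendZero_val]; rfl

/-- The Gram determinant of the fork is, up to sign and scale, `2(n + 1) - (k + 1)(n - k)`. -/
theorem linearIndependent (h : IsRootFork B p n k a x) (hp : 0 < p) (hsymm : B.IsSymm) (hk : k < n)
    (hdet : ((k : ℤ) + 1) * (n - k) ≠ 2 * (n + 1)) : LinearIndependent ℤ (family n a x) := by
  rw [Fintype.linearIndependent_iff]
  intro c hc0
  rw [sum_family] at hc0
  set e := extendZero fun i => c (some i) with he
  set d := c none with hd
  have hen : e n = 0 := by simp [he, extendZero]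
  have h1 : ∀ j < n, pathDiff e j - pathDiff e (j + 1) = if j = k then d else 0 := by
    intro j hj
    have h2 := congrArg (fun y => B y (a j)) hc0
    simp only [map_add, LinearMap.add_apply, map_smul, LinearMap.smul_apply, smul_eq_mul,
      h.path.form_sum_apply hsymm e hj, h.form_apply hj, map_zero, LinearMap.zero_apply] at h2
    have h3 : (if j + 1 < n then pathDiff e (j + 1) else -e j) = pathDiff e (j + 1) := by
      split_ifs with hjn
      · rfl
      · obtain rfl : n = j + 1 := by omega
        simp only [pathDiff, hen]; ring
    rw [h3] at h2
    refine mul_left_cancel₀ hp.ne' ?_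
    split_ifs at h2 ⊢ <;> linear_combination h2
  have h2 : e k = 2 * d := by
    have h2 := congrArg (B x) hc0
    rw [map_add, h.form_sum e le_rfl hk, map_smul, h.norm_eq, map_zero, smul_eq_mul] at h2
    refine mul_left_cancel₀ hp.ne' ?_
    linear_combination -h2
  have h3 := apply_eq_of_pathDiff_sub hk h1
  obtain ⟨m, rfl⟩ : ∃ m, n = m + 1 := ⟨n - 1, by omega⟩
  have h4 := (h3 k hk).1
  have h5 := (h3 m (by omega)).2
  rw [Nat.sub_self, h2] at h4
  rw [hen, Nat.cast_sub (by omega)] at h5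
  push_cast at h4 h5 hdet
  -- eliminating `c₀` leaves `d` times the determinant
  have h6 : d = 0 := by
    have h7 : d * (((k : ℤ) + 1) * (m + 1 - k) - 2 * (m + 1 + 1)) = 0 := by
      linear_combination (-(m : ℤ) - 2) * h4 + (k + 1 : ℤ) * h5
    rcases mul_eq_zero.mp h7 with h8 | h8
    · exact h8
    · exact absurd (by linear_combination h8) hdet
  have h7 : e 0 = 0 := by
    rw [h6] at h4
    have : ((k : ℤ) + 1) * e 0 = 0 := by linear_combination -h4
    rcases mul_eq_zero.mp this with h8 | h8
    · omega
    · exact h8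
  rintro (_ | i)
  · exact h6
  · have := (h3 i i.is_lt).1
    rw [h6, h7, he, extendZero_val] at this
    simpa using this

end IsRootFork

theorem IsRootPath.linearIndependent {p : ℤ} {n : ℕ} {a : ℕ → L} (h : IsRootPath B p n a)
    (hp : 0 < p) (hsymm : B.IsSymm) : LinearIndependent ℤ fun i : Fin n => a i := by
  rw [Fintype.linearIndependent_iff]
  intro c hc0 i
  have h1 := h.norm_sum_of_eq_zero hsymm (c := extendZero c) (by simp [extendZero])
  have h2 : ∑ i ∈ Finset.range n, extendZero c i • a i = 0 := by
    rw [← hc0, Finset.sum_range]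
    exact Finset.sum_congr rfl fun i _ => by rw [extendZero_val]
  rw [h2, map_zero, zero_eq_mul] at h1
  have h3 := sum_sq_eq_zero (h1.resolve_left hp.ne')
  rw [← extendZero_val c i, ← sum_pathDiff (extendZero c)]
  exact Finset.sum_eq_zero fun j hj => h3 j (by simp at hj; omega)

end RootForks

/-! ### Sublattices of type A, D and E -/

section SimplyLacedSpans

variable {L : Type*} [AddCommGroup L] {B : LinearMap.BilinForm ℤ L}

/-- The sublattices spanned by vectors of `R` that are simple roots of type `Aₙ` with `n ≥ 2`, `Dₙ`
with `n ≥ 4` or `Eₙ`. -/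
inductive IsSimplyLacedSpan (B : LinearMap.BilinForm ℤ L) (p : ℤ) (R : Set L) :
    Submodule ℤ L → Prop
  | path (n : ℕ) (a : ℕ → L) (hn : 2 ≤ n) (h : IsRootPath B p n a) (ha : ∀ i < n, a i ∈ R) :
    IsSimplyLacedSpan B p R (Submodule.span ℤ (Set.range fun i : Fin n => a i))
  | fork (n k : ℕ) (a : ℕ → L) (x : L) (hnk : k = 1 ∧ 3 ≤ n ∨ k = 2 ∧ 5 ≤ n ∧ n ≤ 7)
    (h : IsRootFork B p n k a x) (ha : ∀ i < n, a i ∈ R) (hx : x ∈ R) :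
    IsSimplyLacedSpan B p R (Submodule.span ℤ (Set.range (IsRootFork.family n a x)))

variable {p : ℤ} {R : Set L}

namespace IsRootFork

variable {n k : ℕ} {a : ℕ → L} {x : L}

theorem mem_span (n : ℕ) (a : ℕ → L) (x : L) :
    x ∈ Submodule.span ℤ (Set.range (family n a x)) := Submodule.subset_span ⟨none, rfl⟩

theorem apply_mem_span (a : ℕ → L) (x : L) {i : ℕ} (hi : i < n) :
    a i ∈ Submodule.span ℤ (Set.range (family n a x)) := Submodule.subset_span ⟨some ⟨i, hi⟩, rfl⟩

/-- The combination of the vectors of an affine diagram with the marks as coefficients is zero. -/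
theorem affine_eq_zero (h : IsRootFork B p n k a x) (hsymm : B.IsSymm)
    (hpos : ∀ x : L, x ≠ 0 → 0 < B x x) (c : ℕ → ℤ) (d : ℤ) {m : ℕ} (hm : m < n) (hkm : k ≤ m)
    (hc : ∑ j ∈ Finset.range (m + 1), pathDiff c j ^ 2 + c m ^ 2 + 2 * d ^ 2 - 2 * d * c k = 0) :
    ∑ i ∈ Finset.range (m + 1), c i • a i + d • x = 0 := by
  refine eq_zero_of_form_self_nonpos hpos ?_
  rw [h.norm_sum hsymm c d hm hkm, hc, mul_zero]

/-- The marks of the affine diagram of type `Ẽ₈`, along its longest path. -/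
def marksE₈ : ℕ → ℤ
  | 0 => 2 | 1 => 4 | 2 => 6 | 3 => 5 | 4 => 4 | 5 => 3 | 6 => 2 | 7 => 1 | _ => 0

/-- The marks of the affine diagram of type `Ẽ₇`, along its longest path. -/
def marksE₇ : ℕ → ℤ
  | 0 => 1 | 1 => 2 | 2 => 3 | 3 => 4 | 4 => 3 | 5 => 2 | 6 => 1 | _ => 0

theorem affineE₈ (h : IsRootFork B p n 2 a x) (hsymm : B.IsSymm)
    (hpos : ∀ x : L, x ≠ 0 → 0 < B x x) (hn : 8 ≤ n) :
    a 7 = -(∑ i ∈ Finset.range 7, marksE₈ i • a i + (3 : ℤ) • x) := by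
  have := h.affine_eq_zero hsymm hpos marksE₈ 3 (show 7 < n by omega) (by omega) (by decide)
  rw [Finset.sum_range_succ] at this
  rw [eq_neg_iff_add_eq_zero, ← this]
  simp only [marksE₈, one_smul]
  abel

theorem affineE₇ (h : IsRootFork B p n 3 a x) (hsymm : B.IsSymm)
    (hpos : ∀ x : L, x ≠ 0 → 0 < B x x) (hn : 7 ≤ n) :
    a 0 = -(∑ i ∈ Finset.range 6, marksE₇ (i + 1) • a (i + 1) + (2 : ℤ) • x) := by
  have := h.affine_eq_zero hsymm hpos marksE₇ 2 (show 6 < n by omega) (by omega) (by decide)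
  rw [Finset.sum_range_succ'] at this
  rw [eq_neg_iff_add_eq_zero, ← this]
  simp only [marksE₇, one_smul]
  abel

/-- A path with one more vector attached in its first half spans a lattice of type `A`, `D` or `E`:
where the diagram contains the affine ones of type `Ẽ₇` or `Ẽ₈`, it has to be equal to them, and one
vector is redundant. -/
theorem exists_span_of_le (h : IsRootFork B p n k a x) (hsymm : B.IsSymm) (hp : 0 < p)
    (hpos : ∀ x : L, x ≠ 0 → 0 < B x x) (hk : 2 * k + 1 ≤ n) (ha : ∀ i < n, a i ∈ R)
    (hx : x ∈ R) : ∃ M, IsSimplyLacedSpan B p R M ∧ x ∈ M ∧ ∀ i < n, a i ∈ M := by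
  obtain rfl | rfl | rfl | hk3 : k = 0 ∨ k = 1 ∨ k = 2 ∨ 3 ≤ k := by omega
  · refine ⟨_, .path (n + 1) (consSeq x a) (by omega) h.isRootPath_consSeq fun i hi => ?_,
      Submodule.subset_span ⟨0, rfl⟩, fun i hi => Submodule.subset_span ⟨⟨i + 1, by omega⟩, rfl⟩⟩
    cases i with
    | zero => exact hx
    | succ i => exact ha i (by omega)
  · exact ⟨_, .fork n 1 a x (by omega) h ha hx, mem_span n a x, fun i hi => apply_mem_span a x hi⟩
  · by_cases hn7 : n ≤ 7
    · exact ⟨_, .fork n 2 a x (by omega) h ha hx, mem_span n a x,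
        fun i hi => apply_mem_span a x hi⟩
    have h7 := h.affineE₈ hsymm hpos (by omega)
    obtain rfl : n = 8 := by
      by_contra hn8
      -- all terms of the affine relation but `a₇` are orthogonal to `a₈`
      have h8 := congrArg (fun y => B y (a 8)) h7
      simp only [map_neg, map_add, LinearMap.neg_apply, LinearMap.add_apply, map_sum,
        LinearMap.sum_apply, map_smul, LinearMap.smul_apply] at h8
      rw [h.path.succ_eq 7 (by omega), h.eq_zero 8 (by omega) (by omega),
        Finset.sum_eq_zero fun i hi => by
          rw [h.path.far_eq i 8 (by simp at hi; omega) (by omega), smul_zero]] at h8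
      simp at h8
      omega
    have h' := h.sub (s := 0) (m := 7) (by omega) (by omega)
    simp only [zero_add] at h'
    refine ⟨_, .fork 7 2 a x (by omega) h' (fun i hi => ha i (by omega)) hx, mem_span 7 a x,
      fun i hi => ?_⟩
    by_cases hi7 : i < 7
    · exact apply_mem_span a x hi7
    · rw [show i = 7 by omega, h7]
      exact Submodule.neg_mem _ (Submodule.add_mem _ (Submodule.sum_mem _ fun j hj =>
        Submodule.smul_mem _ _ (apply_mem_span a x (by simpa using hj)))
        (Submodule.smul_mem _ _ (mem_span 7 a x)))
  -- the path reaches at least three steps away from `aₖ` on either side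
  · have h' := h.sub (s := k - 3) (m := n - (k - 3)) (by omega) (by omega)
    rw [show k - (k - 3) = 3 by omega] at h'
    have h0 := h'.affineE₇ hsymm hpos (by omega)
    obtain rfl : n = 7 := by
      by_contra hn7
      -- all terms of the affine relation but the last one `aₖ₊₃` are orthogonal to `aₖ₊₄`
      have h8 := congrArg (fun y => B y (a (k - 3 + 7))) h0
      simp only [map_neg, map_add, LinearMap.neg_apply, LinearMap.add_apply,
        Finset.sum_range_succ _ 5, LinearMap.sum_apply, map_smul, LinearMap.smul_apply, map_sum]
        at h8
      rw [h.path.far_eq _ _ (by omega) (by omega), h.eq_zero _ (by omega) (by omega),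
        Finset.sum_eq_zero fun i hi => by
          rw [h.path.far_eq _ _ (by simp at hi; omega) (by omega), smul_zero],
        h.path.succ_eq (k - 3 + (5 + 1)) (by omega)] at h8
      simp [marksE₇] at h8
      omega
    obtain rfl : k = 3 := by omega
    simp only [tsub_self, zero_add] at h0
    have h1 := h.sub (s := 1) (m := 6) (by omega) (by omega)
    refine ⟨_, .fork 6 2 (fun i => a (1 + i)) x (by omega) h1 (fun i hi => ha _ (by omega)) hx,
      mem_span _ _ x, fun i hi => ?_⟩
    have hmem : ∀ i < 6, a (i + 1) ∈ Submodule.span ℤ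
        (Set.range (IsRootFork.family 6 (fun i => a (1 + i)) x)) := fun i hi => by
      rw [add_comm]
      exact apply_mem_span (fun i => a (1 + i)) x hi
    cases i with
    | zero =>
      rw [h0]
      exact Submodule.neg_mem _ (Submodule.add_mem _ (Submodule.sum_mem _ fun j hj =>
        Submodule.smul_mem _ _ (hmem j (by simpa using hj)))
        (Submodule.smul_mem _ _ (mem_span _ _ x)))
    | succ i => exact hmem i (by omega)

theorem exists_span (h : IsRootFork B p n k a x) (hsymm : B.IsSymm) (hp : 0 < p)
    (hpos : ∀ x : L, x ≠ 0 → 0 < B x x) (hk : k < n) (ha : ∀ i < n, a i ∈ R)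
    (hx : x ∈ R) : ∃ M, IsSimplyLacedSpan B p R M ∧ x ∈ M ∧ ∀ i < n, a i ∈ M := by
  by_cases hkn : 2 * k + 1 ≤ n
  · exact h.exists_span_of_le hsymm hp hpos hkn ha hx
  · obtain ⟨M, h1, h2, h3⟩ := (h.reverse hsymm hk).exists_span_of_le hsymm hp hpos (by omega)
      (fun i hi => ha _ (by omega)) hx
    refine ⟨M, h1, h2, fun i hi => ?_⟩
    have := h3 (n - 1 - i) (by omega)
    rwa [show n - 1 - (n - 1 - i) = i by omega] at this

/-- The vectors of `R` outside of the span of a fork and not orthogonal to it, with `cᵢ` and `d` the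
marks of the highest root, can be changed modulo this span so that they are attached to one vector of mark `1`. -/
theorem exists_attached [Module.Free ℤ L] (h : IsRootFork B p n k a x) (hR : IsRootLike B p R)
    (hp : 0 < p) (hsymm : B.IsSymm) (hpos : ∀ x : L, x ≠ 0 → 0 < B x x) (hk : k < n)
    (hdet : ((k : ℤ) + 1) * (n - k) ≠ 2 * (n + 1)) (ha : ∀ i < n, a i ∈ R) (hx : x ∈ R)
    (c : ℕ → ℤ) (d : ℤ) (hc : ∀ i < n, 1 ≤ c i) (hd : 1 ≤ d)
    (hθ : ∑ j ∈ Finset.range n, pathDiff c j ^ 2 + c (n - 1) ^ 2 + 2 * d ^ 2 - 2 * d * c k = 2)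
    {z : L} (hz : z ∈ R) (hzM : z ∉ Submodule.span ℤ (Set.range (family n a x)))
    (hzg : ∃ i, B z (family n a x i) ≠ 0) :
    ∃ y ∈ R, y - z ∈ Submodule.span ℤ (Set.range (family n a x)) ∧
      ((d = 1 ∧ B y x = -p ∧ ∀ i < n, B y (a i) = 0) ∨
        ∃ i < n, c i = 1 ∧ IsRootFork B p n i a y ∧ B y x = 0) := by
  let m : Option (Fin n) → ℤ := fun i => i.elim d fun i => c i
  have hsum : ∑ i, m i • family n a x i = ∑ i ∈ Finset.range n, c i • a i + d • x := by
    rw [Fintype.sum_option, add_comm, Finset.sum_range]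
    rfl
  obtain ⟨y, hy, hyz, i, hmi, hi, hj⟩ := hR.exists_attached hp hsymm hpos (g := family n a x)
    (fun i => by cases i with
      | none => exact hx
      | some i => exact ha i i.is_lt)
    (h.linearIndependent hp hsymm hk hdet) (m := m)
    (fun i => by cases i with
      | none => exact hd
      | some i => exact hc i i.is_lt)
    (by
      have := h.norm_sum hsymm c d (show n - 1 < n by omega) (by omega)
      rw [show n - 1 + 1 = n by omega, hθ] at this
      rw [hsum, this, mul_comm]) hz hzM hzg
  refine ⟨y, hy, hyz, ?_⟩
  cases i with
  | none => exact Or.inl ⟨hmi, hi, fun j hjn => hj (some ⟨j, hjn⟩) (by simp)⟩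
  | some i =>
    refine Or.inr ⟨i, i.is_lt, hmi, ⟨h.path, hR.norm_eq y hy, hi, fun j hjn hji => ?_⟩,
      hj none (by simp)⟩
    exact hj (some ⟨j, hjn⟩) fun h => hji (by rw [← Option.some.inj h])

/-- The coefficients of the highest root of `Dₙ₊₁` on the path of length `n`. -/
theorem sum_sq_marks_D {n : ℕ} (hn : 3 ≤ n) :
    ∑ j ∈ Finset.range n, pathDiff (fun i => if i = 0 ∨ i + 1 = n then 1 else 2) j ^ 2 = 3 := by
  obtain ⟨r, rfl⟩ : ∃ r, n = r + 3 := ⟨n - 3, by omega⟩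
  rw [Finset.sum_range_succ, Finset.sum_range_succ', Finset.sum_range_succ',
    Finset.sum_eq_zero fun i hi => ?_]
  · simp [pathDiff]
  · have := Finset.mem_range.mp hi
    simp only [pathDiff]
    rw [if_neg (by omega), if_neg (by omega)]
    rfl

/-- A vector of `R` not orthogonal to a sublattice of type `D` or `E` enlarges it: changed modulo
the sublattice, it is attached to an end of the fork, and there is again a path with one vector
attached. -/
theorem exists_extension [Module.Free ℤ L] (h : IsRootFork B p n k a x)
    (hnk : k = 1 ∧ 3 ≤ n ∨ k = 2 ∧ 5 ≤ n ∧ n ≤ 7) (hR : IsRootLike B p R)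
    (hp : 0 < p) (hsymm : B.IsSymm) (hpos : ∀ x : L, x ≠ 0 → 0 < B x x)
    (ha : ∀ i < n, a i ∈ R) (hx : x ∈ R)
    {z : L} (hz : z ∈ R) (hzM : z ∉ Submodule.span ℤ (Set.range (family n a x)))
    (hzg : ∃ i, B z (family n a x i) ≠ 0) :
    ∃ M y, IsSimplyLacedSpan B p R M ∧ y ∈ M ∧
      y - z ∈ Submodule.span ℤ (Set.range (family n a x)) ∧ x ∈ M ∧ ∀ i < n, a i ∈ M := by
  have hcons : ∀ {a : ℕ → L} {x y : L}, IsRootFork B p n k a x → IsRootFork B p n 0 a y →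
      B y x = 0 → (∀ i < n, a i ∈ R) → x ∈ R → y ∈ R →
      ∃ M, IsSimplyLacedSpan B p R M ∧ y ∈ M ∧ x ∈ M ∧ ∀ i < n, a i ∈ M := by
    intro a x y h hy hyx ha hx hyR
    obtain ⟨M, hM, hxM, haM⟩ := (h.cons hsymm hy hyx).exists_span (R := R) hsymm hp hpos (by omega)
      (fun i hi => by cases i with
        | zero => exact hyR
        | succ i => exact ha i (by omega)) hx
    exact ⟨M, hM, haM 0 (by omega), hxM, fun i hi => haM (i + 1) (by omega)⟩
  have happend : ∀ {y : L}, IsRootFork B p n (n - 1) a y → B y x = 0 → y ∈ R →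
      ∃ M, IsSimplyLacedSpan B p R M ∧ y ∈ M ∧ x ∈ M ∧ ∀ i < n, a i ∈ M := by
    intro y hy hyx hyR
    obtain ⟨M, hM, hxM, haM⟩ := (h.append hsymm (by omega) hy hyx).exists_span (R := R) hsymm hp
      hpos (by omega)
      (fun i hi => by
        by_cases hin : i = n
        · rw [hin, Function.update_self]; exact hyR
        · rw [Function.update_of_ne hin]; exact ha i (by omega)) hx
    refine ⟨M, hM, ?_, hxM, fun i hi => ?_⟩
    · have := haM n (by omega)
      rwa [Function.update_self] at this
    · have := haM i (by omega)
      rwa [Function.update_of_ne hi.ne] at this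
  rcases hnk with ⟨rfl, hn⟩ | ⟨rfl, hn5, hn7⟩
  · obtain ⟨y, hyR, hyz, ⟨-, hyx, hya⟩ | ⟨i, hi, hci, hyi, hyx⟩⟩ := h.exists_attached hR hp hsymm hpos
      (by omega) (by push_cast; omega) ha hx (fun i => if i = 0 ∨ i + 1 = n then 1 else 2) 1
      (fun i _ => by split_ifs <;> norm_num) le_rfl
      (by
        rw [sum_sq_marks_D hn, if_pos (by omega), if_neg (by omega)]
        norm_num) hz hzM hzg
    · obtain ⟨M, hM, hyM, h0M, haM⟩ := hcons (h.swap hsymm (by omega))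
        (y := y) ⟨(h.swap hsymm (by omega)).path, hR.norm_eq y hyR, hyx, fun j hj hj0 => by
          cases j with
          | zero => exact absurd rfl hj0
          | succ j => exact hya (1 + j) (by omega)⟩ (hya 0 (by omega))
        (fun i hi => by cases i with
          | zero => exact hx
          | succ i => exact ha _ (by omega)) (ha 0 (by omega)) hyR
      refine ⟨M, y, hM, hyM, hyz, haM 0 (by omega), fun i hi => ?_⟩
      cases i with
      | zero => exact h0M
      | succ i =>
        rw [add_comm i 1]
        exact haM (i + 1) hi
    · have hi' : i = 0 ∨ i = n - 1 := by
        split_ifs at hci <;> omega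
      rcases hi' with rfl | rfl
      · obtain ⟨M, hM, hyM, hxM, haM⟩ := hcons h hyi hyx ha hx hyR
        exact ⟨M, y, hM, hyM, hyz, hxM, haM⟩
      · obtain ⟨M, hM, hyM, hxM, haM⟩ := happend hyi hyx hyR
        exact ⟨M, y, hM, hyM, hyz, hxM, haM⟩
  -- the highest roots of `E₆`, `E₇`, `E₈`, with coefficients `1` only at ends of the path
  · obtain rfl | rfl | rfl : n = 5 ∨ n = 6 ∨ n = 7 := by omega
    · obtain ⟨y, hyR, hyz, ⟨hd, -, -⟩ | ⟨i, hi, hci, hyi, hyx⟩⟩ := h.exists_attached hR hp hsymm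
        hpos (by omega) (by norm_num) ha hx (fun i => [1, 2, 3, 2, 1].getD i 0) 2
        (by decide) (by norm_num) (by decide) hz hzM hzg
      · norm_num at hd
      · have hi' : i = 0 ∨ i = 4 := by
          clear hyi
          interval_cases i <;> simp at hci ⊢
        rcases hi' with rfl | rfl
        · obtain ⟨M, hM, hyM, hxM, haM⟩ := hcons h hyi hyx ha hx hyR
          exact ⟨M, y, hM, hyM, hyz, hxM, haM⟩
        · obtain ⟨M, hM, hyM, hxM, haM⟩ := happend hyi hyx hyR
          exact ⟨M, y, hM, hyM, hyz, hxM, haM⟩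
    · obtain ⟨y, hyR, hyz, ⟨hd, -, -⟩ | ⟨i, hi, hci, hyi, hyx⟩⟩ := h.exists_attached hR hp hsymm
        hpos (by omega) (by norm_num) ha hx (fun i => [2, 3, 4, 3, 2, 1].getD i 0) 2
        (by decide) (by norm_num) (by decide) hz hzM hzg
      · norm_num at hd
      · obtain rfl : i = 5 := by
          clear hyi
          interval_cases i <;> simp at hci ⊢
        obtain ⟨M, hM, hyM, hxM, haM⟩ := happend hyi hyx hyR
        exact ⟨M, y, hM, hyM, hyz, hxM, haM⟩
    · obtain ⟨y, hyR, hyz, ⟨hd, -, -⟩ | ⟨i, hi, hci, hyi, hyx⟩⟩ := h.exists_attached hR hp hsymm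
        hpos (by omega) (by norm_num) ha hx (fun i => [2, 4, 6, 5, 4, 3, 2].getD i 0) 3
        (by decide) (by norm_num) (by decide) hz hzM hzg
      · norm_num at hd
      · clear hyi
        interval_cases i <;> simp at hci

end IsRootFork

/-- A vector of `R` not orthogonal to a sublattice of type `A` enlarges it. -/
theorem IsRootPath.exists_extension [Module.Free ℤ L] {n : ℕ} {a : ℕ → L} (h : IsRootPath B p n a)
    (hn : 0 < n) (hR : IsRootLike B p R)
    (hp : 0 < p) (hsymm : B.IsSymm) (hpos : ∀ x : L, x ≠ 0 → 0 < B x x)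
    (ha : ∀ i < n, a i ∈ R) {z : L} (hz : z ∈ R)
    (hzM : z ∉ Submodule.span ℤ (Set.range fun i : Fin n => a i))
    (hzg : ∃ i : Fin n, B z (a i) ≠ 0) :
    ∃ M y, IsSimplyLacedSpan B p R M ∧ y ∈ M ∧
      y - z ∈ Submodule.span ℤ (Set.range fun i : Fin n => a i) ∧ ∀ i < n, a i ∈ M := by
  obtain ⟨y, hyR, hyz, i, -, hi, hj⟩ := hR.exists_attached hp hsymm hpos
    (g := fun i : Fin n => a i) (fun i => ha i i.is_lt) (h.linearIndependent hp hsymm)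
    (m := fun _ => 1) (fun _ => le_rfl)
    (by
      have := h.norm_sum hsymm (fun _ => 1) (show n - 1 < n by omega)
      rw [show n - 1 + 1 = n by omega, Finset.sum_range] at this
      rw [this, show n = n - 1 + 1 by omega, Finset.sum_range_succ', Finset.sum_eq_zero]
      · simp [pathDiff]; ring
      · intro j _
        simp [pathDiff]) hz hzM hzg
  obtain ⟨M, hM, hyM, haM⟩ := (IsRootFork.exists_span (k := i) (x := y) ⟨h, hR.norm_eq y hyR, hi,
    fun j hjn hji => hj ⟨j, hjn⟩ fun h => hji (by rw [← h])⟩ hsymm hp hpos i.is_lt ha hyR)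
  exact ⟨M, y, hM, hyM, hyz, haM⟩

namespace IsSimplyLacedSpan

variable {M : Submodule ℤ L}

/-- A vector of `R` that is neither in the sublattice nor orthogonal to it enlarges it. -/
theorem exists_extension [Module.Free ℤ L] (hM : IsSimplyLacedSpan B p R M)
    (hR : IsRootLike B p R) (hp : 0 < p) (hsymm : B.IsSymm)
    (hpos : ∀ x : L, x ≠ 0 → 0 < B x x) {z : L} (hz : z ∈ R) (hzM : z ∉ M)
    (hzg : ∃ y ∈ M, B z y ≠ 0) : ∃ M', IsSimplyLacedSpan B p R M' ∧ M < M' := by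
  have key : ∀ {ι : Type} {g : ι → L} {M' : Submodule ℤ L} {y : L}, (∀ i, g i ∈ M') → y ∈ M' →
      z ∉ Submodule.span ℤ (Set.range g) → y - z ∈ Submodule.span ℤ (Set.range g) →
      Submodule.span ℤ (Set.range g) < M' := by
    intro ι g M' y hg hy hzM hyz
    have hle : Submodule.span ℤ (Set.range g) ≤ M' :=
      Submodule.span_le.mpr (by rintro _ ⟨i, rfl⟩; exact hg i)
    refine lt_of_le_of_ne hle fun heq => hzM ?_
    have := Submodule.sub_mem _ hy (hle hyz)
    rwa [sub_sub_cancel, ← heq] at this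
  have hnot : ∀ {ι : Type} {g : ι → L}, (∃ y ∈ Submodule.span ℤ (Set.range g), B z y ≠ 0) →
      ∃ i, B z (g i) ≠ 0 := by
    rintro ι g ⟨y, hy, hzy⟩
    by_contra! hcon
    exact hzy (form_eq_zero_of_mem_span (by rintro _ ⟨i, rfl⟩; exact hcon i) y hy)
  cases hM with
  | path n a hn h ha =>
    obtain ⟨M', y, hM', hy, hyz, haM⟩ := h.exists_extension (by omega) hR hp hsymm hpos ha hz hzM
      (hnot hzg)
    exact ⟨M', hM', key (fun i => haM i i.is_lt) hy hzM hyz⟩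
  | fork n k a x hnk h ha hx =>
    obtain ⟨M', y, hM', hy, hyz, hxM, haM⟩ := h.exists_extension hnk hR hp hsymm hpos ha hx hz hzM
      (hnot hzg)
    refine ⟨M', hM', key (fun i => ?_) hy hzM hyz⟩
    cases i with
    | none => exact hxM
    | some i => exact haM i i.is_lt

/-- The generators of the sublattice, none of which is isolated in the Dynkin diagram. -/
theorem exists_generators (hM : IsSimplyLacedSpan B p R M) (hsymm : B.IsSymm) :
    ∃ G ⊆ R, G.Nonempty ∧ Submodule.span ℤ G = M ∧ ∀ g ∈ G, ∃ g' ∈ G, B g g' = -p := by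
  have hpath : ∀ {n : ℕ} {a : ℕ → L}, 2 ≤ n → IsRootPath B p n a → ∀ i < n, ∃ j < n,
      B (a i) (a j) = -p := by
    intro n a hn h i hi
    cases i with
    | zero => exact ⟨1, by omega, h.succ_eq 0 (by omega)⟩
    | succ i => exact ⟨i, by omega, (hsymm.eq _ _).trans (h.succ_eq i hi)⟩
  cases hM with
  | path n a hn h ha =>
    have : Nonempty (Fin n) := ⟨⟨0, by omega⟩⟩
    refine ⟨_, ?_, Set.range_nonempty _, rfl, ?_⟩
    · rintro _ ⟨i, rfl⟩
      exact ha i i.is_lt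
    · rintro _ ⟨i, rfl⟩
      obtain ⟨j, hj, hij⟩ := hpath hn h i i.is_lt
      exact ⟨_, ⟨⟨j, hj⟩, rfl⟩, hij⟩
  | fork n k a x hnk h ha hx =>
    refine ⟨_, ?_, Set.range_nonempty _, rfl, ?_⟩
    · rintro _ ⟨_ | i, rfl⟩
      · exact hx
      · exact ha i i.is_lt
    · rintro _ ⟨_ | i, rfl⟩
      · exact ⟨_, ⟨some ⟨k, by omega⟩, rfl⟩, h.eq_neg⟩
      · obtain ⟨j, hj, hij⟩ := hpath (by omega) h.path i i.is_lt
        exact ⟨_, ⟨some ⟨j, hj⟩, rfl⟩, hij⟩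

end IsSimplyLacedSpan

end SimplyLacedSpans

/-! ### Recognizing the root lattices -/

section ScaledRootLattices

variable {L : Type*} [AddCommGroup L] {B : LinearMap.BilinForm ℤ L}

theorem isScaledRootLattice_of_gram {p : ℕ} {t : DynkinType} {a : Fin t.rank → L}
    (hli : LinearIndependent ℤ a) (ha : ∀ k l, B (a k) (a l) = (p : ℤ) * t.cartan k l) :
    IsScaledRootLattice B (Submodule.span ℤ (Set.range a)) p 1 t := by
  refine isScaledRootLattice_of_family (fun i => a i.2)
    (hli.comp _ fun i j h => Prod.ext (Subsingleton.elim _ _) h) ?_ fun i j k l => ?_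
  · rw [show (fun i : Fin 1 × Fin t.rank => a i.2) = a ∘ Prod.snd from rfl,
      Prod.snd_surjective.range_comp]
  · rw [if_pos (Subsingleton.elim i j)]
    exact ha k l

variable {p : ℤ} {n k : ℕ} {a : ℕ → L} {x : L}

theorem IsRootPath.gram (h : IsRootPath B p n a) (hsymm : B.IsSymm) (i j : Fin n) :
    B (a i) (a j) = p * CartanMatrix.A n i j := by
  rw [h.form_apply hsymm i.is_lt j.is_lt]
  congr 1
  simp only [CartanMatrix.A, Matrix.of_apply, Fin.ext_iff]
  split_ifs <;> omega

namespace IsRootFork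

/-- The Cartan matrix of a fork. -/
def cartan (n k : ℕ) : Option (Fin n) → Option (Fin n) → ℤ
  | none, none => 2
  | none, some j => if (j : ℕ) = k then -1 else 0
  | some i, none => if (i : ℕ) = k then -1 else 0
  | some i, some j => CartanMatrix.A n i j

theorem gram (h : IsRootFork B p n k a x) (hsymm : B.IsSymm) (i j : Option (Fin n)) :
    B (family n a x i) (family n a x j) = p * cartan n k i j := by
  have hx : ∀ j : Fin n, B x (a j) = p * if (j : ℕ) = k then -1 else 0 := fun j => by
    rw [h.form_apply j.is_lt]
    split_ifs <;> ring
  rcases i with _ | i <;> rcases j with _ | j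
  · exact h.norm_eq.trans (mul_comm _ _)
  · exact hx j
  · exact (hsymm.eq _ _).trans (hx i)
  · exact h.path.gram hsymm i j

/-- A fork whose Cartan matrix is, in some order, the one of type `t`. -/
theorem isScaledRootLattice {p : ℕ} (h : IsRootFork B p n k a x) (hp : 0 < p) (hsymm : B.IsSymm)
    (hk : k < n) (hdet : ((k : ℤ) + 1) * (n - k) ≠ 2 * (n + 1)) {t : DynkinType}
    (e : Fin t.rank ≃ Option (Fin n)) (he : ∀ i j, cartan n k (e i) (e j) = t.cartan i j) :
    IsScaledRootLattice B (Submodule.span ℤ (Set.range (family n a x))) p 1 t := by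
  have hp' : (0 : ℤ) < p := by exact_mod_cast hp
  rw [← e.surjective.range_comp]
  refine isScaledRootLattice_of_gram ((h.linearIndependent hp' hsymm hk hdet).comp _ e.injective)
    fun i j => ?_
  rw [Function.comp_apply, Function.comp_apply, h.gram hsymm, he]

/-- The order of the simple roots of `Dₙ₊₁` that starts at the end of the path. -/
def equivD (n : ℕ) : Fin (n + 1) ≃ Option (Fin n) :=
  finSuccEquivLast.trans (Equiv.optionCongr Fin.revPerm)

theorem cartan_equivD {n : ℕ} (hn : 3 ≤ n) (i j : Fin (n + 1)) :
    cartan n 1 (equivD n i) (equivD n j) = CartanMatrix.D (n + 1) i j := by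
  induction i using Fin.lastCases with
  | last =>
    induction j using Fin.lastCases with
    | last => simp [equivD, cartan, CartanMatrix.D]
    | cast j =>
      simp only [equivD, cartan, CartanMatrix.D, Equiv.trans_apply, finSuccEquivLast_last,
        finSuccEquivLast_castSucc, Equiv.optionCongr_apply, Option.map_none, Option.map_some,
        Fin.revPerm_apply, Matrix.of_apply, Fin.val_rev, Fin.ext_iff, Fin.val_last,
        Fin.val_castSucc, or_true, and_true]
      have := j.is_lt
      split_ifs <;> omega
  | cast i =>
    induction j using Fin.lastCases with
    | last =>
      simp only [equivD, cartan, CartanMatrix.D, Equiv.trans_apply, finSuccEquivLast_last,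
        finSuccEquivLast_castSucc, Equiv.optionCongr_apply, Option.map_none, Option.map_some,
        Fin.revPerm_apply, Matrix.of_apply, Fin.val_rev, Fin.ext_iff, Fin.val_last,
        Fin.val_castSucc, or_true, and_true]
      have := i.is_lt
      split_ifs <;> omega
    | cast j =>
      simp only [equivD, cartan, CartanMatrix.D, CartanMatrix.A, Equiv.trans_apply,
        finSuccEquivLast_castSucc, Equiv.optionCongr_apply, Option.map_some,
        Fin.revPerm_apply, Matrix.of_apply, Fin.val_rev, Fin.ext_iff, Fin.val_castSucc]
      have := i.is_lt
      split_ifs <;> omega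

/-- Bourbaki's order of the simple roots of `E₆`. -/
noncomputable def equivE₆ : Fin 6 ≃ Option (Fin 5) :=
  Equiv.ofBijective ![some 0, none, some 1, some 2, some 3, some 4] (by decide)

/-- Bourbaki's order of the simple roots of `E₇`. -/
noncomputable def equivE₇ : Fin 7 ≃ Option (Fin 6) :=
  Equiv.ofBijective ![some 0, none, some 1, some 2, some 3, some 4, some 5] (by decide)

/-- Bourbaki's order of the simple roots of `E₈`. -/
noncomputable def equivE₈ : Fin 8 ≃ Option (Fin 7) :=
  Equiv.ofBijective ![some 0, none, some 1, some 2, some 3, some 4, some 5, some 6] (by decide)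

theorem cartan_equivE₆ : ∀ i j : Fin 6,
    cartan 5 2 (equivE₆ i) (equivE₆ j) = CartanMatrix.E₆ i j := by
  intro i j
  fin_cases i <;> fin_cases j <;> rfl

theorem cartan_equivE₇ : ∀ i j : Fin 7,
    cartan 6 2 (equivE₇ i) (equivE₇ j) = CartanMatrix.E₇ i j := by
  intro i j
  fin_cases i <;> fin_cases j <;> rfl

theorem cartan_equivE₈ : ∀ i j : Fin 8,
    cartan 7 2 (equivE₈ i) (equivE₈ j) = CartanMatrix.E₈ i j := by
  intro i j
  fin_cases i <;> fin_cases j <;> rfl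

end IsRootFork

/-- The spans of paths and forks are the rescaled root lattices of type `A`, `D` and `E`. -/
theorem IsSimplyLacedSpan.exists_type {p : ℕ} {R : Set L} {M : Submodule ℤ L}
    (hM : IsSimplyLacedSpan B p R M) (hp : 0 < p) (hsymm : B.IsSymm) :
    ∃ K X, IsScaledRootLattice B M p 1 K ∧ ScreenerType K 1 X := by
  have hp' : (0 : ℤ) < p := by exact_mod_cast hp
  cases hM with
  | path n a hn h ha =>
    have hA : IsScaledRootLattice B (Submodule.span ℤ (Set.range fun i : Fin n => a i)) p 1 (.A n) :=
      isScaledRootLattice_of_gram (t := .A n) (a := fun i : Fin n => a i)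
        (h.linearIndependent hp' hsymm) (h.gram hsymm)
    obtain rfl | rfl | hn : n = 2 ∨ n = 3 ∨ 3 < n := by omega
    · exact ⟨_, _, hA, .A_two⟩
    · exact ⟨_, _, hA, .A_three⟩
    · exact ⟨_, _, hA, .A n hn⟩
  | fork n k a x hnk h ha hx =>
    rcases hnk with ⟨rfl, hn⟩ | ⟨rfl, hn5, hn7⟩
    · have hD := h.isScaledRootLattice hp hsymm (by omega) (by push_cast; omega)
        (t := .D (n + 1)) (IsRootFork.equivD n) (IsRootFork.cartan_equivD hn)
      obtain rfl | hn : n = 3 ∨ 4 < n + 1 := by omega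
      · exact ⟨_, _, hD, .D_four⟩
      · exact ⟨_, _, hD, .D _ hn⟩
    · obtain rfl | rfl | rfl : n = 5 ∨ n = 6 ∨ n = 7 := by omega
      · exact ⟨_, _, h.isScaledRootLattice hp hsymm (by omega) (by norm_num) (t := .E₆)
          IsRootFork.equivE₆ IsRootFork.cartan_equivE₆, .E_six⟩
      · exact ⟨_, _, h.isScaledRootLattice hp hsymm (by omega) (by norm_num) (t := .E₇)
          IsRootFork.equivE₇ IsRootFork.cartan_equivE₇, .E_seven⟩
      · exact ⟨_, _, h.isScaledRootLattice hp hsymm (by omega) (by norm_num) (t := .E₈)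
          IsRootFork.equivE₈ IsRootFork.cartan_equivE₈, .E_eight⟩

end ScaledRootLattices

/-! ### Decomposition of a lattice generated by screeners -/

section Components

variable {L : Type*} [AddCommGroup L] {B : LinearMap.BilinForm ℤ L}

/-- The sublattice is isometric to one of the lattices `√p K`, or to several copies of `√p A₁`. -/
def IsListedLattice (B : LinearMap.BilinForm ℤ L) (N : Submodule ℤ L) : Prop :=
  ∃ (p m : ℕ) (K X : DynkinType), 0 < p ∧ IsScaledRootLattice B N p m K ∧ ScreenerType K m X

/-- Each element of `Φ` belongs to `N` or is orthogonal to `N`. -/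
def Separates (B : LinearMap.BilinForm ℤ L) (Φ : Set L) (N : Submodule ℤ L) : Prop :=
  ∀ x ∈ Φ, x ∈ N ∨ ∀ y ∈ N, B x y = 0

/-- A set of screeners that, like the set of all screeners orthogonal to a sublattice, is stable
under its own reflections. -/
structure IsReflectionStable (B : LinearMap.BilinForm ℤ L) (Φ : Set L) : Prop where
  subset : Φ ⊆ screeners B
  reflect : ∀ x ∈ Φ, ∀ y ∈ Φ, ∀ m : ℤ, 2 * B x y = m * B x x → y - m • x ∈ Φ

theorem linearIndependent_of_orthogonal {m : ℕ} {f : Fin m → L} (h0 : ∀ i, B (f i) (f i) ≠ 0)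
    (h : ∀ i j, i ≠ j → B (f i) (f j) = 0) : LinearIndependent ℤ f := by
  rw [Fintype.linearIndependent_iff]
  intro c hc i
  have h1 := congrArg (B (f i)) hc
  simp only [map_sum, map_smul, smul_eq_mul, map_zero] at h1
  rw [Finset.sum_eq_single i (fun j _ hj => by rw [h i j hj.symm, mul_zero]) (by simp)] at h1
  exact (mul_eq_zero.mp h1).resolve_right (h0 i)

/-- Orthogonal vectors of norm `2p` generate copies of `√p A₁`. -/
theorem isListedLattice_of_orthogonal {p m : ℕ} (hp : 0 < p) (hm : 0 < m) {f : Fin m → L}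
    (h0 : ∀ i, B (f i) (f i) = 2 * p) (h : ∀ i j, i ≠ j → B (f i) (f j) = 0) :
    IsListedLattice B (Submodule.span ℤ (Set.range f)) := by
  have hA : IsScaledRootLattice B (Submodule.span ℤ (Set.range f)) p m (.A 1) := by
    refine isScaledRootLattice_of_family (t := .A 1) (fun i => f i.1)
      ((linearIndependent_of_orthogonal (fun i => by rw [h0]; omega) h).comp _ fun i j hij =>
        Prod.ext hij (Subsingleton.elim (α := Fin 1) _ _)) ?_ fun i j k l => ?_
    · have : Function.Surjective (Prod.fst : Fin m × Fin 1 → Fin m) := Prod.fst_surjective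
      rw [← this.range_comp]
      rfl
    · have hkl : (DynkinType.A 1).cartan k l = 2 := by
        obtain rfl : k = l := Subsingleton.elim (α := Fin 1) _ _
        exact DynkinType.cartan_diag _ _
      split_ifs with hij
      · rw [hij, h0, hkl, mul_comm]
      · exact h i j hij
  obtain rfl | hm : m = 1 ∨ 2 ≤ m := by omega
  · exact ⟨p, 1, _, _, hp, hA, .A_one⟩
  · exact ⟨p, m, _, _, hp, hA, .A_one_copies m hm⟩

namespace IsReflectionStable

variable {Φ : Set L}

/-- The elements of norm `2p` of a reflection stable set of screeners. -/
theorem isRootLike (hΦ : IsReflectionStable B Φ) (hpos : ∀ x : L, x ≠ 0 → 0 < B x x)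
    (hsymm : B.IsSymm) (heven : ∀ x : L, Even (B x x)) (p : ℤ) :
    IsRootLike B p {x | x ∈ Φ ∧ B x x = 2 * p} := by
  refine ⟨fun x hx => hx.2, fun x hx y hy => ?_, fun x hx y hy hxy => ?_⟩
  · have := ((mem_screeners_iff hpos hsymm heven).mp (hΦ.subset hx.1)).2 y
    rw [hx.2] at this
    exact (mul_dvd_mul_iff_left two_ne_zero).mp this
  · have h1 : 2 * B x y = 1 * B x x := by rw [hxy, hx.2, one_mul]
    have h2 := hΦ.reflect x hx.1 y hy.1 1 h1
    have h3 := form_reflect hsymm h1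
    rw [one_smul] at h2 h3
    exact ⟨h2, h3.trans hy.2⟩

/-- If `z` has the minimal norm, and `y` a bigger one, the reflection in `y` takes `z` to
`z ± y`. -/
theorem two_mul_form_eq [Module.Free ℤ L] (hΦ : IsReflectionStable B Φ)
    (hpos : ∀ x : L, x ≠ 0 → 0 < B x x)
    (hsymm : B.IsSymm) (heven : ∀ x : L, Even (B x x)) {y z : L} (hy : y ∈ Φ)
    (hlt : B z z < B y y) (hyz : B y z ≠ 0) :
    ∃ ε : ℤ, (ε = 1 ∨ ε = -1) ∧ 2 * B y z = ε * B y y := by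
  obtain ⟨ε, hε⟩ := ((mem_screeners_iff hpos hsymm heven).mp (hΦ.subset hy)).2 z
  have hq : 0 < B y y := (form_self_nonneg hpos z).trans_lt hlt
  have hcs : B y z ^ 2 ≤ B y y * B z z := by
    by_cases h : B y y • z = B y z • y
    · have h1 := congrArg (B z) h
      simp only [map_smul, smul_eq_mul, show B z y = B y z from hsymm.eq _ _] at h1
      rw [h1, sq]
    · exact (form_sq_lt_of_smul_ne hsymm hpos h).le
  have h1 : ε ^ 2 < 4 := by
    have h2 : B y y ^ 2 * ε ^ 2 < B y y ^ 2 * 4 := by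
      calc B y y ^ 2 * ε ^ 2 = 4 * B y z ^ 2 := by linear_combination -(2 * B y z + B y y * ε) * hε
        _ ≤ 4 * (B y y * B z z) := by omega
        _ < B y y ^ 2 * 4 := by nlinarith
    exact lt_of_mul_lt_mul_left h2 (by positivity)
  have h2 : -2 < ε := by nlinarith
  have h3 : ε < 2 := by nlinarith
  refine ⟨ε, ?_, by rw [hε, mul_comm]⟩
  have h4 : ε ≠ 0 := by
    rintro rfl
    omega
  omega

/-- If the sublattice `M`, generated by elements of minimal norm, separates the elements of minimal
norm, it separates all elements of `Φ`. -/
theorem separates [Module.Free ℤ L] (hΦ : IsReflectionStable B Φ)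
    (hpos : ∀ x : L, x ≠ 0 → 0 < B x x)
    (hsymm : B.IsSymm) (heven : ∀ x : L, Even (B x x)) {p : ℤ} (hp : 0 < p)
    (hmin : ∀ x ∈ Φ, 2 * p ≤ B x x) {G : Set L} (hG : G ⊆ {x | x ∈ Φ ∧ B x x = 2 * p})
    (h : Separates B {x | x ∈ Φ ∧ B x x = 2 * p} (Submodule.span ℤ G))
    (h' : (∀ x ∈ Φ, B x x = 2 * p → x ∈ Submodule.span ℤ G) ∨
      ∀ g ∈ G, ∃ g' ∈ G, B g g' = -p) :
    Separates B Φ (Submodule.span ℤ G) := by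
  intro y hy
  by_cases hyp : B y y = 2 * p
  · exact h y ⟨hy, hyp⟩
  have hlt : 2 * p < B y y := lt_of_le_of_ne (hmin y hy) (Ne.symm hyp)
  by_cases hyG : ∀ g ∈ G, B y g = 0
  · exact Or.inr (form_eq_zero_of_mem_span hyG)
  left
  push Not at hyG
  obtain ⟨g, hg, hyg⟩ := hyG
  obtain ⟨hgΦ, hgp⟩ := hG hg
  have hgM : g ∈ Submodule.span ℤ G := Submodule.subset_span hg
  obtain ⟨ε, hε, hε2⟩ := hΦ.two_mul_form_eq hpos hsymm heven hy (by omega) hyg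
  have hz := hΦ.reflect y hy g hgΦ ε hε2
  have hzp : B (g - ε • y) (g - ε • y) = 2 * p := (form_reflect hsymm hε2).trans hgp
  have hmem : g - ε • y ∈ Submodule.span ℤ G → y ∈ Submodule.span ℤ G := by
    intro hzM
    have h1 : ε • y ∈ Submodule.span ℤ G := by
      have := Submodule.sub_mem _ hgM hzM
      rwa [sub_sub_cancel] at this
    rcases hε with rfl | rfl
    · rwa [one_smul] at h1
    · rwa [neg_smul, one_smul, Submodule.neg_mem_iff] at h1
  rcases h _ ⟨hz, hzp⟩ with hzM | hzM
  · exact hmem hzM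
  · rcases h' with h' | h'
    · exact hmem (h' _ hz hzp)
    -- otherwise `y` has norm `4p`, and its inner products with `M`, up to sign those of `g`, are
    -- divisible by `2p`
    exfalso
    have h1 := hzM g hgM
    simp only [map_sub, LinearMap.sub_apply, map_smul, LinearMap.smul_apply, smul_eq_mul,
      hgp] at h1
    have hεε : ε * ε = 1 := by rcases hε with rfl | rfl <;> norm_num
    have h2 : B y y = 4 * p := by linear_combination -2 * h1 - ε * hε2 - B y y * hεε
    obtain ⟨g', hg', hgg'⟩ := h' g hg
    have h3 := hzM g' (Submodule.subset_span hg')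
    simp only [map_sub, LinearMap.sub_apply, map_smul, LinearMap.smul_apply, smul_eq_mul,
      hgg'] at h3
    obtain ⟨t, ht⟩ := ((mem_screeners_iff hpos hsymm heven).mp (hΦ.subset hy)).2 g'
    rw [h2] at ht
    have ht' : B y g' = 2 * (p * t) := by linarith
    have h4 : p * (2 * (ε * t) + 1) = 0 := by linear_combination -h3 - ε * ht'
    have h5 := (mul_eq_zero.mp h4).resolve_left hp.ne'
    omega

/-- If the elements of norm `2p` are orthogonal or proportional, they span copies of `√p A₁`. -/
theorem exists_orthogonal_generators [Module.Finite ℤ L] [Module.Free ℤ L] {R : Set L} {p : ℕ}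
    (hp : 0 < p) (hnorm : ∀ x ∈ R, B x x = 2 * p) (hsymm : B.IsSymm) (hne : R.Nonempty)
    (horth : ∀ x ∈ R, ∀ y ∈ R, B x y ≠ 0 → y = x ∨ y = -x) :
    ∃ G ⊆ R, IsListedLattice B (Submodule.span ℤ G) ∧ ∀ x ∈ R, x ∈ Submodule.span ℤ G := by
  classical
  let P : ℕ → Prop := fun m => ∃ f : Fin m → L, (∀ i, f i ∈ R) ∧ ∀ i j, i ≠ j → B (f i) (f j) = 0
  have hbound : ∀ m, P m → m ≤ Module.finrank ℤ L := by
    rintro m ⟨f, hf, hf'⟩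
    have := (linearIndependent_of_orthogonal (fun i => by rw [hnorm _ (hf i)]; omega)
      hf').fintype_card_le_finrank
    rwa [Fintype.card_fin] at this
  obtain ⟨x₀, hx₀⟩ := hne
  have h1 : P 1 := ⟨fun _ => x₀, fun _ => hx₀, fun i j hij => absurd (Subsingleton.elim i j) hij⟩
  have hP := Nat.findGreatest_spec (hbound 1 h1) h1
  have hm1 := Nat.le_findGreatest (hbound 1 h1) h1
  have hmax : ¬ P (Nat.findGreatest P (Module.finrank ℤ L) + 1) := fun h => by
    have := Nat.le_findGreatest (hbound _ h) h
    omega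
  generalize Nat.findGreatest P (Module.finrank ℤ L) = m at hP hm1 hmax
  obtain ⟨f, hf, hf'⟩ := hP
  refine ⟨Set.range f, by rintro _ ⟨i, rfl⟩; exact hf i,
    isListedLattice_of_orthogonal hp (by omega) (fun i => hnorm _ (hf i)) hf', fun x hx => ?_⟩
  by_contra hxM
  have hx0 : ∀ i, B (f i) x = 0 := by
    intro i
    by_contra h
    rcases horth _ (hf i) _ hx h with rfl | rfl
    · exact hxM (Submodule.subset_span ⟨i, rfl⟩)
    · exact hxM (Submodule.neg_mem _ (Submodule.subset_span ⟨i, rfl⟩))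
  refine hmax ⟨Fin.snoc f x, fun i => ?_, fun i j hij => ?_⟩
  · induction i using Fin.lastCases with
    | last => rw [Fin.snoc_last]; exact hx
    | cast i => rw [Fin.snoc_castSucc]; exact hf i
  · induction i using Fin.lastCases with
    | last =>
      induction j using Fin.lastCases with
      | last => exact absurd rfl hij
      | cast j =>
        rw [Fin.snoc_last, Fin.snoc_castSucc]
        exact (hsymm.eq _ _).trans (hx0 j)
    | cast i =>
      induction j using Fin.lastCases with
      | last => rw [Fin.snoc_last, Fin.snoc_castSucc]; exact hx0 i
      | cast j =>
        rw [Fin.snoc_castSucc, Fin.snoc_castSucc]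
        exact hf' i j fun h => hij (by rw [h])

/-- A reflection stable set of screeners has elements that generate one of the lattices of the list
and separate it. -/
theorem exists_component [Module.Finite ℤ L] [Module.Free ℤ L] (hΦ : IsReflectionStable B Φ)
    (hpos : ∀ x : L, x ≠ 0 → 0 < B x x) (hsymm : B.IsSymm) (heven : ∀ x : L, Even (B x x))
    (hne : Φ.Nonempty) :
    ∃ G ⊆ Φ, (∃ x ∈ G, x ≠ 0) ∧ IsListedLattice B (Submodule.span ℤ G) ∧
      Separates B Φ (Submodule.span ℤ G) := by
  have hne0 : ∀ x ∈ Φ, x ≠ 0 := by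
    rintro x hx rfl
    exact ((mem_screeners_iff hpos hsymm heven).mp (hΦ.subset hx)).1 0 (by simp)
  obtain ⟨p, hp, hmin, x₀, hx₀⟩ : ∃ p : ℕ, 0 < p ∧ (∀ x ∈ Φ, 2 * (p : ℤ) ≤ B x x) ∧
      ∃ x ∈ Φ, B x x = 2 * (p : ℤ) := by
    obtain ⟨x₀, h1, h2⟩ : ∃ x₀ ∈ Φ, ∀ x ∈ Φ, (B x₀ x₀).toNat ≤ (B x x).toNat :=
      ⟨_, Function.argminOn_mem (fun x => (B x x).toNat) Φ hne,
        fun x hx => Function.argminOn_le (fun x => (B x x).toNat) Φ hx⟩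
    have h3 := hpos x₀ (hne0 x₀ h1)
    obtain ⟨q, hq⟩ := heven x₀
    refine ⟨q.toNat, by omega, fun x hx => ?_, x₀, h1, by omega⟩
    have := h2 x hx
    omega
  have hp' : (0 : ℤ) < p := by exact_mod_cast hp
  set R : Set L := {x | x ∈ Φ ∧ B x x = 2 * (p : ℤ)} with hRdef
  have hR := hΦ.isRootLike hpos hsymm heven p
  have hRne : ∀ x ∈ R, x ≠ 0 := fun x hx => hne0 x hx.1
  by_cases horth : ∀ x ∈ R, ∀ y ∈ R, B x y ≠ 0 → y = x ∨ y = -x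
  · obtain ⟨G, hG, hlist, hRG⟩ := exists_orthogonal_generators hp hR.norm_eq hsymm ⟨x₀, hx₀⟩ horth
    refine ⟨G, fun x hx => (hG hx).1, ?_, hlist, hΦ.separates hpos hsymm heven hp' hmin hG
      (fun x hx => Or.inl (hRG x hx)) (Or.inl fun x hx hxp => hRG x ⟨hx, hxp⟩)⟩
    obtain ⟨g, hg⟩ : G.Nonempty := by
      by_contra! h
      have := hRG x₀ hx₀
      rw [h, Submodule.span_empty, Submodule.mem_bot] at this
      exact hne0 x₀ hx₀.1 this
    exact ⟨g, hg, hRne g (hG hg)⟩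
  · push Not at horth
    obtain ⟨x, hx, y, hy, hxy, h1, h2⟩ := horth
    -- two roots of inner product `-p`, to start from
    obtain ⟨y', hy', hxy'⟩ : ∃ y' ∈ R, B x y' = -p := by
      rcases hR.form_cases hsymm hpos hx hy h1 h2 with h | h | h
      · exact ⟨y, hy, h⟩
      · exact absurd h hxy
      · exact ⟨y - x, hR.sub_mem x hx y hy h, by rw [map_sub, h, hR.norm_eq x hx]; ring⟩
    have hstart : ∃ M, IsSimplyLacedSpan B p R M := by
      refine ⟨_, .path 2 (fun i => if i = 0 then x else y') le_rfl
        ⟨fun i hi => ?_, fun i hi => ?_, fun i j hij hj => by omega⟩ fun i hi => ?_⟩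
      · split_ifs
        · exact hR.norm_eq x hx
        · exact hR.norm_eq y' hy'
      · obtain rfl : i = 0 := by omega
        simpa using hxy'
      · split_ifs
        · exact hx
        · exact hy'
    obtain ⟨M, hM, hmax⟩ := (wellFounded_gt (α := Submodule ℤ L)).has_min
      {M | IsSimplyLacedSpan B p R M} hstart
    obtain ⟨G, hG, hGne, hGM, hnbr⟩ := hM.exists_generators hsymm
    obtain ⟨K, X, hK, hKX⟩ := hM.exists_type hp hsymm
    subst hGM
    refine ⟨G, fun x hx => (hG hx).1, ?_, ⟨p, 1, K, X, hp, hK, hKX⟩,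
      hΦ.separates hpos hsymm heven hp' hmin hG (fun z hz => ?_) (Or.inr hnbr)⟩
    · obtain ⟨g, hg⟩ := hGne
      exact ⟨g, hg, hRne g (hG hg)⟩
    · by_contra! hcon
      obtain ⟨M', hM', hlt⟩ := hM.exists_extension hR hp' hsymm hpos hz hcon.1 hcon.2
      exact hmax M' hM' hlt

end IsReflectionStable

/-- A sublattice separating generators of `L` is an orthogonal direct summand. -/
theorem Separates.isScreenerSummand {Φ : Set L} {M : Submodule ℤ L} (h : Separates B Φ M)
    (hΦ : Submodule.span ℤ Φ = ⊤) (hpos : ∀ x : L, x ≠ 0 → 0 < B x x) (hsymm : B.IsSymm)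
    (heven : ∀ x : L, Even (B x x)) : IsScreenerSummand B M := by
  have hsplit : ∀ α : L, ∃ m ∈ M, ∀ y ∈ M, B (α - m) y = 0 := by
    intro α
    have hα : α ∈ Submodule.span ℤ Φ := hΦ ▸ Submodule.mem_top
    induction hα using Submodule.span_induction with
    | mem x hx =>
      rcases h x hx with h | h
      · exact ⟨x, h, fun y _ => by simp⟩
      · exact ⟨0, M.zero_mem, by simpa using h⟩
    | zero => exact ⟨0, M.zero_mem, by simp⟩
    | add u v _ _ hu hv =>
      obtain ⟨m, hm, hm'⟩ := hu
      obtain ⟨n, hn, hn'⟩ := hv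
      refine ⟨m + n, M.add_mem hm hn, fun y hy => ?_⟩
      rw [add_sub_add_comm, map_add, LinearMap.add_apply, hm' y hy, hn' y hy, add_zero]
    | smul c u _ hu =>
      obtain ⟨m, hm, hm'⟩ := hu
      refine ⟨c • m, M.smul_mem c hm, fun y hy => ?_⟩
      rw [← smul_sub, map_smul, LinearMap.smul_apply, hm' y hy, smul_zero]
  intro x hx
  rw [mem_screeners_iff hpos hsymm heven]
  refine ⟨fun hs => ⟨fun γ _ => hs.1 γ, fun α _ => hs.2 α⟩, fun hs => ⟨fun γ hγ => ?_, fun α => ?_⟩⟩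
  · obtain ⟨m, hm, hm'⟩ := hsplit γ
    have h1 : 2 • (γ - m) ∈ M := by
      rw [smul_sub, ← hγ]
      exact M.sub_mem hx (nsmul_mem hm 2)
    have h2 := hm' _ h1
    rw [map_nsmul, smul_eq_zero] at h2
    have h3 := sub_eq_zero.mp
      (eq_zero_of_form_self_nonpos hpos (h2.resolve_left (by norm_num)).le)
    exact hs.1 m hm (h3 ▸ hγ)
  · obtain ⟨m, hm, hm'⟩ := hsplit α
    have h1 := hs.2 m hm
    have h2 : B x α = B x m := by
      have := hm' x hx
      rw [show B (α - m) x = B x (α - m) from hsymm.eq _ _, map_sub] at this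
      omega
    rwa [h2]

/-- Any orthogonal system of separating sublattices of the list can be completed until it contains
all screeners. -/
theorem exists_components [Module.Finite ℤ L] [Module.Free ℤ L]
    (hpos : ∀ x : L, x ≠ 0 → 0 < B x x) (hsymm : B.IsSymm) (heven : ∀ x : L, Even (B x x))
    (F : Finset (Submodule ℤ L))
    (hF : ∀ N ∈ F, IsListedLattice B N ∧ Separates B (screeners B) N)
    (horth : ∀ N ∈ F, ∀ N' ∈ F, N ≠ N' → ∀ x ∈ N, ∀ y ∈ N', B x y = 0) :
    ∃ F' : Finset (Submodule ℤ L),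
      (∀ N ∈ F', IsListedLattice B N ∧ Separates B (screeners B) N) ∧
      (∀ N ∈ F', ∀ N' ∈ F', N ≠ N' → ∀ x ∈ N, ∀ y ∈ N', B x y = 0) ∧
      ∀ x ∈ screeners B, ∃ N ∈ F', x ∈ N := by
  classical
  induction hS : F.sup id using (wellFounded_gt (α := Submodule ℤ L)).induction generalizing F with
  | _ S ih =>
  subst hS
  by_cases hall : ∀ x ∈ screeners B, ∃ N ∈ F, x ∈ N
  · exact ⟨F, hF, horth, hall⟩
  push Not at hall
  obtain ⟨x, hx, hxF⟩ := hall
  let Φ : Set L := {x | x ∈ screeners B ∧ ∀ N ∈ F, ∀ y ∈ N, B x y = 0}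
  have hΦ : IsReflectionStable B Φ := by
    refine ⟨fun x hx => hx.1, fun x hx y hy m h => ⟨reflect_mem_screeners hpos hsymm heven hx.1
      hy.1 h, fun N hN z hz => ?_⟩⟩
    rw [map_sub, map_smul, LinearMap.sub_apply, LinearMap.smul_apply, hx.2 N hN z hz,
      hy.2 N hN z hz, smul_zero, sub_zero]
  obtain ⟨G, hG, ⟨g, hg, hg0⟩, hlist, hsep⟩ := hΦ.exists_component hpos hsymm heven
    ⟨x, hx, fun N hN => ((hF N hN).2 x hx).resolve_left (hxF N hN)⟩
  have hGF : ∀ N ∈ F, ∀ y ∈ N, ∀ z ∈ Submodule.span ℤ G, B y z = 0 := by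
    intro N hN y hy
    refine form_eq_zero_of_mem_span fun z hz => ?_
    exact (hsymm.eq _ _).trans ((hG hz).2 N hN y hy)
  have hGF' : ∀ N ∈ F, ∀ z ∈ Submodule.span ℤ G, ∀ y ∈ N, B z y = 0 :=
    fun N hN z hz y hy => (hsymm.eq _ _).trans (hGF N hN y hy z hz)
  have hsep' : Separates B (screeners B) (Submodule.span ℤ G) := by
    intro y hy
    by_cases hyF : ∃ N ∈ F, y ∈ N
    · obtain ⟨N, hN, hyN⟩ := hyF
      exact Or.inr (hGF N hN y hyN)
    · push Not at hyF
      exact hsep y ⟨hy, fun N hN => ((hF N hN).2 y hy).resolve_left (hyF N hN)⟩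
  refine ih _ ?_ (insert (Submodule.span ℤ G) F) ?_ ?_ rfl
  · refine lt_of_le_of_ne (Finset.sup_mono (Finset.subset_insert _ _)) fun heq => hg0 ?_
    have h1 : g ∈ F.sup id := by
      rw [heq, Finset.sup_insert]
      exact Submodule.mem_sup_left (Submodule.subset_span hg)
    have h2 : F.sup id ≤ LinearMap.ker (B g) := Finset.sup_le fun N hN y hy =>
      hGF' N hN g (Submodule.subset_span hg) y hy
    exact eq_zero_of_form_self_nonpos hpos (le_of_eq (h2 h1))
  · intro N hN
    rcases Finset.mem_insert.mp hN with rfl | hN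
    · exact ⟨hlist, hsep'⟩
    · exact hF N hN
  · intro N hN N' hN' hne
    rcases Finset.mem_insert.mp hN with rfl | hN <;> rcases Finset.mem_insert.mp hN' with rfl | hN'
    · exact absurd rfl hne
    · exact hGF' N' hN'
    · exact hGF N hN
    · exact horth N hN N' hN' hne

end Components

/-! ### The screeners of a lattice generated by a screening system -/

theorem theorem5p16 {L : Type*} [AddCommGroup L] [Module.Finite ℤ L] [Module.Free ℤ L]
    (B : LinearMap.BilinForm ℤ L) (hsymm : B.IsSymm) (hpos : ∀ x : L, x ≠ 0 → 0 < B x x)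
    (heven : ∀ x : L, Even (B x x)) :
    -- If `L` is generated by a screening system, then `L` is an orthogonal direct sum of rescaled
    -- simply laced root lattices (the `A₁`'s of equal scale being collected into one summand), and
    -- its screeners form the orthogonal union of root systems from the list, one for each summand.
    ((∃ S : Set L, IsScreeningSystem B S ∧ Submodule.span ℤ S = ⊤) →
      ∃ (s : ℕ) (N : Fin s → Submodule ℤ L) (p m : Fin s → ℕ) (K X : Fin s → DynkinType),
        DirectSum.IsInternal N ∧
        (∀ i j, i ≠ j → ∀ x ∈ N i, ∀ y ∈ N j, B x y = 0) ∧
        (∀ i, 0 < p i ∧ IsScaledRootLattice B (N i) (p i) (m i) (K i)) ∧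
        (∀ i, ScreenerType (K i) (m i) (X i) ∧ IsListed (X i)) ∧
        (∀ i, IsRootSetOfType B (screeners B ∩ N i) (X i)) ∧
        screeners B = ⋃ i, screeners B ∩ N i) ∧
    -- The screeners of each rescaled simply laced root lattice `√p K`, whose roots are the
    -- elements of norm squared `2p`.
    (∀ p : ℕ, 0 < p →
      (∀ n : ℕ, 3 < n → IsScaledRootLattice B ⊤ p 1 (.A n) →
        screeners B = {x | B x x = 2 * p} ∧ IsRootSetOfType B (screeners B) (.A n)) ∧
      (∀ E : DynkinType, E = .E₆ ∨ E = .E₇ ∨ E = .E₈ → IsScaledRootLattice B ⊤ p 1 E →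
        screeners B = {x | B x x = 2 * p} ∧ IsRootSetOfType B (screeners B) E) ∧
      (IsScaledRootLattice B ⊤ p 1 (.A 2) →
        {x | B x x = 2 * p} ⊆ screeners B ∧ (screeners B \ {x | B x x = 2 * p}).encard = 6 ∧
          IsRootSetOfType B (screeners B) .G₂) ∧
      (IsScaledRootLattice B ⊤ p 1 (.A 3) →
        {x | B x x = 2 * p} ⊆ screeners B ∧ (screeners B \ {x | B x x = 2 * p}).encard = 6 ∧
          IsRootSetOfType B (screeners B) (.C 3)) ∧
      (IsScaledRootLattice B ⊤ p 1 (.D 4) →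
        {x | B x x = 2 * p} ⊆ screeners B ∧ (screeners B \ {x | B x x = 2 * p}).encard = 24 ∧
          IsRootSetOfType B (screeners B) .F₄) ∧
      (∀ n : ℕ, 4 < n → IsScaledRootLattice B ⊤ p 1 (.D n) →
        {x | B x x = 2 * p} ⊆ screeners B ∧
          (screeners B \ {x | B x x = 2 * p}).encard = 2 * n ∧
          IsRootSetOfType B (screeners B) (.C n)) ∧
      -- `n` orthogonal copies of `A₁` give the roots of `Bₙ`
      (∀ n : ℕ, 2 ≤ n → IsScaledRootLattice B ⊤ p n (.A 1) →
        IsRootSetOfType B (screeners B) (.B n))) := by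
  constructor
  · rintro ⟨S, ⟨hS, -⟩, hspan⟩
    have htop : Submodule.span ℤ (screeners B) = ⊤ :=
      top_le_iff.mp (hspan ▸ Submodule.span_mono hS)
    obtain ⟨F, hF, horth, hall⟩ := exists_components hpos hsymm heven ∅ (by simp) (by simp)
    let N : Fin F.card → Submodule ℤ L := fun i => F.equivFin.symm i
    have hN : ∀ i, N i ∈ F := fun i => (F.equivFin.symm i).2
    have hNorth : ∀ i j, i ≠ j → ∀ x ∈ N i, ∀ y ∈ N j, B x y = 0 := fun i j hij =>
      horth _ (hN i) _ (hN j) fun h => hij (F.equivFin.symm.injective (Subtype.ext h))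
    have hmem : ∀ x ∈ screeners B, ∃ i, x ∈ N i := by
      intro x hx
      obtain ⟨M, hM, hxM⟩ := hall x hx
      refine ⟨F.equivFin ⟨M, hM⟩, ?_⟩
      simpa [N] using hxM
    have hlist := fun i => (hF _ (hN i)).1
    choose p m K X hp hK hKX using hlist
    refine ⟨F.card, N, p, m, K, X, ?_, hNorth, fun i => ⟨hp i, hK i⟩,
      fun i => ⟨hKX i, (hKX i).isListed⟩, fun i => ?_, ?_⟩
    · rw [DirectSum.isInternal_submodule_iff_iSupIndep_and_iSup_eq_top]
      constructor
      · intro i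
        rw [Submodule.disjoint_def]
        intro x hx hx'
        have hle : ⨆ j, ⨆ (_ : j ≠ i), N j ≤ LinearMap.ker (B x) :=
          iSup₂_le fun j hj y hy => hNorth i j hj.symm x hx y hy
        exact eq_zero_of_form_self_nonpos hpos (le_of_eq (hle hx'))
      · rw [eq_top_iff, ← htop, Submodule.span_le]
        intro x hx
        obtain ⟨i, hi⟩ := hmem x hx
        exact Submodule.mem_iSup_of_mem i hi
    · exact (hKX i).isRootSetOfType (hp i) hpos hsymm heven
        ((hF _ (hN i)).2.isScreenerSummand htop hpos hsymm heven) (hK i)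
    · rw [← Set.inter_iUnion, eq_comm, Set.inter_eq_left]
      intro x hx
      exact Set.mem_iUnion.mpr (hmem x hx)
  · intro p hp
    have hp' : (0 : ℤ) < p := by exact_mod_cast hp
    have htop := isScreenerSummand_top hpos hsymm heven
    have hinter : screeners B ∩ ((⊤ : Submodule ℤ L) : Set L) = screeners B := by simp
    refine ⟨fun n hn h => ?_, fun E hE h => ?_, fun h => ?_, fun h => ?_, fun h => ?_,
      fun n hn h => ?_, fun n hn h => ?_⟩
    · obtain ⟨a, hli, haN, hG⟩ := h.exists_family
      simpa [hinter] using screeners_A hp' hpos hsymm heven htop hn hli haN hG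
    · obtain ⟨a, hli, haN, hG⟩ := h.exists_family
      simpa [hinter] using screeners_E hp' hpos hsymm heven htop hE hli haN hG
    · obtain ⟨a, hli, haN, hG⟩ := h.exists_family
      have ha := RootGenerators.of_cartan (t := .A 2) haN hG
      have h1 := roots_subset_screeners hp' hpos hsymm ha htop
      have h2 := encard_screeners_A₂ hp' hpos hsymm htop hli ha hG
      have h3 := screeners_A₂ hp' hpos hsymm heven htop hli ha hG
      rw [hinter] at h2 h3
      exact ⟨fun x hx => h1 ⟨Submodule.mem_top, hx⟩, h2, h3⟩
    · obtain ⟨a, hli, haN, hG⟩ := h.exists_family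
      obtain ⟨h1, h2, h3⟩ := screeners_A₃ hp' hpos hsymm heven htop hli haN hG
      rw [hinter] at h2 h3
      exact ⟨fun x hx => h1 ⟨Submodule.mem_top, hx⟩, h2, h3⟩
    · obtain ⟨a, hli, haN, hG⟩ := h.exists_family
      have ha := RootGenerators.of_cartan (t := .D 4) haN hG
      have h1 := roots_subset_screeners hp' hpos hsymm ha htop
      have h2 := encard_screeners_D₄ hp' hpos hsymm htop hli ha hG
      have h3 := screeners_D₄ hp' hpos hsymm heven htop hli ha hG
      rw [hinter] at h2 h3
      exact ⟨fun x hx => h1 ⟨Submodule.mem_top, hx⟩, h2, h3⟩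
    · obtain ⟨a, hli, haN, hG⟩ := h.exists_family
      obtain ⟨h1, h2, h3⟩ := screeners_D hp' hpos hsymm heven htop hn hli haN hG
      rw [hinter] at h2 h3
      exact ⟨fun x hx => h1 ⟨Submodule.mem_top, hx⟩, h2, h3⟩
    · have := ScreenerType.isRootSetOfType hp hpos hsymm heven htop (.A_one_copies n hn) h
      rwa [hinter] at this
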